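/- Let $h:\mathbb{R}^3\to\mathbb{R}$ be a homogeneous polynomial of degree $\tau\ge 3$. A point $p$ with $h(p)>0$ is called a hyperbolic point of $h$ if the negative Hessian $-\partial^2h_p$ has one negative and two positive eigenvalues; $\mathrm{hyp}(h)$ is the set of hyperbolic points, $\mathrm{hyp}_1(h)=\{h=1\}\cap\mathrm{hyp}(h)$, and $h$ is called hyperbolic if $\mathrm{hyp}(h)\neq\emptyset$. The surface $\mathrm{hyp}_1(h)$ carries the Riemannian metric $g=-\frac1\tau\partial^2h$ restricted to its tangent planes. A special homogeneous surface of degree $\tau$ is a non-empty surface $\mathcal H$ that is contained in $\mathrm{hyp}_1(h)$ (that is, a relatively open subset of it) for a hyperbolic polynomial $h$ of degree $\tau\ge 3$, and on which a subgroup of $\mathrm{GL}(3,\mathbb{R})$ acts transitively. The automorphism group of $h$ is $G^h=\{A\in\mathrm{GL}(3,\mathbb{R}) : h\circ A=h\}$, and $G^h_0$ is its identity component. Semidirect products below are with respect to a faithful action of the right-hand factor. **Theorem.** Let $\mathcal H\subset\{h=1\}$ be a special homogeneous surface of degree $\tau\ge3$. Among the following polynomials $\overline h$ of degree $\tau$ there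 is precisely one for which some $A\in\mathrm{GL}(3,\mathbb{R})$ maps $\mathcal H$ into $\{\overline h=1\}$; for this $\overline h$ the map $A$ can be chosen such that moreover $\overline h\circ A=h$ and $A(\mathcal H)\subset\mathrm{hyp}_1(\overline h)$: (i) for $\tau$ even, $\overline h=(x^2-y^2-z^2)^{\tau/2}$; (ii) $\overline h=(x+z)^{\tau-2k}(x^2-y^2-z^2)^k$ with $1\le k<\frac\tau2$; (iii) $\overline h=x^ay^bz^c$ with $1\le a\le b\le c\le\tau-2$ and $a+b+c=\tau$. Conversely, each of these polynomials is hyperbolic, each connected component of its hyperbolic level set $\mathrm{hyp}_1(\overline h)$ is a special homogeneous surface, on which a closed subgroup of $\mathrm{GL}(3,\mathbb{R})$ acts transitively, and the connected components of $\mathrm{hyp}_1(\overline h)$ are pairwise isometric with respect to $g$. Moreover, writing $h$ for $\overline h$: In case (i), $\mathrm{hyp}_1(h)$ has two connected components, each of them (equivariantly) homothetic to the symmetric space $\mathrm{SO}(2,1)^+/\mathrm{SO}(2)$; every hyperbolic point of $h$ has one-dimensional stabiliser in $G^h$; and $G^h=\mathrm{O}(2,1)$. In case (ii), $\mathrm{hyp}_1(h)$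 has one connected component if $\tau$ is odd and two if $\tau$ is even. The group $G^h_0$ is isomorphic to the connected two-dimensional affine Lie group $\{t\mapsto at+b : a>0,\ b\in\mathbb{R}\}$; $G^h=G^h_0\rtimes\mathbb{Z}_2$ if $\tau$ is odd, and $G^h\cong(G^h_0\times\mathbb{Z}_2)\rtimes\mathbb{Z}_2$ if $\tau$ is even. The stabiliser in $G^h$ of every hyperbolic point of $h$ is isomorphic to $\mathbb{Z}_2$. In case (iii), $\mathrm{hyp}_1(h)$ has $8$ connected components if $a,b,c$ are all even and $4$ otherwise. With $m=3$ if $a,b,c$ are all even and $m=2$ otherwise, $G^h$ is isomorphic to $\mathbb{R}^2\times\mathbb{Z}_2^m$ if $a<b<c$, to $(\mathbb{R}^2\times\mathbb{Z}_2^m)\rtimes\mathbb{Z}_2$ if $a=b<c$ or $a<b=c$, and to $(\mathbb{R}^2\times\mathbb{Z}_2^m)\rtimes S_3$ if $a=b=c$. -/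

import Mathlib

open scoped Matrix ContDiff

noncomputable section

namespace SpecialHom

/-- The ambient space `ℝ³` with coordinates `(x, y, z) = (v 0, v 1, v 2)`. -/
abbrev V : Type := Fin 3 → ℝ

/-- Real polynomials in three variables. -/
abbrev Poly : Type := MvPolynomial (Fin 3) ℝ

/-- The group `GL(3, ℝ)`. -/
abbrev GL3 : Type := GL (Fin 3) ℝ

/-- The linear action of `GL(3, ℝ)` on `ℝ³`. -/
def act (A : GL3) (v : V) : V := (A : Matrix (Fin 3) (Fin 3) ℝ) *ᵥ v

theorem act_one (v : V) : act 1 v = v := by simp [act]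

theorem act_mul (A B : GL3) (v : V) : act (A * B) v = act A (act B v) := by
  simp [act, Matrix.mulVec_mulVec]

theorem act_act_inv (A : GL3) (v : V) : act A (act A⁻¹ v) = v := by
  rw [← act_mul, mul_inv_cancel, act_one]

/-! ### Hyperbolic polynomials and special homogeneous surfaces -/

/-- The Hessian matrix `∂²h_p`. -/
def hessian (h : Poly) (p : V) : Matrix (Fin 3) (Fin 3) ℝ :=
  Matrix.of fun i j => MvPolynomial.eval p (MvPolynomial.pderiv i (MvPolynomial.pderiv j h))

/-- A real symmetric `3 × 3` matrix with one negative and two positive eigenvalues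
(counted with multiplicity). -/
def IsMinkowski (M : Matrix (Fin 3) (Fin 3) ℝ) : Prop :=
  ∃ hM : M.IsHermitian,
    {i | hM.eigenvalues i < 0}.ncard = 1 ∧ {i | 0 < hM.eigenvalues i}.ncard = 2

/-- The set `hyp(h)` of hyperbolic points of `h`. -/
def hyp (h : Poly) : Set V :=
  {p | 0 < MvPolynomial.eval p h ∧ IsMinkowski (-hessian h p)}

/-- The hyperbolic level set `hyp₁(h) = {h = 1} ∩ hyp(h)`. -/
def hyp₁ (h : Poly) : Set V := {p | MvPolynomial.eval p h = 1} ∩ hyp h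

/-- `h` is a hyperbolic homogeneous polynomial of degree `τ`. -/
def IsHyperbolic (τ : ℕ) (h : Poly) : Prop := h.IsHomogeneous τ ∧ (hyp h).Nonempty

/-- `H` is a (non-empty) hypersurface in the hyperbolic level set of a hyperbolic polynomial `h` of
degree `τ ≥ 3`. Since `hyp₁(h)` is itself a smooth surface, its two-dimensional submanifolds are
its relatively open subsets. -/
structure IsGPSRSurface (τ : ℕ) (h : Poly) (H : Set V) : Prop where
  three_le : 3 ≤ τ
  hyperbolic : IsHyperbolic τ h
  nonempty : H.Nonempty
  relOpen : ∃ U : Set V, IsOpen U ∧ H = U ∩ hyp₁ h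

/-- The subgroup `G` of `GL(3, ℝ)` preserves `H` and acts transitively on it. -/
def ActsTransitivelyOn (G : Subgroup GL3) (H : Set V) : Prop :=
  (∀ A ∈ G, ∀ p ∈ H, act A p ∈ H) ∧ ∀ p ∈ H, ∀ q ∈ H, ∃ A ∈ G, act A p = q

/-- A special homogeneous surface: some linear group acts transitively on it. No topological
condition is put on the group, so immersed as well as closed Lie subgroups are covered. -/
def IsSpecialHomogeneousSurface (τ : ℕ) (h : Poly) (H : Set V) : Prop :=
  IsGPSRSurface τ h H ∧ ∃ G : Subgroup GL3, ActsTransitivelyOn G H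

/-! ### The centro-affine metric -/

/-- The bilinear form `-(1/τ) ∂²h_p`, whose restriction to tangent vectors is the
centro-affine metric. -/
def metric (τ : ℕ) (h : Poly) (p v w : V) : ℝ :=
  -(1 / (τ : ℝ)) * (v ⬝ᵥ (hessian h p *ᵥ w))

/-- `v` is tangent at `p` to the level set of `h` through `p`, that is `dh_p(v) = 0`. -/
def IsTangent (h : Poly) (p v : V) : Prop :=
  ∑ i, MvPolynomial.eval p (MvPolynomial.pderiv i h) * v i = 0

/-- `C` and `D`, open pieces of `hyp₁(h)`, are isometric for the centro-affine metric: there are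
mutually inverse smooth maps between them (given by smooth maps on open neighbourhoods)
that preserve the metric. -/
def AreIsometric (τ : ℕ) (h : Poly) (C D : Set V) : Prop :=
  ∃ (F F' : V → V) (U U' : Set V),
    IsOpen U ∧ IsOpen U' ∧ C ⊆ U ∧ D ⊆ U' ∧
    ContDiffOn ℝ ∞ F U ∧ ContDiffOn ℝ ∞ F' U' ∧
    Set.MapsTo F C D ∧ Set.MapsTo F' D C ∧
    (∀ p ∈ C, F' (F p) = p) ∧ (∀ q ∈ D, F (F' q) = q) ∧
    ∀ p ∈ C, ∀ v w : V, IsTangent h p v → IsTangent h p w →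
      metric τ h (F p) (fderiv ℝ F p v) (fderiv ℝ F p w) = metric τ h p v w

/-! ### Automorphism groups -/

/-- The automorphism group `G^h` of `h`: all linear transformations that leave `h` invariant. -/
def autGroup (h : Poly) : Subgroup GL3 where
  carrier := {A | ∀ v, MvPolynomial.eval (act A v) h = MvPolynomial.eval v h}
  one_mem' := fun v => by rw [act_one]
  mul_mem' := fun {A B} hA hB v => by rw [act_mul, hA, hB]
  inv_mem' := fun {A} hA v => by rw [← hA (act A⁻¹ v), act_act_inv]

/-- The stabiliser of the point `p` in `G^h`. -/
def stab (h : Poly) (p : V) : Subgroup GL3 where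
  carrier := {A | A ∈ autGroup h ∧ act A p = p}
  one_mem' := ⟨one_mem _, act_one p⟩
  mul_mem' := fun {A B} hA hB => ⟨mul_mem hA.1 hB.1, by rw [act_mul, hB.2, hA.2]⟩
  inv_mem' := fun {A} hA => ⟨inv_mem hA.1, by
    conv_lhs => rw [← hA.2]
    rw [← act_mul, inv_mul_cancel, act_one]⟩

/-- The dimension of a closed subgroup `S` of `GL(3, ℝ)` as a Lie group, that is, of its
Lie algebra `{X | exp (t X) ∈ S for all t}`. -/
def lieDim (S : Subgroup GL3) : ℕ :=
  Module.finrank ℝ (Submodule.span ℝ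
    {X : Matrix (Fin 3) (Fin 3) ℝ |
      ∀ t : ℝ, ∃ A ∈ S, (A : Matrix (Fin 3) (Fin 3) ℝ) = NormedSpace.exp (t • X)})

/-- The group `G` is the (internal) semidirect product of the normal subgroup `N` with the
subgroup `K`, which acts faithfully on `N` by conjugation. -/
def IsSemidirect {G : Type} [Group G] (N K : Subgroup G) : Prop :=
  N.Normal ∧ N.IsComplement' K ∧ ∀ k ∈ K, (∀ n ∈ N, k * n = n * k) → k = 1

/-- The group with two elements; as a unit group it carries the discrete topology. -/
abbrev Z₂ : Type := ℤˣ

/-- The group `ℝ² × Z₂ᵐ`. -/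
abbrev FlatGroup (m : ℕ) : Type := Multiplicative (ℝ × ℝ) × (Fin m → Z₂)

/-- The (connected) two-dimensional affine Lie group of the maps `t ↦ a t + b` with `a > 0`,
as the group of matrices with rows `(a, b)` and `(0, 1)`. -/
def affineGroup : Subgroup (GL (Fin 2) ℝ) where
  carrier := {A | ∃ a b : ℝ, 0 < a ∧ (A : Matrix (Fin 2) (Fin 2) ℝ) = !![a, b; 0, 1]}
  one_mem' := ⟨1, 0, one_pos, by simp [Matrix.one_fin_two]⟩
  mul_mem' := by
    rintro A B ⟨a, b, ha, hA⟩ ⟨c, d, hc, hB⟩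
    exact ⟨a * c, a * d + b, mul_pos ha hc, by simp [hA, hB]⟩
  inv_mem' := by
    rintro A ⟨a, b, ha, hA⟩
    refine ⟨a⁻¹, -(a⁻¹ * b), inv_pos.2 ha, ?_⟩
    rw [Matrix.coe_units_inv, hA]
    refine Matrix.inv_eq_right_inv ?_
    simp [Matrix.one_fin_two, ha.ne']

/-! ### The Lorentz group and `SO(2,1)⁺ / SO(2)` -/

/-- The symmetric bilinear form of signature `(2, 1)` on `ℝ³`. -/
def minkForm (v w : V) : ℝ := -(v 0 * w 0) + v 1 * w 1 + v 2 * w 2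

/-- The group `O(2,1)`. -/
def O21 : Subgroup GL3 where
  carrier := {A | ∀ v w, minkForm (act A v) (act A w) = minkForm v w}
  one_mem' := fun v w => by rw [act_one, act_one]
  mul_mem' := fun {A B} hA hB v w => by rw [act_mul, act_mul, hA, hB]
  inv_mem' := fun {A} hA v w => by
    rw [← hA (act A⁻¹ v), act_act_inv, act_act_inv]

/-- The group `SO(2,1)⁺` of all elements of `O(2,1)` that have determinant one and preserve the
time orientation. -/
def SO21p : Subgroup GL3 where
  carrier := {A | A ∈ O21 ∧ (A : Matrix (Fin 3) (Fin 3) ℝ).det = 1 ∧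
    ∀ v, minkForm v v < 0 → (0 < act A v 0 ↔ 0 < v 0)}
  one_mem' := ⟨one_mem _, by simp, fun v _ => by rw [act_one]⟩
  mul_mem' := fun {A B} hA hB => ⟨mul_mem hA.1 hB.1, by
      rw [Units.val_mul, Matrix.det_mul, hA.2.1, hB.2.1, one_mul], fun v hv => by
      rw [act_mul, hA.2.2 _ (by rw [hB.1]; exact hv), hB.2.2 v hv]⟩
  inv_mem' := fun {A} hA => ⟨inv_mem hA.1, by
      rw [Matrix.coe_units_inv, Matrix.det_nonsing_inv, hA.2.1, Ring.inverse_one], fun v hv => by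
      rw [← hA.2.2 _ (by rw [inv_mem hA.1]; exact hv), act_act_inv]⟩

/-- The subgroup `SO(2)` of `SO(2,1)⁺`: rotations in the last two coordinates. -/
def SO2 : Subgroup SO21p where
  carrier := {A | ∃ θ : ℝ, ((A : GL3) : Matrix (Fin 3) (Fin 3) ℝ) =
    !![1, 0, 0; 0, Real.cos θ, -Real.sin θ; 0, Real.sin θ, Real.cos θ]}
  one_mem' := ⟨0, by simp [Matrix.one_fin_three]⟩
  mul_mem' := by
    rintro A B ⟨s, hA⟩ ⟨t, hB⟩
    refine ⟨s + t, ?_⟩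
    rw [Subgroup.coe_mul, Units.val_mul, hA, hB, Real.cos_add, Real.sin_add]
    ext i j
    fin_cases i <;> fin_cases j <;> simp [Matrix.mul_apply, Fin.sum_univ_three] <;> ring
  inv_mem' := by
    rintro A ⟨s, hA⟩
    refine ⟨-s, ?_⟩
    rw [Subgroup.coe_inv, Matrix.coe_units_inv, hA]
    refine Matrix.inv_eq_right_inv ?_
    have e := Real.sin_sq_add_cos_sq s
    ext i j
    fin_cases i <;> fin_cases j <;> simp [Matrix.mul_apply, Fin.sum_univ_three] <;> nlinarith

/-- The Lie algebra `so(2,1)`. -/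
def so21 : Set (Matrix (Fin 3) (Fin 3) ℝ) :=
  {X | ∀ v w, minkForm (X *ᵥ v) w + minkForm v (X *ᵥ w) = 0}

/-- The projection of `so(2,1) = so(2) ⊕ 𝔪` onto the complement `𝔪` of symmetric matrices. -/
def symPart (Z : Matrix (Fin 3) (Fin 3) ℝ) : Matrix (Fin 3) (Fin 3) ℝ := (1 / 2 : ℝ) • (Z + Zᵀ)

/-- The canonical invariant Riemannian metric of the symmetric space `SO(2,1)⁺ / SO(2)`: its value
at the coset of `g` on the velocities at `t = 0` of the curves `exp (t X) g SO(2)` and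
`exp (t Y) g SO(2)`. On `𝔪`, the tangent space at the base point, it is half the trace form. -/
def symmetricMetric (g : SO21p) (X Y : Matrix (Fin 3) (Fin 3) ℝ) : ℝ :=
  (1 / 2) * Matrix.trace
    (symPart (((g⁻¹ : SO21p) : GL3).val * X * (g : GL3).val) *
      symPart (((g⁻¹ : SO21p) : GL3).val * Y * (g : GL3).val))

/-- `C ⊆ hyp₁(h)` with its centro-affine metric is homothetic to `SO(2,1)⁺ / SO(2)`, by an
equivariant map `φ`. An equivariant homeomorphism is a diffeomorphism, and it sends the velocity of
`exp (t X) g SO(2)` to the vector `X φ(g SO(2))`. -/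
def IsHomotheticToSO21ModSO2 (τ : ℕ) (h : Poly) (C : Set V) : Prop :=
  ∃ (c : ℝ) (φ : (SO21p ⧸ SO2) ≃ₜ C), 0 < c ∧
    (∀ (g : SO21p) (x : SO21p ⧸ SO2), (φ (g • x) : V) = act g (φ x)) ∧
    ∀ (g : SO21p), ∀ X ∈ so21, ∀ Y ∈ so21,
      metric τ h (φ (g : SO21p ⧸ SO2)) (X *ᵥ (φ (g : SO21p ⧸ SO2) : V))
        (Y *ᵥ (φ (g : SO21p ⧸ SO2) : V)) = c * symmetricMetric g X Y

/-! ### The normal forms -/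

/-- The quadratic form `x² - y² - z²`. -/
def quad : Poly := MvPolynomial.X 0 ^ 2 - MvPolynomial.X 1 ^ 2 - MvPolynomial.X 2 ^ 2

/-- `(x² - y² - z²)^(τ/2)`, used for even `τ`. -/
def lorentzPoly (τ : ℕ) : Poly := quad ^ (τ / 2)

/-- `(x + z)^(τ - 2k) (x² - y² - z²)^k`, used for `2 k < τ`. -/
def affinePoly (τ k : ℕ) : Poly := (MvPolynomial.X 0 + MvPolynomial.X 2) ^ (τ - 2 * k) * quad ^ k

/-- `x^a y^b z^c`. -/
def flatPoly (a b c : ℕ) : Poly :=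
  MvPolynomial.X 0 ^ a * MvPolynomial.X 1 ^ b * MvPolynomial.X 2 ^ c

/-- The list of normal forms in degree `τ`. -/
inductive NormalForm (τ : ℕ) : Type
  | lorentz (hτ : Even τ) : NormalForm τ
  | affine (k : ℕ) (hk : 1 ≤ k) (hkτ : 2 * k < τ) : NormalForm τ
  | flat (a b c : ℕ) (ha : 1 ≤ a) (hab : a ≤ b) (hbc : b ≤ c) (hc : c ≤ τ - 2)
      (habc : a + b + c = τ) : NormalForm τ

/-- The polynomial of a normal form. -/
def NormalForm.poly {τ : ℕ} : NormalForm τ → Poly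
  | .lorentz _ => lorentzPoly τ
  | .affine k _ _ => affinePoly τ k
  | .flat a b c _ _ _ _ _ => flatPoly a b c

end SpecialHom

end

noncomputable section

namespace SpecialHom

open MvPolynomial Filter Topology

-- The surface determines the polynomial: a homogeneous polynomial of the same degree that equals
-- one on a relatively open piece of `hyp₁ h` agrees with `h` along the rays through that piece,
-- hence everywhere (`eq_of_eq_one_on_surface`). So a group acting on the surface consists of
-- automorphisms of `h`, and a linear map of the surface into another level set intertwines the two
-- polynomials. The classification thereby becomes algebraic.
--
-- Nothing is assumed about the group, so transitivity is made infinitesimal by compactness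
-- (`exists_mem_lieAlg_mulVec_eq`). Automorphisms that move a base point to nearby points respect a
-- positive definite form built from the Hessian and stay bounded; limits of rescaled differences
-- are linear fields annihilating `h`, with every prescribed tangent velocity. In coordinates
-- adapted to the Hessian, two derivatives of the invariance identity show that the isotropy is at
-- most an infinitesimal rotation and reduce two spanning fields to the four coefficients of a
-- binary cubic and two skew parts. Closure under brackets gives quadratic equations for these six
-- numbers. Up to a rotation the solutions are an abelian algebra, diagonal in suitable coordinates,
-- and a non-abelian one spanned by a diagonal and a nilpotent matrix (`exists_rot_alg`).
--
-- The invariants are then found by hand. Two diagonal fields and the degree leave a single monomial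
-- (`eq_flatPoly_of_mem_lieAlg`). In the non-abelian case the diagonal field leaves one monomial on
-- a plane and the nilpotent flow spreads it over space, which yields a power of a linear form times
-- a power of a Lorentzian quadratic form (`eq_of_mem_lieAlg_nilp`). Degenerate exponents are
-- excluded because the Hessian would be singular everywhere.
--
-- Inequivalence and the automorphism groups both come from matching factors: a linear map between
-- normal forms has to match their linear factors, because the quadratic form vanishes on no plane
-- (`exists_perm_of_flat`, `nullForm_pow_eq`, `exists_quadForm_smul`).
--
-- Conversely, logarithmic derivatives make the Hessians of the normal forms explicit
-- (`mem_hyp_flatPoly`, `mem_hyp_affinePoly`). The hyperbolic sets are unions of convex cones, whose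
-- number is that of the components of `hyp₁`, and explicit automorphisms act transitively on the
-- whole level set.

/-- Real `3 × 3` matrices. -/
abbrev M3 : Type := Matrix (Fin 3) (Fin 3) ℝ

/-! ### Signature `(2, 1)` -/

theorem dotProduct_mulVec_eq_sum_eigenvalues {M : M3} (hM : M.IsHermitian) (v : V) :
    v ⬝ᵥ (M *ᵥ v) = ∑ i, hM.eigenvalues i *
      (((star (hM.eigenvectorUnitary : M3)) *ᵥ v) i) ^ 2 := by
  set U : M3 := (hM.eigenvectorUnitary : M3) with hU
  have h := hM.spectral_theorem
  rw [Unitary.conjStarAlgAut_apply] at h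
  conv_lhs => rw [h]
  rw [← Matrix.mulVec_mulVec, ← Matrix.mulVec_mulVec, Matrix.dotProduct_mulVec]
  have e : v ᵥ* U = star U *ᵥ v := by
    rw [Matrix.star_eq_conjTranspose, Matrix.conjTranspose_eq_transpose_of_trivial,
      Matrix.mulVec_transpose]
  rw [← hU, e, dotProduct]
  refine Finset.sum_congr rfl fun i _ => ?_
  rw [Matrix.mulVec_diagonal]
  simp [hU]
  ring

/-- In dimension three a negative determinant leaves one or three negative eigenvalues and no zero
one, and a vector of positive square excludes three. The criterion avoids eigenvalues, so it can be
checked by polynomial identities and is visibly open. -/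
theorem isMinkowski_iff {M : M3} :
    IsMinkowski M ↔ M.IsHermitian ∧ M.det < 0 ∧ ∃ v : V, 0 < v ⬝ᵥ (M *ᵥ v) := by
  constructor
  · rintro ⟨hM, h1, h2⟩
    obtain ⟨i, hi⟩ := Set.ncard_eq_one.1 h1
    have hd : {i | hM.eigenvalues i < 0} ∪ {i | 0 < hM.eigenvalues i} = Set.univ := by
      refine Set.eq_univ_of_forall fun j => ?_
      by_contra hj
      have hdis : Disjoint {i | hM.eigenvalues i < 0} {i | 0 < hM.eigenvalues i} :=
        Set.disjoint_left.2 fun a ha hb => lt_asymm (show hM.eigenvalues a < 0 from ha) hb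
      have h3 := Set.ncard_union_eq hdis (Set.toFinite _) (Set.toFinite _)
      rw [h1, h2] at h3
      have h4 : ({i | hM.eigenvalues i < 0} ∪ {i | 0 < hM.eigenvalues i}) = Set.univ := by
        refine Set.eq_of_subset_of_ncard_le (Set.subset_univ _) ?_ (Set.toFinite _)
        rw [h3, Set.ncard_univ]; simp
      exact hj (h4 ▸ Set.mem_univ j)
    have hneg : i ∈ {i | hM.eigenvalues i < 0} := hi ▸ Set.mem_singleton i
    replace hneg : hM.eigenvalues i < 0 := hneg
    have hpos : ∀ j, j ≠ i → 0 < hM.eigenvalues j := by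
      intro j hj
      have := hd.symm ▸ Set.mem_univ j
      rw [hi] at this
      rcases this with h | h
      · exact absurd h hj
      · exact h
    refine ⟨hM, ?_, ?_⟩
    · have h := hM.det_eq_prod_eigenvalues
      rw [h, ← Finset.mul_prod_erase _ _ (Finset.mem_univ i)]
      refine mul_neg_of_neg_of_pos (by simpa using hneg) (Finset.prod_pos fun j hj => ?_)
      simpa using hpos j (Finset.ne_of_mem_erase hj)
    · obtain ⟨j, hj⟩ := exists_ne i
      refine ⟨(hM.eigenvectorUnitary : M3) *ᵥ Pi.single j 1, ?_⟩
      rw [dotProduct_mulVec_eq_sum_eigenvalues hM, Matrix.mulVec_mulVec,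
        Unitary.coe_star_mul_self, Matrix.one_mulVec, Finset.sum_eq_single j]
      · simpa using hpos j hj
      · intro b _ hb; simp [hb]
      · simp
  · rintro ⟨hM, hdet, v, hv⟩
    rw [dotProduct_mulVec_eq_sum_eigenvalues hM] at hv
    have h := hM.det_eq_prod_eigenvalues
    simp only [RCLike.ofReal_real_eq_id, id] at h
    rw [h, Fin.prod_univ_three] at hdet
    rw [Fin.sum_univ_three] at hv
    refine ⟨hM, ?_⟩
    generalize hM.eigenvalues = l at *
    generalize (star (hM.eigenvectorUnitary : M3)) *ᵥ v = w at *
    have key : ∃ i, l i < 0 ∧ ∀ j, j ≠ i → 0 < l j := by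
      rcases lt_trichotomy (l 0) 0 with h0 | h0 | h0 <;>
      rcases lt_trichotomy (l 1) 0 with h1 | h1 | h1 <;>
      rcases lt_trichotomy (l 2) 0 with h2 | h2 | h2 <;>
      first
      | (exfalso; simp [h0, h1, h2] at hdet)
      | (exfalso
         nlinarith [mul_nonneg (neg_nonneg.2 h0.le) (sq_nonneg (w 0)),
          mul_nonneg (neg_nonneg.2 h1.le) (sq_nonneg (w 1)),
          mul_nonneg (neg_nonneg.2 h2.le) (sq_nonneg (w 2))])
      | (exfalso; have := mul_pos (mul_pos h0 h1) h2; linarith)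
      | (exfalso; have := mul_pos (mul_pos_of_neg_of_neg h0 h1) h2; linarith)
      | (exfalso; have := mul_pos_of_neg_of_neg (mul_neg_of_neg_of_pos h0 h1) h2; linarith)
      | (exfalso; have := mul_pos_of_neg_of_neg (mul_neg_of_pos_of_neg h0 h1) h2; linarith)
      | exact ⟨0, h0, fun j hj => by fin_cases j <;> first | exact absurd rfl hj | assumption⟩
      | exact ⟨1, h1, fun j hj => by fin_cases j <;> first | exact absurd rfl hj | assumption⟩
      | exact ⟨2, h2, fun j hj => by fin_cases j <;> first | exact absurd rfl hj | assumption⟩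
    obtain ⟨i, hi, hj⟩ := key
    have e1 : {j | l j < 0} = {i} := by
      ext j
      refine ⟨fun h => ?_, fun h => by rw [Set.mem_singleton_iff.1 h]; exact hi⟩
      by_contra hne
      exact lt_asymm h (hj j hne)
    have e2 : {j | 0 < l j} = {i}ᶜ := by
      ext j
      refine ⟨fun h hji => ?_, fun h => hj j h⟩
      rw [Set.mem_singleton_iff.1 hji] at h
      exact lt_asymm h hi
    refine ⟨by rw [e1, Set.ncard_singleton], ?_⟩
    rw [e2, Set.ncard_compl, Set.ncard_singleton]
    simp

/-! ### Linear substitutions and linear vector fields -/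

/-- The `i`-th coordinate of the linear map with matrix `M`. -/
def linForm (M : M3) (i : Fin 3) : Poly := ∑ j, C (M i j) * X j

/-- The substitution `h ↦ h ∘ M`. -/
def subst (M : M3) : Poly →ₐ[ℝ] Poly := aeval (linForm M)

/-- The derivation given by the linear vector field `v ↦ M v`. -/
def lieDer (M : M3) : Derivation ℝ Poly Poly := mkDerivation ℝ (linForm M)

@[simp] theorem eval_linForm (M : M3) (i : Fin 3) (v : V) : eval v (linForm M i) = (M *ᵥ v) i := by
  simp [linForm, Matrix.mulVec, dotProduct]

@[simp] theorem eval_subst (M : M3) (h : Poly) (v : V) : eval v (subst M h) = eval (M *ᵥ v) h := by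
  induction h using MvPolynomial.induction_on with
  | C a => simp [subst]
  | add p q hp hq => rw [map_add, map_add, map_add, hp, hq]
  | mul_X p i hp => rw [map_mul, map_mul, map_mul, hp]; simp [subst]

@[simp] theorem lieDer_X (M : M3) (i : Fin 3) : lieDer M (X i) = linForm M i := by simp [lieDer]

theorem lieDer_apply (M : M3) (h : Poly) : lieDer M h = ∑ i, linForm M i * pderiv i h := by
  have : lieDer M = linForm M 0 • pderiv 0 + linForm M 1 • pderiv 1 + linForm M 2 • pderiv 2 := by
    refine derivation_ext fun i => ?_
    fin_cases i <;> simp [pderiv_X]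
  rw [this, Fin.sum_univ_three]
  simp

theorem eval_lieDer (M : M3) (h : Poly) (v : V) :
    eval v (lieDer M h) = ∑ i, (M *ᵥ v) i * eval v (pderiv i h) := by
  simp [lieDer_apply]

theorem lieDer_add (M N : M3) : lieDer (M + N) = lieDer M + lieDer N :=
  derivation_ext fun i => by simp [linForm, add_mul, Finset.sum_add_distrib]

theorem lieDer_smul (c : ℝ) (M : M3) : lieDer (c • M) = c • lieDer M :=
  derivation_ext fun i => by
    simp [linForm, Finset.smul_sum, smul_eq_C_mul, mul_assoc]

theorem lieDer_linForm (M N : M3) (i : Fin 3) : lieDer M (linForm N i) = linForm (N * M) i := by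
  have : lieDer M (linForm N i) = ∑ j, C (N i j) * linForm M j := by
    rw [linForm, map_sum]
    exact Finset.sum_congr rfl fun j _ => by
      rw [Derivation.leibniz, derivation_C, lieDer_X]; simp
  rw [this]
  simp only [linForm, Matrix.mul_apply, Finset.mul_sum, Finset.sum_mul, map_sum, map_mul]
  rw [Finset.sum_comm]
  simp [mul_assoc]

/-- The order is reversed because differentiating the coordinates of `N` along the field of `M`
gives the coordinates of `N * M`. -/
theorem lie_lieDer (M N : M3) : ⁅lieDer M, lieDer N⁆ = lieDer (N * M - M * N) :=
  derivation_ext fun i => by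
    rw [Derivation.commutator_apply, lieDer_X, lieDer_X, lieDer_X, lieDer_linForm, lieDer_linForm]
    simp [linForm, sub_mul]

/-- The Lie algebra of infinitesimal linear automorphisms of `h`. -/
def lieAlg (h : Poly) : Submodule ℝ M3 where
  carrier := {M | lieDer M h = 0}
  zero_mem' := by simp [lieDer_apply, linForm]
  add_mem' := fun {M N} (hM : _ = 0) (hN : _ = 0) => by
    simp [lieDer_add, hM, hN]
  smul_mem' := fun c M (hM : _ = 0) => by simp [lieDer_smul, hM]

theorem mem_lieAlg {h : Poly} {M : M3} : M ∈ lieAlg h ↔ lieDer M h = 0 := Iff.rfl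

theorem mem_lieAlg_iff {h : Poly} {M : M3} :
    M ∈ lieAlg h ↔ ∀ v, ∑ i, (M *ᵥ v) i * eval v (pderiv i h) = 0 := by
  rw [mem_lieAlg]
  refine ⟨fun e v => by rw [← eval_lieDer, e, map_zero], fun e => MvPolynomial.funext fun v => ?_⟩
  rw [eval_lieDer, e, map_zero]

theorem commutator_mem_lieAlg {h : Poly} {M N : M3} (hM : M ∈ lieAlg h) (hN : N ∈ lieAlg h) :
    M * N - N * M ∈ lieAlg h := by
  rw [mem_lieAlg] at *
  rw [← lie_lieDer, Derivation.commutator_apply, hM, hN]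
  simp

theorem pderiv_subst (S : M3) (i : Fin 3) (h : Poly) :
    pderiv i (subst S h) = ∑ k, C (S k i) * subst S (pderiv k h) := by
  induction h using MvPolynomial.induction_on with
  | C a => simp [subst]
  | add p q hp hq => simp [hp, hq, mul_add, Finset.sum_add_distrib]
  | mul_X p j hp =>
    have h1 : pderiv i (linForm S j) = C (S j i) := by
      simp only [linForm, map_sum, pderiv_C_mul, pderiv_X]
      rw [Finset.sum_eq_single i] <;> simp +contextual [eq_comm]
    have h2 : subst S (X j) = linForm S j := by simp [subst]
    simp only [map_mul, h2, pderiv_mul, hp, h1, pderiv_X, map_add, mul_add, Finset.sum_add_distrib,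
      Finset.sum_mul]
    congr 1
    · exact Finset.sum_congr rfl fun k _ => by ring
    · rw [Finset.sum_eq_single j]
      · simp; ring
      · intro b _ hb; simp [hb.symm]
      · simp

theorem subst_subst (S T : M3) (h : Poly) : subst S (subst T h) = subst (T * S) h :=
  MvPolynomial.funext fun v => by simp [Matrix.mulVec_mulVec]

@[simp] theorem subst_one (h : Poly) : subst 1 h = h :=
  MvPolynomial.funext fun v => by simp

/-- The hypothesis says that `S` carries the linear field of `N` to that of `M`, so this is the
naturality of derivations under pullback. In this form `S` need not be invertible. -/
theorem lieDer_subst {S M N : M3} (hS : S * N = M * S) (h : Poly) :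
    lieDer N (subst S h) = subst S (lieDer M h) := by
  refine MvPolynomial.funext fun v => ?_
  rw [eval_lieDer, eval_subst, eval_lieDer, Matrix.mulVec_mulVec, ← hS, ← Matrix.mulVec_mulVec]
  simp only [pderiv_subst, map_sum, map_mul, eval_C, eval_subst, Finset.mul_sum]
  rw [Finset.sum_comm]
  refine Finset.sum_congr rfl fun k _ => ?_
  rw [Matrix.mulVec, dotProduct, Finset.sum_mul]
  exact Finset.sum_congr rfl fun k _ => by ring

theorem mem_lieAlg_subst {S M N : M3} (hS : S * N = M * S) {h : Poly} (hM : M ∈ lieAlg h) :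
    N ∈ lieAlg (subst S h) := by
  rw [mem_lieAlg] at *
  rw [lieDer_subst hS, hM, map_zero]

theorem pderiv_comm (i j : Fin 3) (h : Poly) : pderiv i (pderiv j h) = pderiv j (pderiv i h) := by
  have : ⁅pderiv (R := ℝ) i, pderiv (R := ℝ) j⁆ = (0 : Derivation ℝ Poly Poly) :=
    derivation_ext fun k => by
      rw [Derivation.commutator_apply]
      simp [pderiv_X, Pi.single_apply, apply_ite (pderiv _)]
  have h2 := congrArg (fun D => D h) this
  simp only [Derivation.commutator_apply, Derivation.coe_zero, Pi.zero_apply] at h2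
  exact sub_eq_zero.1 h2

theorem hessian_isSymm (h : Poly) (p : V) : (hessian h p)ᵀ = hessian h p := by
  ext i j
  simp only [hessian, Matrix.transpose_apply, Matrix.of_apply]
  rw [pderiv_comm]

theorem hessian_isHermitian (h : Poly) (p : V) : (-hessian h p).IsHermitian := by
  rw [Matrix.IsHermitian, Matrix.conjTranspose_eq_transpose_of_trivial, Matrix.transpose_neg,
    hessian_isSymm]

theorem hessian_subst (S : M3) (h : Poly) (p : V) :
    hessian (subst S h) p = Sᵀ * hessian h (S *ᵥ p) * S := by
  ext i j
  simp only [hessian, Matrix.of_apply, pderiv_subst, map_sum, pderiv_C_mul, Matrix.mul_apply,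
    Matrix.transpose_apply, map_mul, eval_C, eval_subst, Finset.sum_mul, Finset.mul_sum]
  exact Finset.sum_congr rfl fun k _ => Finset.sum_congr rfl fun k _ => by ring

theorem mem_hyp_iff {h : Poly} {p : V} : p ∈ hyp h ↔
    0 < eval p h ∧ (-hessian h p).det < 0 ∧ ∃ v : V, 0 < v ⬝ᵥ ((-hessian h p) *ᵥ v) := by
  rw [hyp, Set.mem_ofPred_eq, isMinkowski_iff, and_iff_right (hessian_isHermitian h p)]

/-- The Hessian changes by congruence: its determinant is multiplied by a positive square, and the
values of its quadratic form are only reparametrised. -/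
theorem mem_hyp_subst_iff {S : M3} (hS : S.det ≠ 0) {h : Poly} {p : V} :
    p ∈ hyp (subst S h) ↔ S *ᵥ p ∈ hyp h := by
  have hu : IsUnit S.det := isUnit_iff_ne_zero.2 hS
  have e : -hessian (subst S h) p = Sᵀ * (-hessian h (S *ᵥ p)) * S := by
    rw [hessian_subst]; simp
  have e2 : ∀ v : V, v ⬝ᵥ ((-hessian (subst S h) p) *ᵥ v) =
      (S *ᵥ v) ⬝ᵥ ((-hessian h (S *ᵥ p)) *ᵥ (S *ᵥ v)) := by
    intro v
    rw [e, ← Matrix.mulVec_mulVec, ← Matrix.mulVec_mulVec, Matrix.dotProduct_mulVec v,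
      Matrix.vecMul_transpose]
  rw [mem_hyp_iff, mem_hyp_iff, eval_subst]
  refine and_congr Iff.rfl (and_congr ?_ ?_)
  · rw [e, Matrix.det_mul, Matrix.det_mul, Matrix.det_transpose]
    have : 0 < S.det * S.det := mul_self_pos.2 hS
    constructor
    · intro h; by_contra h2; push Not at h2; nlinarith [mul_nonneg this.le h2]
    · intro h; nlinarith [mul_neg_of_pos_of_neg this h]
  · constructor
    · rintro ⟨v, hv⟩; exact ⟨S *ᵥ v, by rwa [← e2]⟩
    · rintro ⟨v, hv⟩
      refine ⟨S⁻¹ *ᵥ v, ?_⟩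
      rw [e2, Matrix.mulVec_mulVec, Matrix.mul_nonsing_inv _ hu, Matrix.one_mulVec]
      exact hv

theorem mem_autGroup_iff {h : Poly} {A : GL3} : A ∈ autGroup h ↔ subst A.val h = h :=
  ⟨fun e => MvPolynomial.funext fun v => by rw [eval_subst]; exact e v, fun e v => by
    conv_rhs => rw [← e]
    rw [eval_subst]; rfl⟩

theorem det_ne_zero (A : GL3) : A.val.det ≠ 0 := by
  have := A.isUnit
  rw [Matrix.isUnit_iff_isUnit_det] at this
  exact this.ne_zero

theorem act_mem_hyp {h : Poly} {A : GL3} (hA : A ∈ autGroup h) {p : V} :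
    act A p ∈ hyp h ↔ p ∈ hyp h := by
  conv_rhs => rw [← mem_autGroup_iff.1 hA]
  exact (mem_hyp_subst_iff (det_ne_zero A)).symm

theorem act_mem_hyp₁ {h : Poly} {A : GL3} (hA : A ∈ autGroup h) {p : V} :
    act A p ∈ hyp₁ h ↔ p ∈ hyp₁ h := by
  rw [hyp₁, Set.mem_inter_iff, Set.mem_inter_iff, act_mem_hyp hA, Set.mem_ofPred_eq,
    Set.mem_ofPred_eq, hA p]

/-! ### Homogeneous polynomials -/

theorem hasFDerivAt_eval (h : Poly) (v : V) :
    HasFDerivAt (fun w : V => eval w h)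
      (∑ i, eval v (pderiv i h) • (ContinuousLinearMap.proj i : V →L[ℝ] ℝ)) v := by
  induction h using MvPolynomial.induction_on with
  | C a => simpa using hasFDerivAt_const a v
  | add p q hp hq =>
    simp only [map_add, add_smul, Finset.sum_add_distrib]
    exact hp.add hq
  | mul_X p j hp =>
    have h1 : HasFDerivAt (fun w : V => w j) (ContinuousLinearMap.proj j : V →L[ℝ] ℝ) v :=
      (ContinuousLinearMap.proj j : V →L[ℝ] ℝ).hasFDerivAt
    have h2 := hp.mul h1
    simp only [map_mul, eval_X]
    convert! h2 using 1
    ext w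
    simp only [pderiv_mul, pderiv_X, map_add, map_mul, eval_X, FunLike.coe_sum,
      Finset.sum_apply, FunLike.coe_smul, Pi.smul_apply, ContinuousLinearMap.proj_apply,
      smul_eq_mul, add_apply, add_mul, Finset.sum_add_distrib, Finset.mul_sum]
    rw [add_comm]
    congr 1
    · rw [Finset.sum_eq_single j]
      · simp
      · intro b _ hb; simp [hb.symm]
      · simp
    · exact Finset.sum_congr rfl fun k _ => by ring

theorem continuous_eval (h : Poly) : Continuous fun v : V => eval v h :=
  MvPolynomial.continuous_eval h

theorem continuous_hessian (h : Poly) : Continuous (hessian h) :=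
  continuous_matrix fun _ _ => continuous_eval _

theorem eval_smul_of_isHomogeneous {n : ℕ} {h : Poly} (hh : h.IsHomogeneous n) (c : ℝ) (v : V) :
    eval (c • v) h = c ^ n * eval v h := by
  rw [eval_eq, eval_eq, Finset.mul_sum]
  refine Finset.sum_congr rfl fun d hd => ?_
  have := hh (mem_support_iff.1 hd)
  rw [Finsupp.weight_apply, Finsupp.sum_fintype _ _ (by simp)] at this
  simp only [Pi.smul_apply, smul_eq_mul, mul_pow, Finset.prod_mul_distrib, Finset.prod_pow_eq_pow_sum]
  have e : ∑ i ∈ d.support, d i = n := by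
    rw [← this, Finset.sum_subset (Finset.subset_univ d.support)]
    · simp
    · intro i _ hi; simpa using hi
  rw [e]; ring

theorem euler {n : ℕ} {h : Poly} (hh : h.IsHomogeneous n) (v : V) :
    ∑ i, v i * eval v (pderiv i h) = n * eval v h := by
  have := congrArg (eval v) hh.sum_X_mul_pderiv
  simpa using this

theorem hessian_mulVec_self {n : ℕ} {h : Poly} (hh : h.IsHomogeneous n) (v : V) (i : Fin 3) :
    (hessian h v *ᵥ v) i = ((n - 1 : ℕ) : ℝ) * eval v (pderiv i h) := by
  rw [← euler (hh.pderiv (i := i)) v]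
  simp only [hessian, Matrix.mulVec, dotProduct, Matrix.of_apply]
  exact Finset.sum_congr rfl fun j _ => by rw [pderiv_comm, mul_comm]

theorem dotProduct_hessian_self {n : ℕ} {h : Poly} (hh : h.IsHomogeneous n) (v : V) :
    v ⬝ᵥ (hessian h v *ᵥ v) = ((n - 1 : ℕ) : ℝ) * n * eval v h := by
  rw [dotProduct, mul_assoc, ← euler hh v, Finset.mul_sum]
  exact Finset.sum_congr rfl fun j _ => by rw [hessian_mulVec_self hh]; ring

theorem hessian_smul {n : ℕ} {h : Poly} (hh : h.IsHomogeneous n) (c : ℝ) (v : V) :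
    hessian h (c • v) = c ^ (n - 2) • hessian h v := by
  ext i j
  simp only [hessian, Matrix.of_apply, Matrix.smul_apply, smul_eq_mul]
  rw [eval_smul_of_isHomogeneous (hh.pderiv.pderiv)]
  -- Two derivatives lower the degree to `n - 1 - 1`, which is `n - 2` by definition, also where the
  -- subtraction is truncated.
  rfl

theorem isHomogeneous_subst {n : ℕ} {h : Poly} (hh : h.IsHomogeneous n) (S : M3) :
    (subst S h).IsHomogeneous n := by
  have := hh.aeval (n := 1) (linForm S) fun i => by
    refine IsHomogeneous.sum _ _ _ fun j _ => ?_
    simpa using (isHomogeneous_C _ (S i j)).mul (isHomogeneous_X ℝ j)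
  simpa [subst] using this

theorem isOpen_hyp (h : Poly) : IsOpen (hyp h) := by
  have : hyp h = {p | 0 < eval p h} ∩ ({p | (-hessian h p).det < 0} ∩
      ⋃ v : V, {p | 0 < v ⬝ᵥ ((-hessian h p) *ᵥ v)}) := by
    ext p
    simp [mem_hyp_iff]
  rw [this]
  have hc := continuous_hessian h
  refine (isOpen_lt continuous_const (continuous_eval h)).inter
    ((isOpen_lt hc.neg.matrix_det continuous_const).inter (isOpen_iUnion fun v =>
      isOpen_lt continuous_const ?_))
  exact continuous_const.dotProduct (hc.neg.matrix_mulVec continuous_const)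

theorem smul_mem_hyp {n : ℕ} {h : Poly} (hh : h.IsHomogeneous n) {c : ℝ} (hc : 0 < c) {p : V}
    (hp : p ∈ hyp h) : c • p ∈ hyp h := by
  rw [mem_hyp_iff] at *
  obtain ⟨h1, h2, v, h3⟩ := hp
  have hk : 0 < c ^ (n - 2) := pow_pos hc _
  have e : -hessian h (c • p) = c ^ (n - 2) • -hessian h p := by
    rw [hessian_smul hh, smul_neg]
  refine ⟨?_, ?_, v, ?_⟩
  · rw [eval_smul_of_isHomogeneous hh]; positivity
  · rw [e, Matrix.det_smul]
    exact mul_neg_of_pos_of_neg (pow_pos hk _) h2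
  · rw [e, Matrix.smul_mulVec, dotProduct_smul, smul_eq_mul]
    positivity

/-- The radial projection onto the level set `{h = 1}`. -/
def radial (n : ℕ) (h : Poly) (v : V) : V := (eval v h) ^ (-(1 / (n : ℝ))) • v

theorem rpow_neg_inv_pow {n : ℕ} (hn : n ≠ 0) {a : ℝ} (ha : 0 < a) :
    (a ^ (-(1 / (n : ℝ)))) ^ n * a = 1 := by
  rw [← Real.rpow_natCast, ← Real.rpow_mul ha.le]
  have : -(1 / (n : ℝ)) * n = -1 := by field_simp
  rw [this, Real.rpow_neg_one, inv_mul_cancel₀ ha.ne']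

theorem eval_radial {n : ℕ} (hn : n ≠ 0) {h : Poly} (hh : h.IsHomogeneous n) {v : V}
    (hv : 0 < eval v h) : eval (radial n h v) h = 1 := by
  rw [radial, eval_smul_of_isHomogeneous hh, rpow_neg_inv_pow hn hv]

theorem radial_eq_self {n : ℕ} {h : Poly} {v : V} (hv : eval v h = 1) : radial n h v = v := by
  simp [radial, hv]

theorem radial_mem_hyp₁ {n : ℕ} (hn : n ≠ 0) {h : Poly} (hh : h.IsHomogeneous n) {v : V}
    (hv : v ∈ hyp h) : radial n h v ∈ hyp₁ h :=
  ⟨eval_radial hn hh hv.1, smul_mem_hyp hh (Real.rpow_pos_of_pos hv.1 _) hv⟩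

theorem continuousAt_radial {n : ℕ} {h : Poly} {v : V} (hv : 0 < eval v h) :
    ContinuousAt (radial n h) v :=
  ((continuous_eval h).continuousAt.rpow_const (Or.inl hv.ne')).smul continuousAt_id

theorem hyp₁_subset_hyp (h : Poly) : hyp₁ h ⊆ hyp h := Set.inter_subset_right

-- Rigidity of a homogeneous polynomial with a given level set.

/-- A polynomial that vanishes on a non-empty open set is zero. -/
theorem eq_of_eqOn_open {f g : Poly} {W : Set V} (hW : IsOpen W) (hne : W.Nonempty)
    (hfg : ∀ v ∈ W, eval v f = eval v g) : f = g := by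
  obtain ⟨p, hp⟩ := hne
  obtain ⟨ε, hε, hb⟩ := Metric.isOpen_iff.1 hW p hp
  refine funext_set (fun i => Metric.ball (p i) ε) (fun i => ?_) fun v hv => hfg v (hb ?_)
  · rw [Real.ball_eq_Ioo]
    exact Set.Ioo_infinite (by linarith)
  · rw [Metric.mem_ball, dist_pi_lt_iff hε]
    exact fun i => hv i (Set.mem_univ i)

/-- A homogeneous polynomial that is one on an open piece of the hyperbolic level set of `h`
equals `h`. -/
theorem eq_of_eq_one_on_surface {τ : ℕ} {h f : Poly} {H : Set V} (hH : IsGPSRSurface τ h H)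
    (hf : f.IsHomogeneous τ) (h1 : ∀ v ∈ H, eval v f = 1) : f = h := by
  obtain ⟨hτ, ⟨hh, -⟩, ⟨p, hp⟩, U, hU, rfl⟩ := hH
  have hτ0 : τ ≠ 0 := by omega
  -- Points near `p` project radially into the surface. There `f` is one, and homogeneity turns this
  -- into `f = h` on a full neighbourhood in `ℝ³`.
  have ho : ∀ᶠ v in 𝓝 p, v ∈ hyp h ∧ radial τ h v ∈ U := by
    refine Filter.Eventually.and ((isOpen_hyp h).mem_nhds hp.2.2) ?_
    refine (continuousAt_radial hp.2.2.1).eventually (hU.mem_nhds ?_)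
    rw [radial_eq_self hp.2.1]
    exact hp.1
  obtain ⟨W, hW, hWo, hpW⟩ := eventually_nhds_iff.1 ho
  refine eq_of_eqOn_open hWo ⟨p, hpW⟩ fun v hv => ?_
  obtain ⟨hv1, hv2⟩ := hW v hv
  have e := h1 _ ⟨hv2, radial_mem_hyp₁ hτ0 hh hv1⟩
  rw [radial, eval_smul_of_isHomogeneous hf] at e
  have e2 := rpow_neg_inv_pow hτ0 hv1.1
  have hne : ((eval v h) ^ (-(1 / (τ : ℝ)))) ^ τ ≠ 0 := by
    intro h0; rw [h0, zero_mul] at e2; exact zero_ne_one e2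
  exact mul_left_cancel₀ hne (e.trans e2.symm)

/-! ### Adapted frames -/

/-- The base point `(1, 0, 0)`. -/
def e₀ : V := ![1, 0, 0]

@[simp] theorem mulVec_e₀ (M : M3) (i : Fin 3) : (M *ᵥ e₀) i = M i 0 := by
  simp [e₀, Matrix.mulVec, dotProduct, Fin.sum_univ_three]

/-- The Hessian at the base point of a polynomial in adapted coordinates. -/
def IsAdapted (τ : ℕ) (h : Poly) : Prop :=
  hessian h e₀ = Matrix.diagonal ![(τ : ℝ) * (τ - 1), -τ, -τ]

theorem gram_eq (M : M3) (a b c : V) :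
    ((Matrix.of ![a, b, c])ᵀ : M3)ᵀ * M * ((Matrix.of ![a, b, c])ᵀ : M3) = Matrix.of ![
      ![a ⬝ᵥ (M *ᵥ a), a ⬝ᵥ (M *ᵥ b), a ⬝ᵥ (M *ᵥ c)],
      ![b ⬝ᵥ (M *ᵥ a), b ⬝ᵥ (M *ᵥ b), b ⬝ᵥ (M *ᵥ c)],
      ![c ⬝ᵥ (M *ᵥ a), c ⬝ᵥ (M *ᵥ b), c ⬝ᵥ (M *ᵥ c)]] := by
  ext i j
  fin_cases i <;> fin_cases j <;>
    simp [Matrix.mul_apply, Fin.sum_univ_three, Matrix.mulVec, Matrix.vecMul, dotProduct] <;> ring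

/-- Gram–Schmidt for the Minkowski form `-∂²h_p`. By Euler's relation `p` has negative square, so
its orthogonal complement is positive definite; two orthogonal vectors there are scaled to square
`τ`. -/
theorem exists_adapted_frame {τ : ℕ} (hτ : 2 ≤ τ) {h : Poly} (hh : h.IsHomogeneous τ) {p : V}
    (hp : p ∈ hyp₁ h) : ∃ S : GL3, act S e₀ = p ∧ IsAdapted τ (subst S.val h) := by
  obtain ⟨-, hdet, v, hv⟩ := mem_hyp_iff.1 hp.2
  have hcast : ((τ - 1 : ℕ) : ℝ) = (τ : ℝ) - 1 := by rw [Nat.cast_sub (by omega)]; simp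
  have hτ2 : (2 : ℝ) ≤ τ := by exact_mod_cast hτ
  have hpp : p ⬝ᵥ ((-hessian h p) *ᵥ p) = -(τ * (τ - 1)) := by
    have h1 : eval p h = 1 := hp.1
    rw [Matrix.neg_mulVec, dotProduct_neg, dotProduct_hessian_self hh, hcast, h1]; ring
  have hsymm : (-hessian h p)ᵀ = -hessian h p := by rw [Matrix.transpose_neg, hessian_isSymm]
  have hHM : hessian h p = -(-hessian h p) := by simp
  set M := -hessian h p with hM
  have hB : ∀ a b : V, a ⬝ᵥ (M *ᵥ b) = b ⬝ᵥ (M *ᵥ a) := fun a b => by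
    rw [Matrix.dotProduct_mulVec, ← Matrix.mulVec_transpose, hsymm, dotProduct_comm]
  have hppn : p ⬝ᵥ (M *ᵥ p) < 0 := by rw [hpp]; nlinarith
  -- Since `p` has negative square, removing the component of `v` along `p` cannot decrease its
  -- square.
  obtain ⟨f, hpf, hff⟩ : ∃ f : V, p ⬝ᵥ (M *ᵥ f) = 0 ∧ 0 < f ⬝ᵥ (M *ᵥ f) := by
    refine ⟨v - ((p ⬝ᵥ (M *ᵥ v)) / (p ⬝ᵥ (M *ᵥ p))) • p, ?_, ?_⟩
    · rw [Matrix.mulVec_sub, dotProduct_sub, Matrix.mulVec_smul, dotProduct_smul, smul_eq_mul,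
        div_mul_cancel₀ _ hppn.ne, sub_self]
    · rw [Matrix.mulVec_sub, dotProduct_sub, sub_dotProduct, sub_dotProduct, Matrix.mulVec_smul,
        dotProduct_smul, smul_dotProduct, smul_dotProduct, dotProduct_smul, hB v p]
      simp only [smul_eq_mul]
      have : 0 ≤ -((p ⬝ᵥ (M *ᵥ v)) ^ 2 / (p ⬝ᵥ (M *ᵥ p))) :=
        neg_nonneg.2 (div_nonpos_of_nonneg_of_nonpos (sq_nonneg _) hppn.le)
      have e : v ⬝ᵥ (M *ᵥ v) - p ⬝ᵥ (M *ᵥ v) / p ⬝ᵥ (M *ᵥ p) * p ⬝ᵥ (M *ᵥ v) -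
        (p ⬝ᵥ (M *ᵥ v) / p ⬝ᵥ (M *ᵥ p) * p ⬝ᵥ (M *ᵥ v) - p ⬝ᵥ (M *ᵥ v) / p ⬝ᵥ (M *ᵥ p) *
          (p ⬝ᵥ (M *ᵥ v) / p ⬝ᵥ (M *ᵥ p) * p ⬝ᵥ (M *ᵥ p))) =
          v ⬝ᵥ (M *ᵥ v) + -((p ⬝ᵥ (M *ᵥ v)) ^ 2 / (p ⬝ᵥ (M *ᵥ p))) := by
        have := hppn.ne
        field_simp
        ring
      rw [e]
      linarith
  -- The cross product of the covectors `M p` and `M f` is annihilated by both, hence orthogonal to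
  -- `p` and `f` for the form `M`.
  set g : V := (M *ᵥ p) ⨯₃ (M *ᵥ f) with hg
  have hpg : p ⬝ᵥ (M *ᵥ g) = 0 := by
    rw [hB, dotProduct_comm, hg, dot_self_cross]
  have hfg : f ⬝ᵥ (M *ᵥ g) = 0 := by
    rw [hB, dotProduct_comm, hg, dot_cross_self]

  -- The Lagrange identity evaluates this determinant as the product of the squares of `p` and `f`.
  have hdetS : ((Matrix.of ![p, f, g])ᵀ : M3).det ≠ 0 := by
    have : ((Matrix.of ![p, f, g])ᵀ : M3).det = (p ⬝ᵥ (M *ᵥ p)) * (f ⬝ᵥ (M *ᵥ f)) := by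
      rw [Matrix.det_transpose]
      change Matrix.det ![p, f, g] = _
      rw [← triple_product_eq_det, triple_product_permutation, triple_product_permutation,
        dotProduct_comm, hg, cross_dot_cross, hpf, hB f p, hpf]
      ring
    rw [this]
    exact (mul_neg_of_neg_of_pos hppn hff).ne
  -- The Gram matrix is diagonal and its determinant has the sign of `M.det`, which is negative. As
  -- `p` has negative and `f` positive square, `g` has positive square.
  have hgg : 0 < g ⬝ᵥ (M *ᵥ g) := by
    have h1 := congrArg Matrix.det (gram_eq M p f g)
    rw [Matrix.det_mul, Matrix.det_mul, Matrix.det_transpose, Matrix.det_fin_three (Matrix.of _)] at h1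
    simp only [hpf, hpg, hfg, hB f p, hB g p, hB g f] at h1
    simp at h1
    have h2 := mul_self_pos.2 hdetS
    rw [Matrix.det_transpose] at h2
    by_contra hcon
    push Not at hcon
    have h3 := mul_neg_of_pos_of_neg h2 hdet
    have h4 := mul_nonneg_of_nonpos_of_nonpos (mul_neg_of_neg_of_pos hppn hff).le hcon
    linarith
  set α := Real.sqrt (τ / (f ⬝ᵥ (M *ᵥ f))) with hα
  set β := Real.sqrt (τ / (g ⬝ᵥ (M *ᵥ g))) with hβ
  have hα2 : α * α * (f ⬝ᵥ (M *ᵥ f)) = τ := by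
    rw [hα, Real.mul_self_sqrt (by positivity), div_mul_cancel₀ _ hff.ne']
  have hβ2 : β * β * (g ⬝ᵥ (M *ᵥ g)) = τ := by
    rw [hβ, Real.mul_self_sqrt (by positivity), div_mul_cancel₀ _ hgg.ne']
  have hG := gram_eq M p (α • f) (β • g)
  have hα0 : α ≠ 0 := by rintro h0; rw [h0] at hα2; simp at hα2; rw [← hα2] at hτ2; norm_num at hτ2
  have hβ0 : β ≠ 0 := by rintro h0; rw [h0] at hβ2; simp at hβ2; rw [← hβ2] at hτ2; norm_num at hτ2
  have hdT : ((Matrix.of ![p, α • f, β • g])ᵀ : M3).det ≠ 0 := by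
    have : ((Matrix.of ![p, α • f, β • g])ᵀ : M3).det =
        α * β * ((Matrix.of ![p, f, g])ᵀ : M3).det := by
      simp [Matrix.det_fin_three]; ring
    rw [this]
    exact mul_ne_zero (mul_ne_zero hα0 hβ0) hdetS
  refine ⟨Matrix.GeneralLinearGroup.mkOfDetNeZero _ hdT, ?_, ?_⟩
  · funext i
    rw [act, mulVec_e₀]
    simp [Matrix.GeneralLinearGroup.mkOfDetNeZero]
  · have e : ((Matrix.of ![p, α • f, β • g])ᵀ : M3) *ᵥ e₀ = p := by
      funext i; rw [mulVec_e₀]; simp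
    rw [IsAdapted, hessian_subst]
    change ((Matrix.of ![p, α • f, β • g])ᵀ : M3)ᵀ *
      hessian h (((Matrix.of ![p, α • f, β • g])ᵀ : M3) *ᵥ e₀) *
      ((Matrix.of ![p, α • f, β • g])ᵀ : M3) = _
    rw [e, hHM, Matrix.mul_neg, Matrix.neg_mul, hG]
    simp only [Matrix.mulVec_smul, dotProduct_smul, smul_dotProduct, smul_eq_mul, hpf, hpg, hfg,
      hB f p, hB g p, hB g f]
    ext i j
    fin_cases i <;> fin_cases j <;> simp [hpp] <;> linarith

/-! ### Infinitesimal automorphisms in adapted coordinates -/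

theorem IsAdapted.hessian_apply {τ : ℕ} {h : Poly} (hn : IsAdapted τ h) (i j : Fin 3) :
    eval e₀ (pderiv i (pderiv j h)) =
      (Matrix.diagonal ![(τ : ℝ) * (τ - 1), -τ, -τ] : M3) i j := by
  rw [← hn]; rfl

/-- Euler's relation for the partial derivatives expresses `τ - 1` times the gradient as the Hessian
applied to the base point, so adapting the Hessian also fixes the gradient. -/
theorem IsAdapted.grad {τ : ℕ} (hτ : 2 ≤ τ) {h : Poly} (hh : h.IsHomogeneous τ)
    (hn : IsAdapted τ h) (i : Fin 3) : eval e₀ (pderiv i h) = (![(τ : ℝ), 0, 0] : V) i := by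
  have h1 := hessian_mulVec_self hh e₀ i
  have hcast : ((τ - 1 : ℕ) : ℝ) = (τ : ℝ) - 1 := by rw [Nat.cast_sub (by omega)]; simp
  have hτ2 : (2 : ℝ) ≤ τ := by exact_mod_cast hτ
  have hne : (τ : ℝ) - 1 ≠ 0 := by linarith
  rw [mulVec_e₀, hn, hcast] at h1
  refine mul_left_cancel₀ hne (h1.symm.trans ?_)
  fin_cases i <;> simp; ring

theorem IsAdapted.eval_eq_one {τ : ℕ} (hτ : 2 ≤ τ) {h : Poly} (hh : h.IsHomogeneous τ)
    (hn : IsAdapted τ h) : eval e₀ h = 1 := by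
  have h1 := euler hh e₀
  have hτ2 : (2 : ℝ) ≤ τ := by exact_mod_cast hτ
  simp only [hn.grad hτ hh, Fin.sum_univ_three] at h1
  simp [e₀] at h1
  have hne : (τ : ℝ) ≠ 0 := by linarith
  exact (mul_left_cancel₀ hne (by simpa [e₀] using h1)).symm

theorem IsAdapted.mem_hyp₁ {τ : ℕ} (hτ : 2 ≤ τ) {h : Poly} (hh : h.IsHomogeneous τ)
    (hn : IsAdapted τ h) : e₀ ∈ hyp₁ h := by
  have hτ2 : (2 : ℝ) ≤ τ := by exact_mod_cast hτ
  refine ⟨hn.eval_eq_one hτ hh, mem_hyp_iff.2 ⟨?_, ?_, ![0, 1, 0], ?_⟩⟩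
  · rw [hn.eval_eq_one hτ hh]; exact one_pos
  · have h1 : 0 < (τ : ℝ) - 1 := by linarith
    have h2 : 0 < (τ : ℝ) := by linarith
    rw [hn, Matrix.det_neg, Matrix.det_diagonal, Fin.prod_univ_three]
    have : 0 < (τ : ℝ) * (τ - 1) * τ * τ := by positivity
    simp [Odd.neg_one_pow (n := 3) (by decide)]
    linarith
  · rw [hn, Matrix.neg_mulVec]
    simp [dotProduct, Matrix.mulVec_diagonal, Fin.sum_univ_three]
    omega

theorem pderiv_linForm (M : M3) (i k : Fin 3) : pderiv k (linForm M i) = C (M i k) := by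
  simp only [linForm, map_sum, pderiv_C_mul, pderiv_X]
  rw [Finset.sum_eq_single k] <;> simp +contextual [eq_comm]

theorem lieAlg_first {h : Poly} {M : M3} (hM : M ∈ lieAlg h) (v : V) (k : Fin 3) :
    ∑ i, (M i k * eval v (pderiv i h) + (M *ᵥ v) i * eval v (pderiv k (pderiv i h))) = 0 := by
  rw [mem_lieAlg, lieDer_apply] at hM
  have := congrArg (fun f => eval v (pderiv k f)) hM
  simp only [map_sum, Derivation.leibniz, pderiv_linForm, smul_eq_mul, map_add, map_mul, eval_C,
    eval_linForm, map_zero] at this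
  rw [← this]
  exact Finset.sum_congr rfl fun i _ => by ring

theorem lieAlg_second {h : Poly} {M : M3} (hM : M ∈ lieAlg h) (v : V) (k l : Fin 3) :
    ∑ i, (M i k * eval v (pderiv l (pderiv i h)) + (M i l * eval v (pderiv k (pderiv i h)) +
      (M *ᵥ v) i * eval v (pderiv l (pderiv k (pderiv i h))))) = 0 := by
  rw [mem_lieAlg, lieDer_apply] at hM
  have := congrArg (fun f => eval v (pderiv l (pderiv k f))) hM
  simp only [map_sum, Derivation.leibniz, pderiv_linForm, smul_eq_mul, map_add, map_mul, eval_C,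
    eval_linForm, map_zero, pderiv_C] at this
  rw [← this]
  exact Finset.sum_congr rfl fun i _ => by ring

/-- The generator of the rotations that fix the base point. -/
def rotGen : M3 := !![0, 0, 0; 0, 0, -1; 0, 1, 0]

/-- The rotations that fix the base point. -/
def rot (φ : ℝ) : M3 :=
  !![1, 0, 0; 0, Real.cos φ, -Real.sin φ; 0, Real.sin φ, Real.cos φ]

/-- The first derivatives of the invariance identity at the base point involve only the gradient and
the Hessian, both known in adapted coordinates. They determine the first row of `M` from its first
column `M e₀`. -/
theorem row_zero_of_mem_lieAlg {τ : ℕ} (hτ : 2 ≤ τ) {h : Poly} (hh : h.IsHomogeneous τ)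
    (hn : IsAdapted τ h) {M : M3} (hM : M ∈ lieAlg h) :
    M 0 0 = 0 ∧ M 0 1 = M 1 0 ∧ M 0 2 = M 2 0 := by
  have hτ2 : (2 : ℝ) ≤ τ := by exact_mod_cast hτ
  have h0 : (τ : ℝ) ≠ 0 := by linarith
  have a0 := lieAlg_first hM e₀ 0
  have a1 := lieAlg_first hM e₀ 1
  have a2 := lieAlg_first hM e₀ 2
  simp only [hn.grad hτ hh, hn.hessian_apply, mulVec_e₀, Fin.sum_univ_three] at a0 a1 a2
  simp at a0 a1 a2
  refine ⟨?_, ?_, ?_⟩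
  · have : M 0 0 * ((τ : ℝ) * τ) = 0 := by linarith
    simpa [h0] using this
  · exact mul_right_cancel₀ h0 (by linarith)
  · exact mul_right_cancel₀ h0 (by linarith)

/-- When `M` kills the base point, the third derivatives of `h` drop out of the second-order
identity, which then says that `M` is skew for the definite form on the tangent plane. The
infinitesimal isotropy has dimension at most one. -/
theorem eq_smul_rotGen {τ : ℕ} (hτ : 2 ≤ τ) {h : Poly} (hh : h.IsHomogeneous τ)
    (hn : IsAdapted τ h) {M : M3} (hM : M ∈ lieAlg h) (h0 : M *ᵥ e₀ = 0) :
    M = M 2 1 • rotGen := by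
  have c : ∀ i, M i 0 = 0 := fun i => by rw [← mulVec_e₀ M i, h0]; rfl
  obtain ⟨r0, r1, r2⟩ := row_zero_of_mem_lieAlg hτ hh hn hM
  have hτ2 : (2 : ℝ) ≤ τ := by exact_mod_cast hτ
  have hτ0 : (τ : ℝ) ≠ 0 := by linarith
  have a11 := lieAlg_second hM e₀ 1 1
  have a12 := lieAlg_second hM e₀ 1 2
  have a22 := lieAlg_second hM e₀ 2 2
  simp only [hn.hessian_apply, h0, Fin.sum_univ_three] at a11 a12 a22
  simp at a11 a12 a22
  have b11 : M 1 1 = 0 := by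
    rcases a11 with h | h
    · exact h
    · omega
  have b22 : M 2 2 = 0 := by
    rcases a22 with h | h
    · exact h
    · omega
  have b12 : M 1 2 = -M 2 1 := mul_right_cancel₀ hτ0 (by linarith)
  ext i j
  fin_cases i <;> fin_cases j <;> simp [rotGen, c, r1, r2, b11, b22, b12]

/-- Limits of difference quotients of linear automorphisms are infinitesimal automorphisms. -/
theorem mem_lieAlg_of_tendsto {h : Poly} {A : ℕ → M3} {s : ℕ → ℝ} {Y : M3}
    (hA : ∀ n v, eval (A n *ᵥ v) h = eval v h) (hA1 : Tendsto A atTop (𝓝 1))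
    (hY : Tendsto (fun n => (s n)⁻¹ • (A n - 1)) atTop (𝓝 Y)) : Y ∈ lieAlg h := by
  rw [mem_lieAlg_iff]
  intro v
  have cont : Continuous fun M : M3 => M *ᵥ v := continuous_id.matrix_mulVec continuous_const
  have d0 : Tendsto (fun n => (A n - 1) *ᵥ v) atTop (𝓝 0) := by
    have := (cont.tendsto (1 - 1)).comp (hA1.sub_const 1)
    simpa [Function.comp_def] using this
  have d1 : Tendsto (fun n => (s n)⁻¹ • ((A n - 1) *ᵥ v)) atTop (𝓝 (Y *ᵥ v)) := by
    have := (cont.tendsto Y).comp hY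
    simpa [Function.comp_def, Matrix.smul_mulVec] using this
  have hl := ((hasFDerivAt_eval h v).hasFDerivWithinAt (s := Set.univ)).lim d0
    (Eventually.of_forall fun _ => Set.mem_univ _) d1
  have hz : ∀ n, (s n)⁻¹ • (eval (v + (A n - 1) *ᵥ v) h - eval v h) = 0 := by
    intro n
    have : v + (A n - 1) *ᵥ v = A n *ᵥ v := by rw [Matrix.sub_mulVec, Matrix.one_mulVec]; abel
    rw [this, hA, sub_self, smul_zero]
  simp only [hz] at hl
  have := tendsto_nhds_unique hl tendsto_const_nhds
  simp only [FunLike.coe_sum, Finset.sum_apply, FunLike.coe_smul, Pi.smul_apply,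
    ContinuousLinearMap.proj_apply, smul_eq_mul] at this
  rw [← this]
  exact Finset.sum_congr rfl fun i _ => mul_comm _ _

theorem rot_mulVec (φ : ℝ) (v : V) :
    rot φ *ᵥ v = ![v 0, Real.cos φ * v 1 - Real.sin φ * v 2,
      Real.sin φ * v 1 + Real.cos φ * v 2] := by
  funext i
  fin_cases i <;> simp [rot, Matrix.mulVec, dotProduct, Fin.sum_univ_three]; ring

theorem det_rot (φ : ℝ) : (rot φ).det = 1 := by
  have := Real.sin_sq_add_cos_sq φ
  simp [rot, Matrix.det_fin_three]
  linarith

/-- The rotations are the flow of `rotGen`, along which `h` has derivative zero. -/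
theorem eval_rot {h : Poly} (hJ : rotGen ∈ lieAlg h) (φ : ℝ) (v : V) :
    eval (rot φ *ᵥ v) h = eval v h := by
  have hd : ∀ t : ℝ, HasDerivAt (fun t => eval (rot t *ᵥ v) h) 0 t := by
    intro t
    have h1 : HasDerivAt (fun t => rot t *ᵥ v) (rotGen *ᵥ (rot t *ᵥ v)) t := by
      simp only [rot_mulVec]
      rw [hasDerivAt_pi]
      intro i
      fin_cases i
      · simpa [rotGen, Matrix.mulVec, dotProduct, Fin.sum_univ_three] using
          hasDerivAt_const t (v 0)
      · refine (((Real.hasDerivAt_cos t).mul_const (v 1)).sub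
          ((Real.hasDerivAt_sin t).mul_const (v 2))).congr_deriv ?_
        simp [rotGen, Matrix.mulVec, dotProduct, Fin.sum_univ_three]; ring
      · refine (((Real.hasDerivAt_sin t).mul_const (v 1)).add
          ((Real.hasDerivAt_cos t).mul_const (v 2))).congr_deriv ?_
        simp [rotGen, Matrix.mulVec, dotProduct, Fin.sum_univ_three]; ring
    refine ((hasFDerivAt_eval h _).comp_hasDerivAt t h1).congr_deriv ?_
    have := mem_lieAlg_iff.1 hJ (rot t *ᵥ v)
    rw [← this]
    simp only [FunLike.coe_sum, Finset.sum_apply, FunLike.coe_smul, Pi.smul_apply,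
      ContinuousLinearMap.proj_apply, smul_eq_mul]
    exact Finset.sum_congr rfl fun i _ => mul_comm _ _
  have := is_const_of_deriv_eq_zero (fun t => (hd t).differentiableAt) (fun t => (hd t).deriv) φ 0
  rw [this]
  congr 2
  rw [rot_mulVec]
  funext i
  fin_cases i <;> simp

theorem exists_cos_sin_eq_zero (a b : ℝ) : ∃ φ, Real.cos φ * a + Real.sin φ * b = 0 := by
  by_cases hb : b = 0
  · exact ⟨Real.pi / 2, by simp [hb]⟩
  · refine ⟨Real.arctan (-a / b), ?_⟩
    rw [← Real.tan_mul_cos (Real.cos_arctan_pos _).ne', Real.tan_arctan]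
    field_simp
    ring

/-- Adding `π` to the angle preserves the equation and reverses the sign of the second expression.
-/
theorem exists_cos_sin_eq_zero_nonneg (a b c d : ℝ) :
    ∃ φ, Real.cos φ * a + Real.sin φ * b = 0 ∧ 0 ≤ Real.cos φ * c + Real.sin φ * d := by
  obtain ⟨φ, hφ⟩ := exists_cos_sin_eq_zero a b
  rcases le_total 0 (Real.cos φ * c + Real.sin φ * d) with h | h
  · exact ⟨φ, hφ, h⟩
  · refine ⟨φ + Real.pi, ?_, ?_⟩ <;> rw [Real.cos_add_pi, Real.sin_add_pi] <;> linarith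

/-! ### Infinitesimal transitivity -/

/-- A symmetric form that is positive definite at hyperbolic points and natural under linear
transformations. -/
def posForm (c : ℝ) (h : Poly) (p : V) : M3 :=
  -hessian h p + c • Matrix.vecMulVec (hessian h p *ᵥ p) (hessian h p *ᵥ p)

theorem posForm_subst (c : ℝ) (S : M3) (h : Poly) (p : V) :
    posForm c (subst S h) p = Sᵀ * posForm c h (S *ᵥ p) * S := by
  have e : hessian (subst S h) p *ᵥ p = Sᵀ *ᵥ (hessian h (S *ᵥ p) *ᵥ (S *ᵥ p)) := by
    rw [hessian_subst, ← Matrix.mulVec_mulVec, ← Matrix.mulVec_mulVec]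
  rw [posForm, posForm, e, hessian_subst, Matrix.mul_add, Matrix.add_mul, Matrix.mul_neg,
    Matrix.neg_mul, Matrix.mul_smul, Matrix.smul_mul, Matrix.mul_vecMulVec, Matrix.vecMulVec_mul,
    ← Matrix.mulVec_transpose]

theorem continuous_posForm (c : ℝ) (h : Poly) : Continuous (posForm c h) := by
  have hc := continuous_hessian h
  have := hc.matrix_mulVec continuous_id
  exact hc.neg.add ((this.matrix_vecMulVec this).const_smul c)

/-- The constant makes the rank-one term twice as large as the negative square of the base point
that it has to compensate. -/
theorem posForm_e₀ {τ : ℕ} (hτ : 2 ≤ τ) {h : Poly} (hn : IsAdapted τ h) :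
    posForm (2 / (τ * (τ - 1))) h e₀ = Matrix.diagonal ![(τ : ℝ) * (τ - 1), τ, τ] := by
  have hτ2 : (2 : ℝ) ≤ τ := by exact_mod_cast hτ
  have h1 : (τ : ℝ) - 1 ≠ 0 := by linarith
  have h2 : (τ : ℝ) ≠ 0 := by linarith
  rw [posForm, hn]
  ext i j
  fin_cases i <;> fin_cases j <;>
    simp [Matrix.vecMulVec_apply, Matrix.mulVec_diagonal, e₀] <;> field_simp <;> ring

theorem posForm_lower {N : V → M3} (hN : ContinuousAt N e₀) {d : V} (hd : ∀ i, 1 ≤ d i)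
    (h0 : N e₀ = Matrix.diagonal d) :
    ∀ᶠ q in 𝓝 e₀, ∀ w : V, (1 / 2 : ℝ) * ∑ i, w i ^ 2 ≤ w ⬝ᵥ (N q *ᵥ w) := by
  -- Nine entries with error below `1 / 6` change the form by at most half the Euclidean square,
  -- since `|w i * w j| ≤ (w i ^ 2 + w j ^ 2) / 2`.
  have h1 : ∀ i j, ∀ᶠ q in 𝓝 e₀, |N q i j - Matrix.diagonal d i j| < 1 / 6 := by
    intro i j
    have hc : ContinuousAt (fun q => N q i j) e₀ :=
      (continuous_apply j).continuousAt.comp ((continuous_apply i).continuousAt.comp hN)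
    have := Metric.tendsto_nhds.1 hc (1 / 6) (by norm_num)
    rw [← h0]
    exact this
  have h2 : ∀ᶠ q in 𝓝 e₀, ∀ i j, |N q i j - Matrix.diagonal d i j| < 1 / 6 :=
    eventually_all.2 fun i => eventually_all.2 fun j => h1 i j
  filter_upwards [h2] with q hq w
  have key : ∀ i j, w i * (Matrix.diagonal d i j * w j) - (1 / 12) * (w i ^ 2 + w j ^ 2) ≤
      w i * (N q i j * w j) := by
    intro i j
    obtain ⟨a, b⟩ := abs_lt.1 (hq i j)
    nlinarith [mul_nonneg (by linarith : 0 ≤ 1 / 6 + (N q i j - Matrix.diagonal d i j))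
      (sq_nonneg (w i + w j)), mul_nonneg (by linarith : 0 ≤ 1 / 6 -
      (N q i j - Matrix.diagonal d i j)) (sq_nonneg (w i - w j))]
  simp only [Matrix.mulVec, dotProduct, Fin.sum_univ_three, mul_add]
  have k00 := key 0 0; have k01 := key 0 1; have k02 := key 0 2
  have k10 := key 1 0; have k11 := key 1 1; have k12 := key 1 2
  have k20 := key 2 0; have k21 := key 2 1; have k22 := key 2 2
  simp at k00 k01 k02 k10 k11 k12 k20 k21 k22
  nlinarith [mul_nonneg (sub_nonneg.2 (hd 0)) (sq_nonneg (w 0)),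
    mul_nonneg (sub_nonneg.2 (hd 1)) (sq_nonneg (w 1)),
    mul_nonneg (sub_nonneg.2 (hd 2)) (sq_nonneg (w 2))]

/-- The derivative of `h` at the base point vanishes on `v`, so the radial factor is stationary and
the velocity is unchanged. -/
theorem hasDerivAt_radial {τ : ℕ} (hτ : 2 ≤ τ) {h : Poly} (hh : h.IsHomogeneous τ)
    (hn : IsAdapted τ h) {v : V} (hv : v 0 = 0) :
    HasDerivAt (fun t : ℝ => radial τ h (e₀ + t • v)) v 0 := by
  have h1 : HasDerivAt (fun t : ℝ => e₀ + t • v) v 0 := by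
    simpa using ((hasDerivAt_id (0 : ℝ)).smul_const v).const_add e₀
  have h2 : HasDerivAt (fun t : ℝ => eval (e₀ + t • v) h) 0 0 := by
    have hf := hasFDerivAt_eval h (e₀ + (0 : ℝ) • v)
    refine (hf.comp_hasDerivAt (0 : ℝ) h1).congr_deriv ?_
    simp [hn.grad hτ hh, Fin.sum_univ_three, hv]
  have h3 := h2.rpow_const (p := -(1 / (τ : ℝ))) (Or.inl (by simp [hn.eval_eq_one hτ hh]))
  refine (h3.smul h1).congr_deriv ?_
  simp [hn.eval_eq_one hτ hh]

/-- Compactness stands in for any topology on the group. Automorphisms carrying the base point along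
a curve in the level set are isometries between the positive forms at the two points, so their
entries are bounded. A subsequence converges to an automorphism that fixes the base point, and
dividing by this limit gives automorphisms tending to the identity. The last clause removes the
freedom of composing with rotations when these are automorphisms; it serves to exclude a purely
rotational limit of the rescaled differences. -/
theorem exists_unipotent_sequence {τ : ℕ} (hτ : 2 ≤ τ) {h : Poly} (hh : h.IsHomogeneous τ)
    (hn : IsAdapted τ h)
    (hloc : ∀ᶠ q in 𝓝[hyp₁ h] e₀, ∃ B ∈ autGroup h, act B e₀ = q) {v : V} (hv : v 0 = 0) :
    ∃ (t : ℕ → ℝ) (A : ℕ → M3), (∀ n, 0 < t n) ∧ Tendsto t atTop (𝓝 0) ∧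
      (∀ n w, eval (A n *ᵥ w) h = eval w h) ∧ Tendsto A atTop (𝓝 1) ∧
      Tendsto (fun n => (t n)⁻¹ • ((A n - 1) *ᵥ e₀)) atTop (𝓝 v) ∧
      (rotGen ∈ lieAlg h → ∀ n, A n 2 1 = 0) := by
  have hτ2 : (2 : ℝ) ≤ τ := by exact_mod_cast hτ
  set q : ℝ → V := fun t => radial τ h (e₀ + t • v) with hq
  have hqd : HasDerivAt q v 0 := hasDerivAt_radial hτ hh hn hv
  have hq0 : q 0 = e₀ := by
    simp only [hq, zero_smul, add_zero]
    exact radial_eq_self (hn.eval_eq_one hτ hh)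
  have hqc : Tendsto q (𝓝 0) (𝓝 e₀) := hq0 ▸ hqd.continuousAt.tendsto
  have hqm : ∀ᶠ t in 𝓝 (0 : ℝ), q t ∈ hyp₁ h := by
    have hc : ContinuousAt (fun t : ℝ => e₀ + t • v) 0 := by fun_prop
    have he : e₀ + (0 : ℝ) • v ∈ hyp h := by simpa using (hn.mem_hyp₁ hτ hh).2
    filter_upwards [hc.eventually ((isOpen_hyp h).mem_nhds he)] with t ht
    exact radial_mem_hyp₁ (by omega) hh ht
  set c : ℝ := 2 / (τ * (τ - 1)) with hc
  have hN0 := posForm_e₀ hτ hn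
  rw [← hc] at hN0
  have hlow := posForm_lower (continuous_posForm c h).continuousAt
    (d := ![(τ : ℝ) * (τ - 1), τ, τ])
    (by intro i; fin_cases i <;> simp <;> nlinarith) hN0
  have hgood : ∀ᶠ t in 𝓝[>] (0 : ℝ), 0 < t ∧ (∃ B ∈ autGroup h, act B e₀ = q t) ∧
      ∀ w : V, (1 / 2 : ℝ) * ∑ i, w i ^ 2 ≤ w ⬝ᵥ (posForm c h (q t) *ᵥ w) := by
    have h1 : Tendsto q (𝓝 0) (𝓝[hyp₁ h] e₀) := tendsto_nhdsWithin_iff.2 ⟨hqc, hqm⟩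
    have h2 := (h1.eventually hloc).filter_mono (nhdsWithin_le_nhds (s := Set.Ioi 0))
    have h3 := (hqc.eventually hlow).filter_mono (nhdsWithin_le_nhds (s := Set.Ioi 0))
    filter_upwards [h2, h3, self_mem_nhdsWithin] with t a b d
    exact ⟨d, a, b⟩
  obtain ⟨t, ht, htg⟩ := exists_seq_forall_of_frequently hgood.frequently
  have ht0 : Tendsto t atTop (𝓝 0) := ht.mono_right nhdsWithin_le_nhds
  choose htp hB hlo using htg
  -- a choice of automorphisms that is rotated into a standard position where possible
  have hB' : ∀ n, ∃ B : M3, (∀ w, eval (B *ᵥ w) h = eval w h) ∧ B *ᵥ e₀ = q (t n) ∧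
      (rotGen ∈ lieAlg h → B 2 1 = 0 ∧ 0 ≤ B 1 1) := by
    intro n
    obtain ⟨B, hBa, hBe⟩ := hB n
    by_cases hJ : rotGen ∈ lieAlg h
    · obtain ⟨φ, h1, h2⟩ := exists_cos_sin_eq_zero_nonneg (B.val 2 1) (B.val 2 2) (B.val 1 1)
        (B.val 1 2)
      refine ⟨B.val * rot φ, fun w => ?_, ?_, fun _ => ⟨?_, ?_⟩⟩
      · rw [← Matrix.mulVec_mulVec]
        exact (hBa _).trans (eval_rot hJ φ w)
      · rw [← Matrix.mulVec_mulVec, ← hBe, act]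
        congr 1
        rw [rot_mulVec]; simp [e₀]
      · rw [← h1]; simp [Matrix.mul_apply, Fin.sum_univ_three, rot]; ring
      · convert h2 using 1; simp [Matrix.mul_apply, Fin.sum_univ_three, rot]; ring
    · exact ⟨B.val, hBa, hBe, fun h => absurd h hJ⟩
  choose B hBa hBe hBJ using hB'
  have hform : ∀ n, (B n)ᵀ * posForm c h (q (t n)) * B n =
      Matrix.diagonal ![(τ : ℝ) * (τ - 1), τ, τ] := by
    intro n
    have e : subst (B n) h = h := MvPolynomial.funext fun w => by rw [eval_subst, hBa]
    rw [← hBe, ← posForm_subst, e, hN0]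
  -- The square of the `j`-th column of `B n` for the form at `q (t n)` is that of the `j`-th basis
  -- vector at the base point; the uniform lower bound of the form then bounds the entries.
  have hbound : ∀ n i j, |B n i j| ≤ 2 * ((τ : ℝ) * τ) := by
    intro n i j
    have h1 := hlo n ((B n).col j)
    have h2 : (B n).col j ⬝ᵥ (posForm c h (q (t n)) *ᵥ (B n).col j) =
        ((B n)ᵀ * posForm c h (q (t n)) * B n) j j := by
      rw [Matrix.mul_assoc]
      simp [Matrix.mul_apply, dotProduct, Matrix.mulVec, Matrix.col]
    rw [h2, hform] at h1
    have h3 : (Matrix.diagonal ![(τ : ℝ) * (τ - 1), τ, τ] : M3) j j ≤ τ * τ := by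
      fin_cases j <;> simp <;> nlinarith
    have h4 : (B n i j) ^ 2 ≤ ∑ i, ((B n).col j i) ^ 2 :=
      Finset.single_le_sum (f := fun i => ((B n).col j i) ^ 2) (fun i _ => sq_nonneg _)
        (Finset.mem_univ i)
    have h5 : (B n i j) ^ 2 ≤ 2 * (τ * τ) := by linarith
    refine abs_le_of_sq_le_sq (h5.trans ?_) (by positivity)
    have h6 : (4 : ℝ) ≤ τ * τ := by nlinarith
    nlinarith
  have hcpt : IsCompact (Set.Icc (fun _ _ => -(2 * ((τ : ℝ) * τ)) : Fin 3 → Fin 3 → ℝ)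
      fun _ _ => 2 * ((τ : ℝ) * τ)) := isCompact_Icc
  obtain ⟨B₀, ψ, hψ, hlim⟩ : ∃ (B₀ : M3) (ψ : ℕ → ℕ), StrictMono ψ ∧
      Tendsto (fun n => B (ψ n)) atTop (𝓝 B₀) := by
    obtain ⟨B₀, -, ψ, hψ, hlim⟩ := hcpt.tendsto_subseq (x := fun n i j => B n i j) fun n =>
      ⟨fun i j => (abs_le.1 (hbound n i j)).1, fun i j => (abs_le.1 (hbound n i j)).2⟩
    exact ⟨Matrix.of B₀, ψ, hψ, hlim⟩
  have hψt := hψ.tendsto_atTop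
  have hentry : ∀ i j, Tendsto (fun n => B (ψ n) i j) atTop (𝓝 (B₀ i j)) := fun i j =>
    (tendsto_pi_nhds.1 ((tendsto_pi_nhds.1 hlim) i)) j
  have hqt : Tendsto (fun n => q (t (ψ n))) atTop (𝓝 e₀) := hqc.comp (ht0.comp hψt)
  have hB₀a : ∀ w, eval (B₀ *ᵥ w) h = eval w h := fun w => by
    have cont : Continuous fun M : M3 => eval (M *ᵥ w) h :=
      (continuous_eval h).comp (continuous_id.matrix_mulVec continuous_const)
    refine tendsto_nhds_unique ((cont.tendsto B₀).comp hlim) ?_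
    simp only [Function.comp_def, hBa]
    exact tendsto_const_nhds
  have hB₀e : B₀ *ᵥ e₀ = e₀ := by
    have cont : Continuous fun M : M3 => M *ᵥ e₀ := continuous_id.matrix_mulVec continuous_const
    refine tendsto_nhds_unique ((cont.tendsto B₀).comp hlim) ?_
    simpa only [Function.comp_def, hBe] using hqt
  have hD : B₀ᵀ * (Matrix.diagonal ![(τ : ℝ) * (τ - 1), τ, τ] : M3) * B₀ =
      Matrix.diagonal ![(τ : ℝ) * (τ - 1), τ, τ] := by
    have e : subst B₀ h = h := MvPolynomial.funext fun w => by rw [eval_subst, hB₀a]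
    conv_lhs => rw [← hN0, ← hB₀e]
    rw [hB₀e]
    conv_lhs => enter [1, 2, 3]; rw [← hB₀e]
    rw [← posForm_subst, e, hN0]
  have hdet : IsUnit B₀.det := by
    rw [isUnit_iff_ne_zero]
    intro h0
    have := congrArg Matrix.det hD
    rw [Matrix.det_mul, h0, mul_zero, Matrix.det_diagonal, Fin.prod_univ_three] at this
    have h3 : (0 : ℝ) < τ * (τ - 1) * τ * τ := by
      have h1 : 0 < (τ : ℝ) - 1 := by linarith
      have h2 : 0 < (τ : ℝ) := by linarith
      positivity
    exact h3.ne this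
  have hinv : B₀ * B₀⁻¹ = 1 := Matrix.mul_nonsing_inv _ hdet
  have hinv' : B₀⁻¹ * B₀ = 1 := Matrix.nonsing_inv_mul _ hdet
  have hcancel : ∀ w : V, B₀ *ᵥ (B₀⁻¹ *ᵥ w) = w := fun w => by
    rw [Matrix.mulVec_mulVec, hinv, Matrix.one_mulVec]
  have hcancel' : ∀ w : V, B₀⁻¹ *ᵥ (B₀ *ᵥ w) = w := fun w => by
    rw [Matrix.mulVec_mulVec, hinv', Matrix.one_mulVec]
  have hfix : B₀⁻¹ *ᵥ e₀ = e₀ := by conv_lhs => rw [← hB₀e, hcancel']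
  refine ⟨fun n => t (ψ n), fun n => B (ψ n) * B₀⁻¹, fun n => htp _, ht0.comp hψt, ?_, ?_, ?_, ?_⟩
  · intro n w
    rw [← Matrix.mulVec_mulVec, hBa, ← hB₀a, hcancel]
  · have cont : Continuous fun M : M3 => M * B₀⁻¹ := continuous_id.matrix_mul continuous_const
    have := (cont.tendsto B₀).comp hlim
    rwa [hinv] at this
  · have h1 := (hasDerivAt_iff_tendsto_slope_zero.1 hqd)
    have h2 : Tendsto (fun n => t (ψ n)) atTop (𝓝[≠] 0) :=
      tendsto_nhdsWithin_iff.2 ⟨ht0.comp hψt, Eventually.of_forall fun n => (htp _).ne'⟩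
    refine (h1.comp h2).congr fun n => ?_
    simp only [Function.comp, zero_add, hq0]
    rw [Matrix.sub_mulVec, Matrix.one_mulVec, ← Matrix.mulVec_mulVec, hfix, hBe]
  -- The limit `B₀` fixes the base point and preserves the diagonal form. As its `(2, 1)` entry is
  -- zero and its `(1, 1)` entry is nonnegative, it fixes the second basis vector, and so does its
  -- inverse. Hence `B (ψ n) * B₀⁻¹` has the same second column as `B (ψ n)`.
  · intro hJ n
    have h21 : B₀ 2 1 = 0 := tendsto_nhds_unique (hentry 2 1) (by
      simp only [(hBJ _ hJ).1]; exact tendsto_const_nhds)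
    have h11 : 0 ≤ B₀ 1 1 := ge_of_tendsto' (hentry 1 1) fun n => (hBJ _ hJ).2
    have hc0 : B₀ 0 0 = 1 := by rw [← mulVec_e₀ B₀ 0, hB₀e]; rfl
    have hc1 : B₀ 1 0 = 0 := by rw [← mulVec_e₀ B₀ 1, hB₀e]; rfl
    have hc2 : B₀ 2 0 = 0 := by rw [← mulVec_e₀ B₀ 2, hB₀e]; rfl
    have d01 := congrFun (congrFun hD 0) 1
    have d11 := congrFun (congrFun hD 1) 1
    simp [Matrix.mul_apply, Fin.sum_univ_three, hc0, hc1, hc2, Matrix.diagonal_apply, h21] at d01 d11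
    have h01 : B₀ 0 1 = 0 := by
      rcases d01 with (h | h) | h
      · omega
      · linarith
      · exact h
    rw [h01] at d11
    have hτ0 : (τ : ℝ) ≠ 0 := by linarith
    have : B₀ 1 1 * B₀ 1 1 = 1 := mul_right_cancel₀ hτ0 (by linarith)
    have h11' : B₀ 1 1 = 1 := by nlinarith
    have hcol : B₀ *ᵥ ![0, 1, 0] = ![0, 1, 0] := by
      funext i
      fin_cases i <;> simp [Matrix.mulVec, dotProduct, Fin.sum_univ_three, h01, h11', h21]
    have hcol' : B₀⁻¹ *ᵥ ![0, 1, 0] = ![0, 1, 0] := by conv_lhs => rw [← hcol, hcancel']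
    have h1 : ((B (ψ n) * B₀⁻¹) *ᵥ ![0, 1, 0]) 2 = 0 := by
      rw [← Matrix.mulVec_mulVec, hcol']
      simp [Matrix.mulVec, dotProduct, Fin.sum_univ_three, (hBJ (ψ n) hJ).1]
    simpa [Matrix.mulVec, dotProduct, Fin.sum_univ_three] using h1

open scoped Matrix.Norms.Elementwise in
/-- If the automorphism group acts locally transitively on the hyperbolic level set at the
base point, then so does its Lie algebra. -/
theorem exists_mem_lieAlg_mulVec_eq {τ : ℕ} (hτ : 2 ≤ τ) {h : Poly} (hh : h.IsHomogeneous τ)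
    (hn : IsAdapted τ h)
    (hloc : ∀ᶠ q in 𝓝[hyp₁ h] e₀, ∃ B ∈ autGroup h, act B e₀ = q) {v : V} (hv : v 0 = 0) :
    ∃ X ∈ lieAlg h, X *ᵥ e₀ = v := by
  obtain ⟨t, A, htp, ht0, hA, hA1, hAt, hAJ⟩ := exists_unipotent_sequence hτ hh hn hloc hv
  -- With the larger of the two sizes as scale, both quotients are bounded and one of them has size
  -- one.
  set s : ℕ → ℝ := fun n => max ‖A n - 1‖ (t n) with hs
  have hsp : ∀ n, 0 < s n := fun n => lt_max_of_lt_right (htp n)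
  have hb : ∀ n, ((s n)⁻¹ • (A n - 1), t n / s n) ∈
      Metric.closedBall (0 : M3) 1 ×ˢ Set.Icc (0 : ℝ) 1 := by
    intro n
    refine ⟨?_, div_nonneg (htp n).le (hsp n).le, (div_le_one (hsp n)).2 (le_max_right _ _)⟩
    rw [mem_closedBall_zero_iff, norm_smul, norm_inv, Real.norm_of_nonneg (hsp n).le,
      inv_mul_le_one₀ (hsp n)]
    exact le_max_left _ _
  have : ProperSpace M3 := FiniteDimensional.proper ℝ M3
  obtain ⟨⟨Y, l⟩, -, ψ, hψ, hlim⟩ :=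
    ((isCompact_closedBall (0 : M3) 1).prod isCompact_Icc).tendsto_subseq hb
  have hψt := hψ.tendsto_atTop
  have hY : Tendsto (fun n => (s (ψ n))⁻¹ • (A (ψ n) - 1)) atTop (𝓝 Y) := hlim.fst_nhds
  have hl : Tendsto (fun n => t (ψ n) / s (ψ n)) atTop (𝓝 l) := hlim.snd_nhds
  have hYL : Y ∈ lieAlg h := mem_lieAlg_of_tendsto (fun n w => hA _ w) (hA1.comp hψt) hY
  have hYe : Y *ᵥ e₀ = l • v := by
    have cont : Continuous fun M : M3 => M *ᵥ e₀ := continuous_id.matrix_mulVec continuous_const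
    refine tendsto_nhds_unique ((cont.tendsto Y).comp hY) ?_
    refine (hl.smul (hAt.comp hψt)).congr fun n => ?_
    simp only [Function.comp, Matrix.smul_mulVec, smul_smul]
    congr 1
    rw [div_mul_eq_mul_div, mul_inv_cancel₀ (htp _).ne', one_div]
  -- If `l = 0`, the base point moves more slowly than the matrices. The limit `Y` then has norm one
  -- and kills the base point, so it is a nonzero multiple of `rotGen`; this contradicts the
  -- normalised `(2, 1)` entry.
  by_cases hl0 : l = 0
  · exfalso
    have hnorm : Tendsto (fun n => ‖(s (ψ n))⁻¹ • (A (ψ n) - 1)‖ ) atTop (𝓝 1) := by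
      have h1 : ∀ᶠ n in atTop, t (ψ n) / s (ψ n) < 1 := by
        rw [hl0] at hl
        exact hl.eventually (gt_mem_nhds one_pos)
      refine tendsto_const_nhds.congr' ?_
      filter_upwards [h1] with n hn1
      rw [div_lt_one (hsp _)] at hn1
      have : s (ψ n) = ‖A (ψ n) - 1‖ := by
        rcases max_choice ‖A (ψ n) - 1‖ (t (ψ n)) with h | h
        · exact h
        · exact absurd (h : s (ψ n) = t (ψ n)) hn1.ne'
      rw [norm_smul, norm_inv, Real.norm_of_nonneg (hsp _).le, ← this,
        inv_mul_cancel₀ (hsp _).ne']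
    have hY1 : ‖Y‖ = 1 := tendsto_nhds_unique hY.norm hnorm
    rw [hl0, zero_smul] at hYe
    have hYJ := eq_smul_rotGen hτ hh hn hYL hYe
    have hY21 : Y 2 1 ≠ 0 := by
      intro h0
      rw [h0, zero_smul] at hYJ
      rw [hYJ, norm_zero] at hY1
      exact zero_ne_one hY1
    have hJ : rotGen ∈ lieAlg h := by
      have := (lieAlg h).smul_mem (Y 2 1)⁻¹ hYL
      generalize Y 2 1 = y at *
      rwa [hYJ, smul_smul, inv_mul_cancel₀ hY21, one_smul] at this
    refine hY21 (tendsto_nhds_unique ((tendsto_pi_nhds.1 ((tendsto_pi_nhds.1 hY) 2)) 1) ?_)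
    have : ∀ n, ((s (ψ n))⁻¹ • (A (ψ n) - 1)) 2 1 = 0 := by
      intro n
      simp [hAJ hJ]
    simp only [this]
    exact tendsto_const_nhds
  · refine ⟨l⁻¹ • Y, (lieAlg h).smul_mem _ hYL, ?_⟩
    rw [Matrix.smul_mulVec, hYe, smul_smul, inv_mul_cancel₀ hl0, one_smul]

/-! ### The Lie algebra in adapted coordinates -/

/-- An infinitesimal automorphism that moves the base point in the direction of the `y`-axis. -/
def genY (p q r θ : ℝ) : M3 := !![0, 1, 0; 1, p, q - θ; 0, q + θ, r]

/-- An infinitesimal automorphism that moves the base point in the direction of the `z`-axis. -/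
def genZ (q r s θ : ℝ) : M3 := !![0, 0, 1; 0, q, r - θ; 1, r + θ, s]

/-- The second-order identities of the two fields contain the same third derivatives of `h`, which
are symmetric. The symmetric parts of the two lower right blocks are therefore the slices of one
binary cubic with coefficients `p, q, r, s`, and only the skew parts are independent of it. -/
theorem exists_genY_genZ {τ : ℕ} (hτ : 2 ≤ τ) {h : Poly} (hh : h.IsHomogeneous τ)
    (hn : IsAdapted τ h) (htr : ∀ v : V, v 0 = 0 → ∃ X ∈ lieAlg h, X *ᵥ e₀ = v) :
    ∃ p q r s θ₁ θ₂ : ℝ, genY p q r θ₁ ∈ lieAlg h ∧ genZ q r s θ₂ ∈ lieAlg h := by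
  obtain ⟨Y, hY, hYe⟩ := htr ![0, 1, 0] rfl
  obtain ⟨Z, hZ, hZe⟩ := htr ![0, 0, 1] rfl
  obtain ⟨y0, y1, y2⟩ := row_zero_of_mem_lieAlg hτ hh hn hY
  obtain ⟨z0, z1, z2⟩ := row_zero_of_mem_lieAlg hτ hh hn hZ
  have hτ2 : (2 : ℝ) ≤ τ := by exact_mod_cast hτ
  have hτ0 : (τ : ℝ) ≠ 0 := by linarith
  have y10 : Y 1 0 = 1 := by rw [← mulVec_e₀ Y 1, hYe]; rfl
  have y20 : Y 2 0 = 0 := by rw [← mulVec_e₀ Y 2, hYe]; rfl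
  have z10 : Z 1 0 = 0 := by rw [← mulVec_e₀ Z 1, hZe]; rfl
  have z20 : Z 2 0 = 1 := by rw [← mulVec_e₀ Z 2, hZe]; rfl
  have a12 := lieAlg_second hY e₀ 1 2
  have a22 := lieAlg_second hY e₀ 2 2
  have b11 := lieAlg_second hZ e₀ 1 1
  have b12 := lieAlg_second hZ e₀ 1 2
  simp only [hn.hessian_apply, hYe, hZe, Fin.sum_univ_three] at a12 a22 b11 b12
  simp [-map_eq_zero] at a12 a22 b11 b12
  rw [pderiv_comm 1 2 h] at b11 b12
  rw [pderiv_comm 1 2 (pderiv 1 h)] at b11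
  have e1 : Y 1 2 + Y 2 1 = 2 * Z 1 1 := mul_right_cancel₀ hτ0 (by linarith)
  have e2 : Z 1 2 + Z 2 1 = 2 * Y 2 2 := mul_right_cancel₀ hτ0 (by linarith)
  refine ⟨Y 1 1, Z 1 1, Y 2 2, Z 2 2, (Y 2 1 - Y 1 2) / 2, (Z 2 1 - Z 1 2) / 2, ?_, ?_⟩
  · convert hY using 1
    ext i j
    fin_cases i <;> fin_cases j <;> simp [genY, y0, y1, y2, y10, y20] <;> linarith
  · convert hZ using 1
    ext i j
    fin_cases i <;> fin_cases j <;> simp [genZ, z0, z1, z2, z10, z20] <;> linarith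

/-- The two-dimensional non-abelian subalgebras in standard position. -/
def HasAffineAlg (h : Poly) : Prop :=
  ∃ r θ : ℝ, θ ^ 2 = 1 + r ^ 2 ∧ genY (2 * r) 0 r 0 ∈ lieAlg h ∧ genZ 0 r 0 θ ∈ lieAlg h

/-- The two-dimensional abelian subalgebras in standard position. -/
def HasFlatAlg (h : Poly) : Prop :=
  ∃ r s : ℝ, r ≠ 0 ∧ genY (r - 1 / r) 0 r 0 ∈ lieAlg h ∧ genZ 0 r s 0 ∈ lieAlg h

/-- Modulo `rotGen`, bracketing with `rotGen` exchanges the two fields up to sign, so the binary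
cubic is rotation invariant and vanishes. Subtracting multiples of `rotGen` then adjusts the skew
parts at will. -/
theorem hasAffineAlg_of_rotGen_mem {τ : ℕ} (hτ : 2 ≤ τ) {h : Poly} (hh : h.IsHomogeneous τ)
    (hn : IsAdapted τ h) (hJ : rotGen ∈ lieAlg h) {p q r s θ₁ θ₂ : ℝ}
    (hY : genY p q r θ₁ ∈ lieAlg h) (hZ : genZ q r s θ₂ ∈ lieAlg h) : HasAffineAlg h := by
  have w1 := eq_smul_rotGen hτ hh hn
    (sub_mem (commutator_mem_lieAlg hJ hY) hZ) (by
      funext i; rw [mulVec_e₀]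
      fin_cases i <;> simp [rotGen, genY, genZ])
  have w2 := eq_smul_rotGen hτ hh hn
    (add_mem (commutator_mem_lieAlg hJ hZ) hY) (by
      funext i; rw [mulVec_e₀]
      fin_cases i <;> simp [rotGen, genY, genZ])
  have a11 := congrFun (congrFun w1 1) 1
  have a12 := congrFun (congrFun w1 1) 2
  have a22 := congrFun (congrFun w1 2) 2
  have b11 := congrFun (congrFun w2 1) 1
  have b22 := congrFun (congrFun w2 2) 2
  simp [rotGen, genY, genZ] at a11 a12 a22 b11 b22
  have hq : q = 0 := by linarith
  have hs : s = 0 := by linarith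
  have hr : r = 0 := by linarith
  have hp : p = 0 := by linarith
  subst hq hs hr hp
  refine ⟨0, 1, by norm_num, ?_, ?_⟩
  · convert sub_mem hY ((lieAlg h).smul_mem θ₁ hJ) using 1
    ext i j
    fin_cases i <;> fin_cases j <;> simp [rotGen, genY]
  · convert sub_mem hZ ((lieAlg h).smul_mem (θ₂ - 1) hJ) using 1
    ext i j
    fin_cases i <;> fin_cases j <;> simp [rotGen, genZ]; ring

/-- With `Y` and `Z` the two fields, `[Y, Z] + θ₁ Y + θ₂ Z` kills the base point, so it is a
multiple of `rotGen` and hence zero. The equations are the diagonal entries of its lower right block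
and the symmetric and skew combinations of the off-diagonal ones. -/
theorem structure_equations {τ : ℕ} (hτ : 2 ≤ τ) {h : Poly} (hh : h.IsHomogeneous τ)
    (hn : IsAdapted τ h) (hJ : rotGen ∉ lieAlg h) {p q r s θ₁ θ₂ : ℝ}
    (hY : genY p q r θ₁ ∈ lieAlg h) (hZ : genZ q r s θ₂ ∈ lieAlg h) :
    3 * θ₂ * q + θ₁ * (p - 2 * r) = 0 ∧ θ₂ * (2 * r - p) + θ₁ * (2 * q - s) = 0 ∧
      3 * θ₁ * r + θ₂ * (s - 2 * q) = 0 ∧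
      q ^ 2 + r ^ 2 - p * r - q * s = 1 - θ₁ ^ 2 - θ₂ ^ 2 := by
  set W := genY p q r θ₁ * genZ q r s θ₂ - genZ q r s θ₂ * genY p q r θ₁ +
    (θ₁ • genY p q r θ₁ + θ₂ • genZ q r s θ₂) with hW
  have hWm : W ∈ lieAlg h := add_mem (commutator_mem_lieAlg hY hZ)
    (add_mem ((lieAlg h).smul_mem _ hY) ((lieAlg h).smul_mem _ hZ))
  have hWJ := eq_smul_rotGen hτ hh hn hWm (by
    funext i; rw [mulVec_e₀]
    fin_cases i <;> simp [hW, genY, genZ])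
  have hW0 : W 2 1 = 0 := by
    by_contra hne
    refine hJ ?_
    have := (lieAlg h).smul_mem (W 2 1)⁻¹ hWm
    clear_value W
    generalize W 2 1 = y at *
    rwa [hWJ, smul_smul, inv_mul_cancel₀ hne, one_smul] at this
  rw [hW0, zero_smul] at hWJ
  have a11 := congrFun (congrFun hWJ 1) 1
  have a12 := congrFun (congrFun hWJ 1) 2
  have a21 := congrFun (congrFun hWJ 2) 1
  have a22 := congrFun (congrFun hWJ 2) 2
  simp [hW, genY, genZ] at a11 a12 a21 a22
  refine ⟨?_, ?_, ?_, ?_⟩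
  · linear_combination a11
  · linear_combination (a12 + a21) / 2
  · linear_combination a22
  · linear_combination (a21 - a12) / 2

theorem rot_mul_transpose (φ : ℝ) : rot φ * (rot φ)ᵀ = 1 := by
  have := Real.sin_sq_add_cos_sq φ
  ext i j
  fin_cases i <;> fin_cases j <;> simp [rot, Matrix.mul_apply, Fin.sum_univ_three] <;> grind

theorem mem_lieAlg_subst_rot {h : Poly} {M : M3} (hM : M ∈ lieAlg h) (φ : ℝ) :
    (rot φ)ᵀ * M * rot φ ∈ lieAlg (subst (rot φ) h) := by
  refine mem_lieAlg_subst ?_ hM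
  rw [← Matrix.mul_assoc, ← Matrix.mul_assoc, rot_mul_transpose, Matrix.one_mul]

/-- Under a rotation `(p, q, r, s)` transforms as a binary cubic and `(θ₁, θ₂)` as a vector. Only
the formula for `q'` is recorded, because the abelian case is normalised by `q' = 0`. -/
theorem genY_genZ_rot {h : Poly} {p q r s θ₁ θ₂ : ℝ}
    (hY : genY p q r θ₁ ∈ lieAlg h) (hZ : genZ q r s θ₂ ∈ lieAlg h) (φ : ℝ) {a b : ℝ}
    (ha : Real.cos φ = a) (hb : Real.sin φ = b) :
    ∃ p' q' r' s' : ℝ, q' = -a ^ 2 * b * p + (a ^ 3 - 2 * a * b ^ 2) * q +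
        (2 * a ^ 2 * b - b ^ 3) * r + a * b ^ 2 * s ∧
      genY p' q' r' (a * θ₁ + b * θ₂) ∈ lieAlg (subst (rot φ) h) ∧
      genZ q' r' s' (-b * θ₁ + a * θ₂) ∈ lieAlg (subst (rot φ) h) := by
  have hab : b ^ 2 + a ^ 2 = 1 := by rw [← ha, ← hb]; exact Real.sin_sq_add_cos_sq φ
  refine ⟨a ^ 3 * p + 3 * a ^ 2 * b * q + 3 * a * b ^ 2 * r + b ^ 3 * s, _,
    a * b ^ 2 * p + (b ^ 3 - 2 * a ^ 2 * b) * q + (a ^ 3 - 2 * a * b ^ 2) * r + a ^ 2 * b * s,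
    -b ^ 3 * p + 3 * a * b ^ 2 * q - 3 * a ^ 2 * b * r + a ^ 3 * s, rfl, ?_, ?_⟩
  · convert mem_lieAlg_subst_rot (add_mem ((lieAlg h).smul_mem a hY) ((lieAlg h).smul_mem b hZ)) φ
      using 1
    ext i j
    fin_cases i <;> fin_cases j <;>
      simp [rot, genY, genZ, Matrix.mul_apply, Fin.sum_univ_three, ha, hb] <;> grind
  · convert mem_lieAlg_subst_rot
      (add_mem ((lieAlg h).smul_mem (-b) hY) ((lieAlg h).smul_mem a hZ)) φ using 1
    ext i j
    fin_cases i <;> fin_cases j <;>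
      simp [rot, genY, genZ, Matrix.mul_apply, Fin.sum_univ_three, ha, hb] <;> grind

theorem isAdapted_rot {τ : ℕ} {h : Poly} (hn : IsAdapted τ h) (φ : ℝ) :
    IsAdapted τ (subst (rot φ) h) := by
  have e : rot φ *ᵥ e₀ = e₀ := by rw [rot_mulVec]; simp [e₀]
  have := Real.sin_sq_add_cos_sq φ
  rw [IsAdapted, hessian_subst, e, hn]
  ext i j
  fin_cases i <;> fin_cases j <;>
    simp [rot, Matrix.mul_apply, Fin.sum_univ_three, Matrix.diagonal_apply] <;> grind

theorem rot_neg_mul (φ : ℝ) : rot φ * rot (-φ) = 1 := by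
  have := Real.sin_sq_add_cos_sq φ
  ext i j
  fin_cases i <;> fin_cases j <;> simp [rot, Matrix.mul_apply, Fin.sum_univ_three] <;> grind

theorem rotGen_mem_rot_iff {h : Poly} (φ : ℝ) (hJ : rotGen ∈ lieAlg (subst (rot φ) h)) :
    rotGen ∈ lieAlg h := by
  have := mem_lieAlg_subst (S := rot (-φ)) (N := rotGen) (M := rotGen) (by
    ext i j
    fin_cases i <;> fin_cases j <;> simp [rot, rotGen]) hJ
  rwa [subst_subst, rot_neg_mul, subst_one] at this

/-- After a rotation, an infinitesimally transitive Lie algebra contains a standard one. -/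
theorem exists_rot_alg {τ : ℕ} (hτ : 2 ≤ τ) {h : Poly} (hh : h.IsHomogeneous τ)
    (hn : IsAdapted τ h) (htr : ∀ v : V, v 0 = 0 → ∃ X ∈ lieAlg h, X *ᵥ e₀ = v) :
    ∃ φ : ℝ, HasAffineAlg (subst (rot φ) h) ∨ HasFlatAlg (subst (rot φ) h) := by
  obtain ⟨p, q, r, s, θ₁, θ₂, hY, hZ⟩ := exists_genY_genZ hτ hh hn htr
  by_cases hJ : rotGen ∈ lieAlg h
  · refine ⟨0, Or.inl ?_⟩
    have : rot 0 = 1 := by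
      ext i j
      fin_cases i <;> fin_cases j <;> simp [rot]
    rw [this, subst_one]
    exact hasAffineAlg_of_rotGen_mem hτ hh hn hJ hY hZ
  have hJ' : ∀ φ, rotGen ∉ lieAlg (subst (rot φ) h) := fun φ hφ => hJ (rotGen_mem_rot_iff φ hφ)
  by_cases hθ : θ₁ = 0 ∧ θ₂ = 0
  · obtain ⟨rfl, rfl⟩ := hθ
    -- The coefficient `q'` is an odd cubic in `(cos φ, sin φ)`: it takes the values `q` and `-q` at
    -- `0` and `π`, so it vanishes for some angle.
    obtain ⟨φ, hφ⟩ : ∃ φ : ℝ, -(Real.cos φ) ^ 2 * Real.sin φ * p + ((Real.cos φ) ^ 3 -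
        2 * Real.cos φ * (Real.sin φ) ^ 2) * q + (2 * (Real.cos φ) ^ 2 * Real.sin φ -
        (Real.sin φ) ^ 3) * r + Real.cos φ * (Real.sin φ) ^ 2 * s = 0 := by
      refine mem_range_of_exists_le_of_exists_ge (f := fun φ : ℝ => -(Real.cos φ) ^ 2 * Real.sin φ * p +
        ((Real.cos φ) ^ 3 - 2 * Real.cos φ * (Real.sin φ) ^ 2) * q + (2 * (Real.cos φ) ^ 2 *
        Real.sin φ - (Real.sin φ) ^ 3) * r + Real.cos φ * (Real.sin φ) ^ 2 * s)
        (by fun_prop) ?_ ?_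
      · rcases le_total q 0 with h | h
        · exact ⟨0, by simpa using h⟩
        · exact ⟨Real.pi, by simpa [Odd.neg_one_pow (n := 3) (by decide)] using h⟩
      · rcases le_total q 0 with h | h
        · exact ⟨Real.pi, by simpa [Odd.neg_one_pow (n := 3) (by decide)] using h⟩
        · exact ⟨0, by simpa using h⟩
    obtain ⟨p', q', r', s', hq', hY', hZ'⟩ := genY_genZ_rot hY hZ φ rfl rfl
    rw [hφ] at hq'
    simp only [mul_zero, add_zero, hq'] at hY' hZ'
    obtain ⟨-, -, -, h4⟩ := structure_equations hτ (isHomogeneous_subst hh _)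
      (isAdapted_rot hn φ) (hJ' φ) hY' hZ'
    have hr : r' ≠ 0 := by rintro rfl; norm_num at h4
    refine ⟨φ, Or.inr ⟨r', s', hr, ?_, hZ'⟩⟩
    convert hY' using 2
    field_simp
    linear_combination h4
  -- Rotating `θ₁` to zero makes the first three structure equations linear, with solution `q = 0`,
  -- `p = 2 r`, `s = 0`; the fourth becomes `θ ^ 2 = 1 + r ^ 2`.
  · obtain ⟨φ, hφ⟩ := exists_cos_sin_eq_zero θ₁ θ₂
    obtain ⟨p', q', r', s', -, hY', hZ'⟩ := genY_genZ_rot hY hZ φ rfl rfl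
    rw [hφ] at hY'
    obtain ⟨h1, h2, h3, h4⟩ := structure_equations hτ (isHomogeneous_subst hh _)
      (isAdapted_rot hn φ) (hJ' φ) hY' hZ'
    set θ := -Real.sin φ * θ₁ + Real.cos φ * θ₂ with hθd
    have hne : θ ≠ 0 := by
      intro h0
      refine hθ ?_
      have hab := Real.sin_sq_add_cos_sq φ
      rw [hθd] at h0
      exact ⟨by linear_combination Real.cos φ * hφ - Real.sin φ * h0 - θ₁ * hab,
        by linear_combination Real.sin φ * hφ + Real.cos φ * h0 - θ₂ * hab⟩
    have hq : q' = 0 := by simpa [hne] using h1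
    have hp : p' = 2 * r' := by
      have : 2 * r' - p' = 0 := by simpa [hne] using h2
      linarith
    have hs : s' = 0 := by
      have : s' - 2 * q' = 0 := by simpa [hne] using h3
      linarith
    subst hq hp hs
    refine ⟨φ, Or.inl ⟨r', θ, by linear_combination h4, hY', hZ'⟩⟩

/-! ### Invariant polynomials of the standard algebras -/

theorem lieDer_diagonal_monomial (d : V) (m : Fin 3 →₀ ℕ) (c : ℝ) :
    lieDer (Matrix.diagonal d) (monomial m c) = (∑ i, d i * m i) • monomial m c := by
  rw [lieDer_apply, Finset.sum_smul]
  refine Finset.sum_congr rfl fun i _ => ?_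
  have : linForm (Matrix.diagonal d) i = C (d i) * X i := by
    rw [linForm, Finset.sum_eq_single i]
    · simp
    · intro b _ hb; simp [Matrix.diagonal_apply_ne' _ hb]
    · simp
  rw [this, mul_assoc, X_mul_pderiv_monomial, mul_smul, smul_eq_C_mul]
  congr 1
  rw [smul_eq_C_mul, nsmul_eq_mul]
  simp

theorem coeff_lieDer_diagonal (d : V) (m : Fin 3 →₀ ℕ) (g : Poly) :
    coeff m (lieDer (Matrix.diagonal d) g) = (∑ i, d i * m i) * coeff m g := by
  induction g using MvPolynomial.induction_on' with
  | monomial n c =>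
    rw [lieDer_diagonal_monomial, coeff_smul, coeff_monomial, smul_eq_mul]
    split_ifs with h
    · rw [h]
    · simp
  | add p q hp hq => rw [map_add, coeff_add, coeff_add, hp, hq]; ring

/-- A diagonal field multiplies each monomial by its weight, so an invariant polynomial contains
monomials of weight zero only. -/
theorem weight_eq_zero {d : V} {g : Poly} (hd : Matrix.diagonal d ∈ lieAlg g) {m : Fin 3 →₀ ℕ}
    (hm : coeff m g ≠ 0) : ∑ i, d i * m i = 0 := by
  have := coeff_lieDer_diagonal d m g
  rw [mem_lieAlg.1 hd, coeff_zero] at this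
  exact (mul_eq_zero.1 this.symm).resolve_right hm

theorem sum_eq_of_isHomogeneous {τ : ℕ} {g : Poly} (hg : g.IsHomogeneous τ) {m : Fin 3 →₀ ℕ}
    (hm : coeff m g ≠ 0) : m 0 + m 1 + m 2 = τ := by
  have := hg hm
  rw [Finsupp.weight_apply, Finsupp.sum_fintype _ _ (by simp), Fin.sum_univ_three] at this
  simpa using this

/-- The two weights and the degree are three linear equations for the exponents, independent because
`1 + r ^ 2` and `μ - ν` are nonzero. One monomial survives, with coefficient the value at `(1, 1,
1)`. -/
theorem eq_flatPoly_of_mem_lieAlg {τ : ℕ} {g : Poly} (hg : g.IsHomogeneous τ) {r μ ν : ℝ}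
    (hr : r ≠ 0) (hμν : μ ≠ ν) (h1 : Matrix.diagonal ![-1 / r, r, r] ∈ lieAlg g)
    (h2 : Matrix.diagonal ![0, μ, ν] ∈ lieAlg g) (hg1 : eval ![1, 1, 1] g = 1) :
    ∃ a b c : ℕ, a + b + c = τ ∧ g = flatPoly a b c := by
  have hg0 : g ≠ 0 := by rintro rfl; simp at hg1
  obtain ⟨m, hm⟩ := ne_zero_iff.1 hg0
  have huniq : ∀ n, coeff n g ≠ 0 → n = m := by
    intro n hn
    have a1 := weight_eq_zero h1 hm
    have a2 := weight_eq_zero h2 hm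
    have b1 := weight_eq_zero h1 hn
    have b2 := weight_eq_zero h2 hn
    simp [Fin.sum_univ_three] at a1 a2 b1 b2
    have a3 : (m 0 : ℝ) + m 1 + m 2 = τ := by exact_mod_cast sum_eq_of_isHomogeneous hg hm
    have b3 : (n 0 : ℝ) + n 1 + n 2 = τ := by exact_mod_cast sum_eq_of_isHomogeneous hg hn
    have a1' : (m 0 : ℝ) = r ^ 2 * (m 1 + m 2) := by field_simp at a1; linarith
    have b1' : (n 0 : ℝ) = r ^ 2 * (n 1 + n 2) := by field_simp at b1; linarith
    have e12 : (n 1 : ℝ) + n 2 = m 1 + m 2 := by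
      have : (1 + r ^ 2) * ((n 1 : ℝ) + n 2 - (m 1 + m 2)) = 0 := by
        linear_combination b3 - a3 - b1' + a1'
      rcases mul_eq_zero.1 this with h | h
      · nlinarith
      · linarith
    have e1 : (n 1 : ℝ) = m 1 := by
      have : (μ - ν) * ((n 1 : ℝ) - m 1) = 0 := by linear_combination b2 - a2 - ν * e12
      rcases mul_eq_zero.1 this with h | h
      · exact absurd (sub_eq_zero.1 h) hμν
      · linarith
    have e2 : (n 2 : ℝ) = m 2 := by linarith
    have e0 : (n 0 : ℝ) = m 0 := by linarith
    ext i
    fin_cases i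
    · exact_mod_cast e0
    · exact_mod_cast e1
    · exact_mod_cast e2
  have hgm : g = monomial m (coeff m g) := by
    ext n
    rw [coeff_monomial]
    split_ifs with h
    · rw [h]
    · by_contra hn; exact h (huniq n hn).symm
  have hc : coeff m g = 1 := by
    rw [hgm, eval_monomial, Finsupp.prod_fintype _ _ (by simp), Fin.prod_univ_three] at hg1
    simpa using hg1
  rw [hc] at hgm
  refine ⟨m 0, m 1, m 2, sum_eq_of_isHomogeneous hg hm, ?_⟩
  refine MvPolynomial.funext fun v => ?_
  rw [hgm, eval_monomial, Finsupp.prod_fintype _ _ (by simp), Fin.prod_univ_three]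
  simp [flatPoly]

/-- A nilpotent matrix of rank two. -/
def nilp (κ : ℝ) : M3 := !![0, 0, 0; 1, 0, 0; 0, κ, 0]

/-- The point on the left moves with the flow of `nilp κ`, quadratic in time because the cube of the
matrix is zero; an invariant polynomial is constant along it. -/
theorem eval_nilp_flow {g : Poly} {κ : ℝ} (hN : nilp κ ∈ lieAlg g) (u v w t : ℝ) :
    eval ![u, v + t * u, w + κ * (t * v + t ^ 2 / 2 * u)] g = eval ![u, v, w] g := by
  set c : ℝ → V := fun t => ![u, v + t * u, w + κ * (t * v + t ^ 2 / 2 * u)] with hc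
  have hd : ∀ t : ℝ, HasDerivAt (fun t => eval (c t) g) 0 t := by
    intro t
    have h1 : HasDerivAt c (nilp κ *ᵥ c t) t := by
      rw [hasDerivAt_pi]
      intro i
      fin_cases i
      · simpa [hc, nilp, Matrix.mulVec, dotProduct, Fin.sum_univ_three] using hasDerivAt_const t u
      · refine (((hasDerivAt_id t).mul_const u).const_add v).congr_deriv ?_
        simp [hc, nilp, Matrix.mulVec, dotProduct, Fin.sum_univ_three]
      · refine (((((hasDerivAt_id t).mul_const v).add
          ((((hasDerivAt_id t).pow 2).div_const 2).mul_const u)).const_mul κ).const_add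
            w).congr_deriv ?_
        simp [hc, nilp, Matrix.mulVec, dotProduct, Fin.sum_univ_three]
    refine ((hasFDerivAt_eval g _).comp_hasDerivAt t h1).congr_deriv ?_
    have := mem_lieAlg_iff.1 hN (c t)
    rw [← this]
    simp only [FunLike.coe_sum, Finset.sum_apply, FunLike.coe_smul, Pi.smul_apply,
      ContinuousLinearMap.proj_apply, smul_eq_mul]
    exact Finset.sum_congr rfl fun i _ => mul_comm _ _
  have := is_const_of_deriv_eq_zero (fun t => (hd t).differentiableAt) (fun t => (hd t).deriv) t 0
  simpa [hc] using this

/-- For exponents with `m 1 = 0`, the weight and the degree are two independent equations, so one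
monomial is left on this plane. -/
theorem eval_axis {τ : ℕ} {g : Poly} (hg : g.IsHomogeneous τ) {l μ : ℝ}
    (hμ : μ ≠ 0) (h1 : Matrix.diagonal ![l + μ, l, l - μ] ∈ lieAlg g)
    (hg1 : eval ![1, 0, 1] g = 1) :
    ∃ k : ℕ, k ≤ τ ∧ ∀ u w : ℝ, eval ![u, 0, w] g = u ^ (τ - k) * w ^ k := by
  have hev : ∀ u w : ℝ, eval ![u, 0, w] g =
      ∑ m ∈ g.support with m 1 = 0, coeff m g * (u ^ m 0 * w ^ m 2) := by
    intro u w
    rw [eval_eq', Finset.sum_filter]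
    refine Finset.sum_congr rfl fun m _ => ?_
    rw [Fin.prod_univ_three]
    split_ifs with h
    · simp [h]
    · simp [h]
  have hne : ∃ m ∈ g.support, m 1 = 0 := by
    by_contra hcon
    push Not at hcon
    rw [hev, Finset.filter_false_of_mem hcon, Finset.sum_empty] at hg1
    exact zero_ne_one hg1
  obtain ⟨m, hm, hm1⟩ := hne
  have hfil : g.support.filter (fun n => n 1 = 0) = {m} := by
    ext n
    simp only [Finset.mem_filter, Finset.mem_singleton]
    refine ⟨?_, by rintro rfl; exact ⟨hm, hm1⟩⟩
    rintro ⟨hn, hn1⟩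
    rw [mem_support_iff] at hn hm
    have a1 := weight_eq_zero h1 hm
    have b1 := weight_eq_zero h1 hn
    simp [Fin.sum_univ_three, hm1, hn1] at a1 b1
    have a3 : m 0 + m 1 + m 2 = τ := sum_eq_of_isHomogeneous hg hm
    have b3 : n 0 + n 1 + n 2 = τ := sum_eq_of_isHomogeneous hg hn
    rw [hm1] at a3
    rw [hn1] at b3
    have a4 : (m 0 : ℝ) + m 2 = τ := by exact_mod_cast a3
    have b4 : (n 0 : ℝ) + n 2 = τ := by exact_mod_cast b3
    have e0 : (n 0 : ℝ) = m 0 := by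
      have : (2 * μ) * ((n 0 : ℝ) - m 0) = 0 := by
        linear_combination b1 - a1 - (l - μ) * (b4 - a4)
      rcases mul_eq_zero.1 this with h | h
      · exact absurd (by linarith) hμ
      · linarith
    have e2 : (n 2 : ℝ) = m 2 := by linarith
    ext i
    fin_cases i
    · exact_mod_cast e0
    · exact hn1.trans hm1.symm
    · exact_mod_cast e2
  simp only [hfil, Finset.sum_singleton] at hev
  have hc : coeff m g = 1 := by
    rw [hev] at hg1
    simpa using hg1
  have a3 : m 0 + m 1 + m 2 = τ := sum_eq_of_isHomogeneous hg (mem_support_iff.1 hm)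
  refine ⟨m 2, by omega, fun u w => ?_⟩
  rw [hev, hc, one_mul]
  congr 2
  omega

/-- The nilpotent flow carries every point with `u ≠ 0` into the plane `v = 0`, where `eval_axis`
applies. This gives a formula for `g` with a power of `u` as denominator, and that `g` is a
polynomial bounds `k`. -/
theorem eq_of_mem_lieAlg_nilp {τ : ℕ} {g : Poly} (hg : g.IsHomogeneous τ) {l μ κ : ℝ}
    (hμ : μ ≠ 0) (hκ : κ ≠ 0) (h1 : Matrix.diagonal ![l + μ, l, l - μ] ∈ lieAlg g)
    (h2 : nilp κ ∈ lieAlg g) (hg1 : eval ![1, 0, 1] g = 1) :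
    ∃ k : ℕ, 2 * k ≤ τ ∧ ∀ u v w : ℝ,
      eval ![u, v, w] g = u ^ (τ - 2 * k) * (u * w - κ / 2 * v ^ 2) ^ k := by
  obtain ⟨k, hk, hax⟩ := eval_axis hg hμ h1 hg1
  set q : Poly := X 0 * X 2 - C (κ / 2) * X 1 ^ 2 with hq
  have hpoly : X 0 ^ k * g = X 0 ^ (τ - k) * q ^ k := by
    refine eq_of_eqOn_open (W := {v : V | v 0 ≠ 0})
      (isOpen_ne_fun (continuous_apply 0) continuous_const) ⟨![1, 0, 0], by simp⟩ fun v hv => ?_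
    have hv0 : v 0 ≠ 0 := hv
    have hvv : v = ![v 0, v 1, v 2] := by funext i; fin_cases i <;> rfl
    have hfl := eval_nilp_flow h2 (v 0) (v 1) (v 2) (-v 1 / v 0)
    have e1 : v 1 + -v 1 / v 0 * v 0 = 0 := by field_simp; ring
    rw [e1, hax, ← hvv] at hfl
    rw [map_mul, ← hfl]
    simp only [hq, map_mul, map_pow, map_sub, eval_X, eval_C]
    have e2 : v 2 + κ * (-v 1 / v 0 * v 1 + (-v 1 / v 0) ^ 2 / 2 * v 0) =
        (v 0 * v 2 - κ / 2 * v 1 ^ 2) / v 0 := by field_simp; ring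
    rw [e2, div_pow]
    field_simp
  have hX : (X 0 : Poly) ≠ 0 := X_ne_zero 0
  by_cases hkτ : 2 * k ≤ τ
  · refine ⟨k, hkτ, fun u v w => ?_⟩
    have e : g = X 0 ^ (τ - 2 * k) * q ^ k := by
      refine mul_left_cancel₀ (pow_ne_zero k hX) (hpoly.trans ?_)
      rw [← mul_assoc, ← pow_add]
      congr 2
      omega
    rw [e]
    simp [hq]
  -- Otherwise `u` would divide a power of `u w - κ / 2 v ^ 2`, which does not vanish at `(0, 1,
  -- 0)`.
  · exfalso
    have e : X 0 ^ (2 * k - τ) * g = q ^ k := by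
      refine mul_left_cancel₀ (pow_ne_zero (τ - k) hX) (Eq.trans ?_ hpoly)
      rw [← mul_assoc, ← pow_add]
      congr 2
      omega
    have := congrArg (eval ![0, 1, 0]) e
    simp [hq, (show 2 * k - τ ≠ 0 by omega)] at this
    have h0 := eq_zero_of_pow_eq_zero this.symm
    exact hκ (by linarith)

-- Linear coordinates that put the standard algebras in triangular or diagonal form.

theorem inv_mul_eq_mul_inv_of_mul_eq {L M N : M3} (hu : IsUnit L.det) (e : L * M = N * L) :
    L⁻¹ * N = M * L⁻¹ :=
  calc L⁻¹ * N = L⁻¹ * (N * L) * L⁻¹ := by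
        rw [Matrix.mul_assoc, Matrix.mul_assoc, Matrix.mul_nonsing_inv _ hu, Matrix.mul_one]
    _ = M * L⁻¹ := by rw [← e, ← Matrix.mul_assoc, Matrix.nonsing_inv_mul _ hu, Matrix.one_mul]

/-- Coordinates in which the standard non-abelian algebra is triangular. -/
def affCoord (r θ : ℝ) : M3 := !![1, r + θ, 0; 0, 0, 1; 1, r - θ, 0]

theorem affCoord_mul_genY {r θ : ℝ} (hθ : θ ^ 2 = 1 + r ^ 2) :
    affCoord r θ * genY (2 * r) 0 r 0 =
      Matrix.diagonal ![r + θ, r, r - θ] * affCoord r θ := by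
  ext i j
  fin_cases i <;> fin_cases j <;>
    simp [affCoord, genY, Matrix.mul_apply, Fin.sum_univ_three, Matrix.diagonal_apply]
  · linear_combination -hθ
  · linear_combination -hθ

theorem affCoord_mul_genZ {r θ : ℝ} (hθ : θ ^ 2 = 1 + r ^ 2) :
    affCoord r θ * genZ 0 r 0 θ = nilp (1 + (r - θ) ^ 2) * affCoord r θ := by
  ext i j
  fin_cases i <;> fin_cases j <;>
    simp [affCoord, genZ, nilp, Matrix.mul_apply, Fin.sum_univ_three]
  · linear_combination -hθ
  · ring

theorem affCoord_mulVec (r θ : ℝ) (v : V) :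
    affCoord r θ *ᵥ v = ![v 0 + (r + θ) * v 1, v 2, v 0 + (r - θ) * v 1] := by
  funext i
  fin_cases i <;> simp [affCoord, Matrix.mulVec, dotProduct, Fin.sum_univ_three]

theorem det_affCoord (r θ : ℝ) : (affCoord r θ).det = 2 * θ := by
  rw [affCoord, Matrix.det_fin_three]; simp; ring

/-- The change from null coordinates to the coordinates of the normal forms. -/
def nullCoord (c : ℝ) : M3 := !![1 / 2, 0, 1 / 2; 0, c, 0; 1 / 2, 0, -1 / 2]

theorem det_nullCoord (c : ℝ) : (nullCoord c).det = -c / 2 := by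
  rw [nullCoord, Matrix.det_fin_three]; simp; ring

theorem eval_nullCoord_affinePoly (τ k : ℕ) (c : ℝ) (v : V) :
    eval (nullCoord c *ᵥ v) (affinePoly τ k) =
      v 0 ^ (τ - 2 * k) * (v 0 * v 2 - c ^ 2 * v 1 ^ 2) ^ k := by
  have e : nullCoord c *ᵥ v = ![(v 0 + v 2) / 2, c * v 1, (v 0 - v 2) / 2] := by
    funext i
    fin_cases i <;> simp [nullCoord, Matrix.mulVec, dotProduct, Fin.sum_univ_three] <;> ring
  rw [e, affinePoly, quad]
  simp
  congr 2 <;> ring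

/-- A transitive non-abelian algebra forces one of the first two normal forms. -/
theorem exists_subst_affinePoly {τ : ℕ} {h : Poly} (hh : h.IsHomogeneous τ) (h1 : eval e₀ h = 1)
    (hA : HasAffineAlg h) :
    ∃ k : ℕ, 2 * k ≤ τ ∧ ∃ A : GL3, subst A.val (affinePoly τ k) = h := by
  obtain ⟨r, θ, hθ, hY, hZ⟩ := hA
  have hθ0 : θ ≠ 0 := by rintro rfl; nlinarith
  obtain ⟨κ, hκ⟩ : ∃ κ, κ = 1 + (r - θ) ^ 2 := ⟨_, rfl⟩
  have hκ0 : 0 < κ := by rw [hκ]; positivity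
  obtain ⟨L, hL⟩ : ∃ L, L = affCoord r θ := ⟨_, rfl⟩
  have hdet : L.det ≠ 0 := by
    rw [hL, det_affCoord]; positivity
  have hu : IsUnit L.det := isUnit_iff_ne_zero.2 hdet
  have hD : Matrix.diagonal ![r + θ, r, r - θ] ∈ lieAlg (subst L⁻¹ h) :=
    mem_lieAlg_subst (inv_mul_eq_mul_inv_of_mul_eq hu (by rw [hL, affCoord_mul_genY hθ])) hY
  have hN : nilp κ ∈ lieAlg (subst L⁻¹ h) :=
    mem_lieAlg_subst (inv_mul_eq_mul_inv_of_mul_eq hu (by rw [hL, hκ, affCoord_mul_genZ hθ])) hZ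
  have hback : subst L (subst L⁻¹ h) = h := by
    rw [subst_subst, Matrix.nonsing_inv_mul _ hu, subst_one]
  have hg1 : eval ![1, 0, 1] (subst L⁻¹ h) = 1 := by
    have : (![1, 0, 1] : V) = L *ᵥ e₀ := by rw [hL, affCoord_mulVec]; simp [e₀]
    rw [this, ← eval_subst, hback, h1]
  obtain ⟨k, hk, hg⟩ := eq_of_mem_lieAlg_nilp (isHomogeneous_subst hh _) hθ0 hκ0.ne' hD hN hg1
  refine ⟨k, hk, ?_⟩
  obtain ⟨c, hc2⟩ : ∃ c : ℝ, c ^ 2 = κ / 2 := ⟨_, Real.sq_sqrt (by positivity)⟩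
  have hc0 : c ≠ 0 := by rintro rfl; rw [zero_pow two_ne_zero] at hc2; linarith
  have hTdet : (nullCoord c * L).det ≠ 0 := by
    rw [Matrix.det_mul, det_nullCoord]
    exact mul_ne_zero (div_ne_zero (neg_ne_zero.2 hc0) two_ne_zero) hdet
  refine ⟨Matrix.GeneralLinearGroup.mkOfDetNeZero _ hTdet, ?_⟩
  have hsub : subst (nullCoord c) (affinePoly τ k) = subst L⁻¹ h := by
    refine MvPolynomial.funext fun v => ?_
    have hvv : v = ![v 0, v 1, v 2] := by funext i; fin_cases i <;> rfl
    conv_rhs => rw [hvv, hg]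
    rw [eval_subst, eval_nullCoord_affinePoly, hc2]
  rw [← hsub, subst_subst] at hback
  exact hback

/-- A transitive abelian algebra forces the third normal form. -/
theorem exists_subst_flatPoly {τ : ℕ} {h : Poly} (hh : h.IsHomogeneous τ) (h1 : eval e₀ h = 1)
    (hA : HasFlatAlg h) :
    ∃ a b c : ℕ, a + b + c = τ ∧ ∃ A : GL3, subst A.val (flatPoly a b c) = h := by
  obtain ⟨r, s, hr, hY, hZ⟩ := hA
  -- These are the nonzero eigenvalues of the second field; they are distinct since their product is
  -- `-(1 + r ^ 2)`.
  obtain ⟨μ, ν, hμν, hμ, hν⟩ : ∃ μ ν : ℝ, μ ≠ ν ∧ μ ^ 2 = 1 + r ^ 2 + s * μ ∧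
      ν ^ 2 = 1 + r ^ 2 + s * ν := by
    have hd : 0 < s ^ 2 + 4 * (1 + r ^ 2) := by positivity
    have hsq := Real.sq_sqrt hd.le
    refine ⟨(s + Real.sqrt (s ^ 2 + 4 * (1 + r ^ 2))) / 2,
      (s - Real.sqrt (s ^ 2 + 4 * (1 + r ^ 2))) / 2, ?_, ?_, ?_⟩
    · have := Real.sqrt_pos.2 hd
      intro h; linarith
    · linear_combination hsq / 4
    · linear_combination hsq / 4
  -- The rows are joint left eigenvectors of the two commuting fields, scaled so that the base point
  -- goes to `(1, 1, 1)`.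
  set L : M3 := !![1, -1 / r, 0; 1, r, μ; 1, r, ν] with hL
  have hdet : L.det ≠ 0 := by
    have : L.det = (r ^ 2 + 1) / r * (ν - μ) := by
      rw [hL, Matrix.det_fin_three]; simp; field_simp; ring
    rw [this]
    exact mul_ne_zero (div_ne_zero (by positivity) hr) (sub_ne_zero.2 hμν.symm)
  have hu : IsUnit L.det := isUnit_iff_ne_zero.2 hdet

  have hD : Matrix.diagonal ![-1 / r, r, r] ∈ lieAlg (subst L⁻¹ h) := by
    refine mem_lieAlg_subst (inv_mul_eq_mul_inv_of_mul_eq hu ?_) hY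
    ext i j
    fin_cases i <;> fin_cases j <;>
      simp [hL, genY, Matrix.mul_apply, Fin.sum_univ_three, Matrix.diagonal_apply] <;>
      field_simp <;> ring
  have hN : Matrix.diagonal ![0, μ, ν] ∈ lieAlg (subst L⁻¹ h) := by
    refine mem_lieAlg_subst (inv_mul_eq_mul_inv_of_mul_eq hu ?_) hZ
    ext i j
    fin_cases i <;> fin_cases j <;>
      simp [hL, genZ, Matrix.mul_apply, Fin.sum_univ_three, Matrix.diagonal_apply] <;> grind
  have hback : subst L (subst L⁻¹ h) = h := by
    rw [subst_subst, Matrix.nonsing_inv_mul _ hu, subst_one]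
  have hg1 : eval ![1, 1, 1] (subst L⁻¹ h) = 1 := by
    have : (![1, 1, 1] : V) = L *ᵥ e₀ := by
      funext i; rw [mulVec_e₀]
      fin_cases i <;> simp [hL]
    rw [this, ← eval_subst, hback, h1]
  obtain ⟨a, b, c, habc, hg⟩ := eq_flatPoly_of_mem_lieAlg (isHomogeneous_subst hh _) hr hμν hD hN hg1
  refine ⟨a, b, c, habc, Matrix.GeneralLinearGroup.mkOfDetNeZero _ hdet, ?_⟩
  change subst L _ = h
  rw [← hg, hback]

/-- A polynomial independent of one variable has a singular Hessian. This discards `k = 0` and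
monomials with a zero exponent. -/
theorem hyp_eq_empty_of_pderiv_eq_zero {f : Poly} {i : Fin 3} (hi : pderiv i f = 0) :
    hyp f = ∅ := by
  refine Set.eq_empty_of_forall_notMem fun p hp => ?_
  have h1 := (mem_hyp_iff.1 hp).2.1
  rw [Matrix.det_eq_zero_of_column_eq_zero i] at h1
  · exact lt_irrefl _ h1
  · intro j
    simp [hessian, hi]

/-! ### Linear maps between the normal forms -/

/-- The linear form `x + z`. -/
def nullForm (v : V) : ℝ := v 0 + v 2

/-- The function `x² - y² - z²`. -/
def quadForm (v : V) : ℝ := v 0 ^ 2 - v 1 ^ 2 - v 2 ^ 2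

@[simp] theorem eval_quad (v : V) : eval v quad = quadForm v := by simp [quad, quadForm]

theorem eval_affinePoly (τ k : ℕ) (v : V) :
    eval v (affinePoly τ k) = nullForm v ^ (τ - 2 * k) * quadForm v ^ k := by
  simp [affinePoly, nullForm, -pow_eq_zero_iff]

theorem eval_flatPoly (a b c : ℕ) (v : V) :
    eval v (flatPoly a b c) = ∏ i, v i ^ (![a, b, c] : Fin 3 → ℕ) i := by
  simp [flatPoly, Fin.prod_univ_three]

theorem lorentzPoly_eq {τ : ℕ} (hτ : Even τ) : lorentzPoly τ = affinePoly τ (τ / 2) := by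
  have : τ - 2 * (τ / 2) = 0 := by have := Nat.two_mul_div_two_of_even hτ; omega
  rw [lorentzPoly, affinePoly, this, pow_zero, one_mul]

theorem isHomogeneous_quad : quad.IsHomogeneous 2 := by
  have h : ∀ i : Fin 3, (X i ^ 2 : Poly).IsHomogeneous 2 := fun i => by
    simpa using (isHomogeneous_X ℝ i).pow 2
  exact ((h 0).sub (h 1)).sub (h 2)

theorem isHomogeneous_affinePoly {τ k : ℕ} (hk : 2 * k ≤ τ) :
    (affinePoly τ k).IsHomogeneous τ := by
  have h1 : (X 0 + X 2 : Poly).IsHomogeneous 1 :=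
    (isHomogeneous_X ℝ 0).add (isHomogeneous_X ℝ 2)
  have := (h1.pow (τ - 2 * k)).mul (isHomogeneous_quad.pow k)
  rwa [show 1 * (τ - 2 * k) + 2 * k = τ by omega] at this

theorem isHomogeneous_flatPoly (a b c : ℕ) : (flatPoly a b c).IsHomogeneous (a + b + c) := by
  have := (((isHomogeneous_X ℝ (0 : Fin 3)).pow a).mul ((isHomogeneous_X ℝ (1 : Fin 3)).pow b)).mul
    ((isHomogeneous_X ℝ (2 : Fin 3)).pow c)
  simpa [flatPoly] using this

theorem NormalForm.isHomogeneous {τ : ℕ} (f : NormalForm τ) : f.poly.IsHomogeneous τ := by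
  cases f with
  | lorentz hτ =>
    rw [NormalForm.poly, lorentzPoly_eq hτ]
    exact isHomogeneous_affinePoly (by omega)
  | affine k hk hkτ => exact isHomogeneous_affinePoly hkτ.le
  | flat a b c _ _ _ _ h =>
    have := isHomogeneous_flatPoly a b c
    rwa [h] at this

/-- Polynomials have no zero divisors. With `S` a projection onto a plane, a product vanishing on
the plane has a factor vanishing there, which takes the place of divisibility by a linear form. -/
theorem eval_eq_zero_or_of_mul {f g : Poly} (S : M3)
    (h : ∀ v, eval (S *ᵥ v) f * eval (S *ᵥ v) g = 0) :
    (∀ v, eval (S *ᵥ v) f = 0) ∨ ∀ v, eval (S *ᵥ v) g = 0 := by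
  have : subst S f * subst S g = 0 := MvPolynomial.funext fun v => by simpa using h v
  rcases mul_eq_zero.1 this with h | h
  · exact Or.inl fun v => by rw [← eval_subst, h, map_zero]
  · exact Or.inr fun v => by rw [← eval_subst, h, map_zero]

/-- The quadratic form does not vanish on any plane. -/
theorem exists_quadForm_ne_zero (a : V) {A : M3} (hA : A.det ≠ 0) :
    ∃ v, a ⬝ᵥ v = 0 ∧ quadForm (A *ᵥ v) ≠ 0 := by
  have hu : IsUnit A.det := isUnit_iff_ne_zero.2 hA
  set b := a ᵥ* A⁻¹ with hb
  -- Every plane contains a nonzero vector with first coordinate zero, and the quadratic form is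
  -- negative on such vectors.
  have key : ∃ w : V, b ⬝ᵥ w = 0 ∧ quadForm w ≠ 0 := by
    by_cases h : b 1 = 0 ∧ b 2 = 0
    · exact ⟨![0, 1, 0], by simp [dotProduct, Fin.sum_univ_three, h.1], by simp [quadForm]⟩
    · refine ⟨![0, b 2, -b 1], by simp [dotProduct, Fin.sum_univ_three]; ring, ?_⟩
      simp only [quadForm]
      simp
      intro h0
      exact h ⟨by nlinarith [sq_nonneg (b 1), sq_nonneg (b 2)],
        by nlinarith [sq_nonneg (b 1), sq_nonneg (b 2)]⟩
  obtain ⟨w, h1, h2⟩ := key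
  refine ⟨A⁻¹ *ᵥ w, by rw [Matrix.dotProduct_mulVec]; exact h1, ?_⟩
  rwa [Matrix.mulVec_mulVec, Matrix.mul_nonsing_inv _ hu, Matrix.one_mulVec]

/-- A linear form with `ℓ · Q(A ·) = 0` on a plane vanishes on the plane. -/
theorem linear_eq_zero_on_plane {A B S : M3} {a : V} {i : Fin 3} (hA : A.det ≠ 0)
    (hS : ∀ v, a ⬝ᵥ v = 0 → S *ᵥ v = v)
    (h : ∀ v, (B *ᵥ (S *ᵥ v)) i * quadForm (A *ᵥ (S *ᵥ v)) = 0) {v : V} (hv : a ⬝ᵥ v = 0) :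
    (B *ᵥ v) i = 0 := by
  have := eval_eq_zero_or_of_mul (f := linForm B i) (g := subst A quad) S fun v => by
    rw [eval_linForm, eval_subst, eval_quad]; exact h v
  rcases this with h1 | h1
  · have := h1 v
    rwa [hS v hv, eval_linForm] at this
  · exfalso
    obtain ⟨w, hw, hq⟩ := exists_quadForm_ne_zero a hA
    have := h1 w
    rw [hS w hw, eval_subst, eval_quad] at this
    exact hq this

/-- The projection onto the plane `v i = 0` along a coordinate axis. -/
def coordProj (i : Fin 3) : M3 := Matrix.diagonal (Function.update 1 i 0)

theorem coordProj_mulVec (i : Fin 3) (v : V) : coordProj i *ᵥ v = Function.update v i 0 := by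
  funext j
  rw [coordProj, Matrix.mulVec_diagonal]
  by_cases h : j = i
  · subst h; simp
  · simp [h]

theorem coordProj_mulVec_eq_self {i : Fin 3} {v : V} (hv : v i = 0) : coordProj i *ᵥ v = v := by
  rw [coordProj_mulVec, ← hv, Function.update_eq_self]

theorem mulVec_ne_zero {A : M3} (hA : A.det ≠ 0) {v : V} (hv : v ≠ 0) : A *ᵥ v ≠ 0 := fun h =>
  hv (Matrix.eq_zero_of_mulVec_eq_zero hA h)

theorem nullForm_eq (A : M3) (v : V) :
    nullForm (A *ᵥ v) = ((!![1, 0, 1; 0, 0, 0; 0, 0, 0] * A) *ᵥ v) 0 := by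
  rw [← Matrix.mulVec_mulVec]
  simp [nullForm, Matrix.mulVec, dotProduct, Fin.sum_univ_three]

/-- No linear map pulls back a normal form of the first two types to one of the third type. -/
theorem not_affine_comp_eq_flat {A : M3} (hA : A.det ≠ 0) {n k : ℕ} {m : Fin 3 → ℕ}
    (hm : ∀ i, m i ≠ 0)
    (h : ∀ v, nullForm (A *ᵥ v) ^ n * quadForm (A *ᵥ v) ^ k = ∏ i, v i ^ m i) : False := by
  -- Each coordinate plane lies in the zero set, and the quadratic factor does not vanish on it, so
  -- the linear factor does. Two such planes span `ℝ³`, which would make the linear form zero.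
  have key : ∀ j : Fin 3, ∀ v : V, v j = 0 → nullForm (A *ᵥ v) = 0 := by
    intro j v hv
    rw [nullForm_eq]
    refine linear_eq_zero_on_plane (a := Pi.single j 1) (S := coordProj j) hA (fun w hw => ?_)
      (fun w => ?_) (by simpa using hv)
    · exact coordProj_mulVec_eq_self (by simpa using hw)
    · rw [← nullForm_eq]
      have h1 := h (coordProj j *ᵥ w)
      rw [Finset.prod_eq_zero (Finset.mem_univ j) (by
        rw [coordProj_mulVec]; simp [hm j])] at h1
      rcases mul_eq_zero.1 h1 with h2 | h2
      · rw [eq_zero_of_pow_eq_zero h2, zero_mul]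
      · rw [eq_zero_of_pow_eq_zero h2, mul_zero]
  have hall : ∀ v : V, nullForm (A *ᵥ v) = 0 := by
    intro v
    have h1 := key 0 (v - Pi.single 0 (v 0)) (by simp)
    have h2 := key 1 (Pi.single 0 (v 0)) (by simp)
    rw [nullForm_eq, Matrix.mulVec_sub, Pi.sub_apply] at h1
    rw [nullForm_eq] at h2 ⊢
    linarith
  have hu : IsUnit A.det := isUnit_iff_ne_zero.2 hA
  have := hall (A⁻¹ *ᵥ e₀)
  rw [Matrix.mulVec_mulVec, Matrix.mul_nonsing_inv _ hu, Matrix.one_mulVec] at this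
  simp [nullForm, e₀] at this

/-- The plane `x + z = 0` lies in the zero set of the right-hand side. The quadratic factor on the
left does not vanish on it, so `A` maps this plane to itself. -/
theorem exists_nullForm_smul {A : M3} (hA : A.det ≠ 0) {n k n' k' : ℕ} (hn' : n' ≠ 0)
    (h : ∀ v, nullForm (A *ᵥ v) ^ n * quadForm (A *ᵥ v) ^ k = nullForm v ^ n' * quadForm v ^ k') :
    ∀ v, nullForm (A *ᵥ v) = nullForm (A *ᵥ e₀) * nullForm v := by
  have key : ∀ v, nullForm v = 0 → nullForm (A *ᵥ v) = 0 := by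
    intro v hv
    rw [nullForm_eq]
    refine linear_eq_zero_on_plane (a := ![1, 0, 1]) (S := !![1, 0, 0; 0, 1, 0; -1, 0, 0]) hA
      (fun w hw => ?_) (fun w => ?_) (by simpa [dotProduct, Fin.sum_univ_three, nullForm] using hv)
    · simp [dotProduct, Fin.sum_univ_three] at hw
      funext i
      fin_cases i <;> simp [Matrix.mulVec, dotProduct, Fin.sum_univ_three]
      linarith
    · rw [← nullForm_eq]
      have h1 := h (!![1, 0, 0; 0, 1, 0; -1, 0, 0] *ᵥ w)
      have h0 : nullForm (!![1, 0, 0; 0, 1, 0; -1, 0, 0] *ᵥ w) = 0 := by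
        simp [nullForm, Matrix.mulVec, dotProduct, Fin.sum_univ_three]
      rw [h0, zero_pow hn', zero_mul] at h1
      rcases mul_eq_zero.1 h1 with h2 | h2
      · rw [eq_zero_of_pow_eq_zero h2, zero_mul]
      · rw [eq_zero_of_pow_eq_zero h2, mul_zero]
  intro v
  have h1 := key (v - nullForm v • e₀) (by simp [nullForm, e₀])
  rw [nullForm_eq, Matrix.mulVec_sub, Pi.sub_apply, Matrix.mulVec_smul, Pi.smul_apply,
    ← nullForm_eq, ← nullForm_eq, smul_eq_mul] at h1
  linarith

theorem exists_nullForm_eq_zero_quadForm_ne_zero {A : M3} (hA : A.det ≠ 0) :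
    ∃ v, nullForm v = 0 ∧ quadForm (A *ᵥ v) ≠ 0 := by
  obtain ⟨v, h1, h2⟩ := exists_quadForm_ne_zero ![1, 0, 1] hA
  exact ⟨v, by simpa [dotProduct, Fin.sum_univ_three, nullForm] using h1, h2⟩

/-- The polynomial `x + z`. -/
def nullPoly : Poly := X 0 + X 2

@[simp] theorem eval_nullPoly (v : V) : eval v nullPoly = nullForm v := by simp [nullPoly, nullForm]

theorem nullPoly_ne_zero : nullPoly ≠ 0 := fun h => by
  have := congrArg (eval e₀) h
  simp [nullForm, e₀] at this

/-- With the linear forms matched, the smaller power of `x + z` cancels; a remaining power would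
vanish at a point of `x + z = 0` where the quadratic factor on the other side does not. -/
theorem nullForm_pow_eq {A : M3} (hA : A.det ≠ 0) {n k n' k' : ℕ} (hn' : n' ≠ 0)
    (h : ∀ v, nullForm (A *ᵥ v) ^ n * quadForm (A *ᵥ v) ^ k = nullForm v ^ n' * quadForm v ^ k') :
    n = n' := by
  have hα := exists_nullForm_smul hA hn' h
  set α := nullForm (A *ᵥ e₀) with hαd
  have hα0 : α ≠ 0 := by
    intro h0
    have hu : IsUnit A.det := isUnit_iff_ne_zero.2 hA
    have := hα (A⁻¹ *ᵥ e₀)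
    rw [h0, Matrix.mulVec_mulVec, Matrix.mul_nonsing_inv _ hu, Matrix.one_mulVec] at this
    simp [nullForm, e₀] at this
  have hp : nullPoly ^ n * (C (α ^ n) * subst A quad ^ k) = nullPoly ^ n' * quad ^ k' :=
    MvPolynomial.funext fun v => by
      have := h v
      rw [hα, mul_pow] at this
      simp only [map_mul, map_pow, eval_C, eval_nullPoly, eval_subst, eval_quad]
      linarith
  rcases lt_trichotomy n n' with hlt | heq | hlt
  · exfalso
    have e : C (α ^ n) * subst A quad ^ k = nullPoly ^ (n' - n) * quad ^ k' := by
      refine mul_left_cancel₀ (pow_ne_zero n nullPoly_ne_zero) (hp.trans ?_)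
      rw [← mul_assoc, ← pow_add]
      congr 2; omega
    obtain ⟨v, h1, h2⟩ := exists_nullForm_eq_zero_quadForm_ne_zero hA
    have := congrArg (eval v) e
    simp only [map_mul, map_pow, eval_C, eval_subst, eval_quad, eval_nullPoly, h1] at this
    rw [zero_pow (by omega), zero_mul] at this
    exact mul_ne_zero (pow_ne_zero _ hα0) (pow_ne_zero _ h2) this
  · exact heq
  · exfalso
    have e : nullPoly ^ (n - n') * (C (α ^ n) * subst A quad ^ k) = quad ^ k' := by
      refine mul_left_cancel₀ (pow_ne_zero n' nullPoly_ne_zero) (Eq.trans ?_ hp)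
      rw [← mul_assoc, ← pow_add]
      congr 2; omega
    have := congrArg (eval (![0, 1, 0] : V)) e
    simp only [map_mul, map_pow, eval_C, eval_subst, eval_quad, eval_nullPoly] at this
    simp [nullForm, quadForm, (show n - n' ≠ 0 by omega)] at this
    exact pow_ne_zero k' (by norm_num : (-1 : ℝ) ≠ 0) this.symm

/-- Taking roots determines the pulled back form up to a sign at each point, and the absence of zero
divisors makes this sign global. -/
theorem exists_quadForm_smul {A : M3} (hA : A.det ≠ 0) {k : ℕ} (hk : k ≠ 0) {c : ℝ}
    (h : ∀ v, c * quadForm (A *ᵥ v) ^ k = quadForm v ^ k) :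
    0 < quadForm (A *ᵥ e₀) ∧ ∀ v, quadForm (A *ᵥ v) = quadForm (A *ᵥ e₀) * quadForm v := by
  set β := quadForm (A *ᵥ e₀) with hβ
  have h1 : c * β ^ k = 1 := by rw [hβ, h]; simp [quadForm, e₀]
  have hβ0 : β ≠ 0 := by rintro h0; rw [h0, zero_pow hk, mul_zero] at h1; exact zero_ne_one h1
  have hc0 : c ≠ 0 := by rintro rfl; simp at h1
  have hsq : ∀ v, quadForm (A *ᵥ v) ^ 2 = (β * quadForm v) ^ 2 := by
    intro v
    have : quadForm (A *ᵥ v) ^ k = (β * quadForm v) ^ k := by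
      refine mul_left_cancel₀ hc0 ?_
      rw [h, mul_pow, ← mul_assoc, h1, one_mul]
    have h2 : |quadForm (A *ᵥ v)| = |β * quadForm v| := by
      refine (pow_left_inj₀ (abs_nonneg _) (abs_nonneg _) hk).1 ?_
      rw [← abs_pow, ← abs_pow, this]
    rw [← sq_abs, h2, sq_abs]
  have hlin : ∀ v, quadForm (A *ᵥ v) = β * quadForm v := by
    have := eval_eq_zero_or_of_mul (f := subst A quad - C β * quad) (g := subst A quad + C β * quad)
      1 fun v => by
        have := hsq v
        simp only [Matrix.one_mulVec, map_sub, map_add, map_mul, eval_C, eval_subst, eval_quad]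
        linear_combination this
    rcases this with h2 | h2
    · intro v
      have := h2 v
      simp only [Matrix.one_mulVec, map_sub, map_mul, eval_C, eval_subst, eval_quad] at this
      linarith
    · exfalso
      have := h2 e₀
      simp only [Matrix.one_mulVec, map_add, map_mul, eval_C, eval_subst, eval_quad, ← hβ] at this
      have h3 : quadForm e₀ = 1 := by simp [quadForm, e₀]
      rw [h3] at this
      exact hβ0 (by linarith)
  refine ⟨?_, hlin⟩
  -- The plane `x = 0` and its preimage under `A` share a line. On it the form is negative before
  -- and after applying `A`, so the factor is positive.
  obtain ⟨v, hv0, hvne, hAv⟩ : ∃ v : V, v 0 = 0 ∧ v ≠ 0 ∧ (A *ᵥ v) 0 = 0 := by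
    by_cases h : A 0 1 = 0 ∧ A 0 2 = 0
    · exact ⟨![0, 1, 0], rfl, fun h => by simpa using congrFun h 1, by
        simp [Matrix.mulVec, dotProduct, Fin.sum_univ_three, h.1]⟩
    · refine ⟨![0, A 0 2, -A 0 1], rfl, fun h0 => h ⟨?_, ?_⟩, ?_⟩
      · simpa using congrFun h0 2
      · simpa using congrFun h0 1
      · simp [Matrix.mulVec, dotProduct, Fin.sum_univ_three]; ring
  have hneg : ∀ w : V, w ≠ 0 → w 0 = 0 → quadForm w < 0 := by
    intro w hw hw0
    have h3 : ¬(w 1 = 0 ∧ w 2 = 0) := fun ⟨a, b⟩ => hw (by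
      funext i
      fin_cases i
      · exact hw0
      · exact a
      · exact b)
    rw [quadForm, hw0]
    rcases not_and_or.1 h3 with h4 | h4
    · have := sq_pos_of_ne_zero h4
      nlinarith [sq_nonneg (w 2)]
    · have := sq_pos_of_ne_zero h4
      nlinarith [sq_nonneg (w 1)]
  have h5 := hneg v hvne hv0
  have h6 := hneg _ (mulVec_ne_zero hA hvne) hAv
  rw [hlin] at h6
  by_contra hcon
  push Not at hcon
  nlinarith [mul_nonneg_of_nonpos_of_nonpos hcon h5.le]

/-- Linear maps between monomials are monomial matrices. -/
theorem exists_perm_of_flat {A : M3} (hA : A.det ≠ 0) {m m' : Fin 3 → ℕ}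
    (hm' : ∀ i, m' i ≠ 0) (h : ∀ v : V, ∏ i, (A *ᵥ v) i ^ m i = ∏ i, v i ^ m' i) :
    ∃ (σ : Equiv.Perm (Fin 3)) (d : V), (∀ i j, A i j = if i = σ j then d j else 0) ∧
      (∀ j, m (σ j) = m' j) ∧ ∏ j, d j ^ m' j = 1 := by
  -- The product of the coordinates of `A v` vanishes on each coordinate plane, so one of these
  -- linear forms does: coordinate planes go into coordinate planes.
  have key : ∀ j, ∃ i, ∀ j', j' ≠ j → A i j' = 0 := by
    intro j
    have hz : ∀ v : V, (A *ᵥ (coordProj j *ᵥ v)) 0 * ((A *ᵥ (coordProj j *ᵥ v)) 1 *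
        (A *ᵥ (coordProj j *ᵥ v)) 2) = 0 := by
      intro v
      have h0 : ∏ i, (coordProj j *ᵥ v) i ^ m' i = 0 :=
        Finset.prod_eq_zero (Finset.mem_univ j) (by rw [coordProj_mulVec]; simp [hm' j])
      have h1 := h (coordProj j *ᵥ v)
      rw [h0, Finset.prod_eq_zero_iff] at h1
      obtain ⟨i, -, hi⟩ := h1
      have := eq_zero_of_pow_eq_zero hi
      fin_cases i <;> simp at this <;> simp [this]
    have hrow : ∀ i, (∀ v, eval (coordProj j *ᵥ v) (linForm A i) = 0) →
        ∀ j', j' ≠ j → A i j' = 0 := by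
      intro i hi j' hj'
      have := hi (Pi.single j' 1)
      rw [coordProj_mulVec_eq_self (by simp [hj'.symm]), eval_linForm] at this
      simpa using this
    have h1 := eval_eq_zero_or_of_mul (f := linForm A 0) (g := linForm A 1 * linForm A 2)
      (coordProj j) fun v => by simpa using hz v
    rcases h1 with h1 | h1
    · exact ⟨0, hrow 0 h1⟩
    · simp only [map_mul] at h1
      rcases eval_eq_zero_or_of_mul (coordProj j) h1 with h2 | h2
      · exact ⟨1, hrow 1 h2⟩
      · exact ⟨2, hrow 2 h2⟩
  choose s hs using key
  have hinj : Function.Injective s := by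
    intro j j' hjj
    by_contra hne
    refine hA (Matrix.det_eq_zero_of_row_eq_zero (s j) fun l => ?_)
    by_cases hl : l = j
    · rw [hjj]; exact hs j' l (by rw [hl]; exact hne)
    · exact hs j l hl
  set σ : Equiv.Perm (Fin 3) := Equiv.ofBijective s (Finite.injective_iff_bijective.1 hinj) with hσ
  have hσs : ∀ j, σ j = s j := fun j => rfl
  have hA' : ∀ i j, A i j = if i = σ j then A (σ j) j else 0 := by
    intro i j
    split_ifs with hij
    · rw [hij]
    · obtain ⟨j', rfl⟩ := σ.surjective i
      exact hs j' j fun e => hij (by rw [e])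
  have hAv : ∀ v : V, ∀ j, (A *ᵥ v) (σ j) = A (σ j) j * v j := by
    intro v j
    rw [Matrix.mulVec, dotProduct, Finset.sum_eq_single j]
    · intro b _ hb
      rw [hA', if_neg (fun e => hb (σ.injective e).symm), zero_mul]
    · simp
  have hprod : ∀ v : V, (∏ j, A (σ j) j ^ m (σ j)) * ∏ j, v j ^ m (σ j) = ∏ j, v j ^ m' j := by
    intro v
    rw [← h v, ← Equiv.prod_comp σ fun i => (A *ᵥ v) i ^ m i, ← Finset.prod_mul_distrib]
    exact Finset.prod_congr rfl fun j _ => by rw [hAv, mul_pow]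
  have h1 : ∏ j, A (σ j) j ^ m (σ j) = 1 := by simpa using hprod 1
  -- The vector with entry `2` in place `j` and ones elsewhere reads off the exponents as powers of
  -- two.
  have hexp : ∀ j, m (σ j) = m' j := by
    intro j
    have := hprod (Function.update 1 j 2)
    rw [h1, one_mul, Finset.prod_eq_single j, Finset.prod_eq_single j] at this
    · simp only [Function.update_self] at this
      exact Nat.pow_right_injective le_rfl (by exact_mod_cast this)
    · intro b _ hb; simp [hb]
    · simp
    · intro b _ hb; simp [hb]
    · simp
  refine ⟨σ, fun j => A (σ j) j, hA', hexp, ?_⟩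
  rw [← h1]
  exact Finset.prod_congr rfl fun j _ => by rw [hexp]

/-- The normal forms are pairwise inequivalent. -/
theorem NormalForm.eq_of_subst {τ : ℕ} (hτ : 3 ≤ τ) {f f' : NormalForm τ} {A : M3}
    (hA : A.det ≠ 0) (h : subst A f'.poly = f.poly) : f' = f := by
  have hu : IsUnit A.det := isUnit_iff_ne_zero.2 hA
  have hA' : A⁻¹.det ≠ 0 := by
    rw [Matrix.det_nonsing_inv]; simpa using hA
  have h' : subst A⁻¹ f.poly = f'.poly := by
    rw [← h, subst_subst, Matrix.mul_nonsing_inv _ hu, subst_one]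
  have e : ∀ v, eval (A *ᵥ v) f'.poly = eval v f.poly := fun v => by rw [← eval_subst, h]
  have e' : ∀ v, eval (A⁻¹ *ᵥ v) f.poly = eval v f'.poly := fun v => by rw [← eval_subst, h']
  cases f with
  | lorentz h2 =>
    cases f' with
    | lorentz h2' => rfl
    | affine k hk hkτ =>
      exfalso
      simp only [NormalForm.poly, lorentzPoly_eq h2, eval_affinePoly] at e'
      have := nullForm_pow_eq hA' (by omega) e'
      obtain ⟨m, rfl⟩ := h2
      omega
    | flat a b c ha hab hbc hc habc =>
      exfalso
      simp only [NormalForm.poly, lorentzPoly_eq h2, eval_affinePoly, eval_flatPoly] at e'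
      exact not_affine_comp_eq_flat hA' (by intro i; fin_cases i <;> simp <;> omega) e'
  | affine k hk hkτ =>
    cases f' with
    | lorentz h2' =>
      exfalso
      simp only [NormalForm.poly, lorentzPoly_eq h2', eval_affinePoly] at e
      have := nullForm_pow_eq hA (by omega) e
      obtain ⟨m, rfl⟩ := h2'
      omega
    | affine k' hk' hkτ' =>
      simp only [NormalForm.poly, eval_affinePoly] at e
      have := nullForm_pow_eq hA (by omega) e
      have hkk : k' = k := by omega
      subst hkk
      rfl
    | flat a b c ha hab hbc hc habc =>
      exfalso
      simp only [NormalForm.poly, eval_affinePoly, eval_flatPoly] at e'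
      exact not_affine_comp_eq_flat hA' (by intro i; fin_cases i <;> simp <;> omega) e'
  | flat a b c ha hab hbc hc habc =>
    cases f' with
    | lorentz h2' =>
      exfalso
      simp only [NormalForm.poly, lorentzPoly_eq h2', eval_affinePoly, eval_flatPoly] at e
      exact not_affine_comp_eq_flat hA (by intro i; fin_cases i <;> simp <;> omega) e
    | affine k' hk' hkτ' =>
      exfalso
      simp only [NormalForm.poly, eval_affinePoly, eval_flatPoly] at e
      exact not_affine_comp_eq_flat hA (by intro i; fin_cases i <;> simp <;> omega) e
    | flat a' b' c' ha' hab' hbc' hc' habc' =>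
      simp only [NormalForm.poly, eval_flatPoly] at e
      obtain ⟨σ, d, -, hσ, -⟩ := exists_perm_of_flat hA
        (by intro i; fin_cases i <;> simp <;> omega) e
      -- The permutation identifies the exponents as multisets, and sorted triples with the same
      -- multiset are equal.
      have hset : Multiset.map (![a', b', c'] : Fin 3 → ℕ) Finset.univ.val =
          Multiset.map (![a, b, c] : Fin 3 → ℕ) Finset.univ.val := by
        have : (![a, b, c] : Fin 3 → ℕ) = ![a', b', c'] ∘ σ := funext fun j => (hσ j).symm
        rw [this, ← Multiset.map_map]
        congr 1
        exact (Multiset.map_univ_val_equiv σ).symm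
      have hl : [a', b', c'].Perm [a, b, c] := by
        rw [← Multiset.coe_eq_coe]
        exact hset
      have hs : [a', b', c'] = [a, b, c] := by
        refine hl.eq_of_pairwise' (r := (· ≤ ·)) ?_ ?_ <;> simp <;> omega
      simp only [List.cons.injEq, and_true] at hs
      obtain ⟨rfl, rfl, rfl⟩ := hs
      rfl

/-! ### The classification -/

theorem exists_flat_sorted {τ : ℕ} {a b c : ℕ} (habc : a + b + c = τ) (ha : 1 ≤ a) (hb : 1 ≤ b)
    (hc : 1 ≤ c) : ∃ f : NormalForm τ, ∃ S : GL3, subst S.val f.poly = flatPoly a b c := by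
  have key : ∀ σ : Equiv.Perm (Fin 3), (![a, b, c] : Fin 3 → ℕ) (σ 0) ≤ (![a, b, c] : Fin 3 → ℕ) (σ 1) →
      (![a, b, c] : Fin 3 → ℕ) (σ 1) ≤ (![a, b, c] : Fin 3 → ℕ) (σ 2) →
      ∃ f : NormalForm τ, ∃ S : GL3, subst S.val f.poly = flatPoly a b c := by
    intro σ h1 h2
    have hpos : ∀ i, 1 ≤ (![a, b, c] : Fin 3 → ℕ) i := by intro i; fin_cases i <;> assumption
    have hsum : (![a, b, c] : Fin 3 → ℕ) (σ 0) + (![a, b, c] : Fin 3 → ℕ) (σ 1) +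
        (![a, b, c] : Fin 3 → ℕ) (σ 2) = τ := by
      rw [← Fin.sum_univ_three fun i => (![a, b, c] : Fin 3 → ℕ) (σ i), Equiv.sum_comp σ,
        Fin.sum_univ_three]
      exact habc
    have h0 := hpos (σ 0)
    have h01 := hpos (σ 1)
    have hdet : (Matrix.of fun i j => if j = σ i then (1 : ℝ) else 0 : M3).det ≠ 0 := by
      have : (Matrix.of fun i j => if j = σ i then (1 : ℝ) else 0 : M3) = σ.permMatrix ℝ := by
        ext i j
        simp [Equiv.Perm.permMatrix, PEquiv.toMatrix_apply, eq_comm]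
      rw [this, Matrix.det_permutation]
      simp
    refine ⟨.flat _ _ _ h0 h1 h2 (by omega) hsum,
      Matrix.GeneralLinearGroup.mkOfDetNeZero _ hdet, ?_⟩
    refine MvPolynomial.funext fun v => ?_
    change eval v (subst (Matrix.of fun i j => if j = σ i then (1 : ℝ) else 0 : M3) _) = _
    have hv : ∀ i, ((Matrix.of fun i j => if j = σ i then (1 : ℝ) else 0 : M3) *ᵥ v) i = v (σ i) := by
      intro i
      simp [Matrix.mulVec, dotProduct]
    rw [eval_subst, NormalForm.poly, eval_flatPoly, eval_flatPoly,
      ← Equiv.prod_comp σ fun i => v i ^ (![a, b, c] : Fin 3 → ℕ) i]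
    refine Finset.prod_congr rfl fun i _ => ?_
    rw [hv]
    fin_cases i <;> rfl
  obtain ⟨σ, hσ⟩ : ∃ σ : Equiv.Perm (Fin 3), Monotone ((![a, b, c] : Fin 3 → ℕ) ∘ σ) :=
    ⟨Tuple.sort _, Tuple.monotone_sort _⟩
  exact key σ (hσ (by decide : (0 : Fin 3) ≤ 1)) (hσ (by decide : (1 : Fin 3) ≤ 2))

theorem exists_normalForm_subst {τ : ℕ} {h : Poly} {H : Set V}
    (hH : IsSpecialHomogeneousSurface τ h H) :
    ∃ f : NormalForm τ, ∃ A : GL3, subst A.val f.poly = h := by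
  obtain ⟨hS, G, hG1, hG2⟩ := hH
  obtain ⟨hτ, ⟨hh, -⟩, ⟨p, hp⟩, U, hU, hHU⟩ := id hS
  have hp1 : p ∈ hyp₁ h := by rw [hHU] at hp; exact hp.2
  obtain ⟨S, hSp, hn⟩ := exists_adapted_frame (by omega) hh hp1
  -- An element preserving the surface pulls `h` back to a homogeneous polynomial that is one on the
  -- surface, hence to `h`.
  have hGaut : ∀ A ∈ G, A ∈ autGroup h := fun A hA => by
    rw [mem_autGroup_iff]
    refine eq_of_eq_one_on_surface hS (isHomogeneous_subst hh _) fun v hv => ?_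
    have := hG1 A hA v hv
    rw [hHU] at this
    rw [eval_subst]
    exact this.2.1
  set g := subst S.val h with hg
  have hgh : g.IsHomogeneous τ := isHomogeneous_subst hh _
  -- The surface is open in the level set, so transitivity on it reaches all points of the level set
  -- near the base point.
  have hloc : ∀ᶠ q in 𝓝[hyp₁ g] e₀, ∃ B ∈ autGroup g, act B e₀ = q := by
    have hc : ContinuousAt (fun q => act S q) e₀ :=
      (continuous_const.matrix_mulVec continuous_id).continuousAt
    have hUe : U ∈ 𝓝 (act S e₀) := by
      rw [hSp]; rw [hHU] at hp; exact hU.mem_nhds hp.1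
    filter_upwards [mem_nhdsWithin_of_mem_nhds (hc hUe), self_mem_nhdsWithin] with q hqU hq
    have hqH : act S q ∈ H := by
      rw [hHU]
      refine ⟨hqU, ?_, (mem_hyp_subst_iff (det_ne_zero S)).1 hq.2⟩
      have := hq.1
      rw [Set.mem_ofPred_eq, hg, eval_subst] at this
      exact this
    obtain ⟨B, hB, hBq⟩ := hG2 p hp _ hqH
    refine ⟨S⁻¹ * B * S, fun v => ?_, ?_⟩
    · have := hGaut B hB (act S v)
      rw [hg, eval_subst, eval_subst]
      change eval (act S (act (S⁻¹ * B * S) v)) h = eval (act S v) h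
      rw [← this, ← act_mul, ← act_mul]
      congr 2
      group
    · rw [act_mul, act_mul, hSp, hBq, ← act_mul, inv_mul_cancel, act_one]
  have htr : ∀ v : V, v 0 = 0 → ∃ X ∈ lieAlg g, X *ᵥ e₀ = v := fun v hv =>
    exists_mem_lieAlg_mulVec_eq (by omega) hgh hn hloc hv
  obtain ⟨φ, hφ⟩ := exists_rot_alg (by omega) hgh hn htr
  have hgφ : (subst (rot φ) g).IsHomogeneous τ := isHomogeneous_subst hgh _
  have hnφ := isAdapted_rot hn φ
  have h1 := hnφ.eval_eq_one (by omega) hgφ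
  -- it suffices to treat the polynomial in rotated adapted coordinates
  have back : ∀ {f : Poly} (A : GL3), subst A.val f = subst (rot φ) g →
      ∃ B : GL3, subst B.val f = h := by
    intro f A hA
    have hdet : (rot φ).det ≠ 0 := by rw [det_rot]; exact one_ne_zero
    set R : GL3 := Matrix.GeneralLinearGroup.mkOfDetNeZero (rot φ) hdet with hR
    refine ⟨A * R⁻¹ * S⁻¹, ?_⟩
    rw [hg, subst_subst] at hA
    have e : (S * R : GL3).val = S.val * rot φ := rfl
    rw [← e] at hA
    rw [mul_assoc, Units.val_mul, ← subst_subst, hA, subst_subst, ← Units.val_mul]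
    have : S * R * (R⁻¹ * S⁻¹) = 1 := by group
    rw [this, Units.val_one, subst_one]
  -- There is a hyperbolic point, so the candidate depends on all three variables.
  have hhyp : ∀ {f : Poly} (A : GL3), subst A.val f = subst (rot φ) g → ∀ i, pderiv i f ≠ 0 := by
    intro f A hA i hi
    have h2 := (hnφ.mem_hyp₁ (by omega) hgφ).2
    rw [← hA, mem_hyp_subst_iff (det_ne_zero A), hyp_eq_empty_of_pderiv_eq_zero hi] at h2
    exact h2
  rcases hφ with hφ | hφ
  · obtain ⟨k, hk, A, hA⟩ := exists_subst_affinePoly hgφ h1 hφ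
    have hk1 : k ≠ 0 := by
      rintro rfl
      refine hhyp A hA 1 ?_
      simp [affinePoly, pderiv_X]
    rcases hk.lt_or_eq with hlt | heq
    · exact ⟨.affine k (by omega) hlt, back A hA⟩
    · refine ⟨.lorentz ⟨k, by omega⟩, ?_⟩
      have : NormalForm.poly (.lorentz ⟨k, by omega⟩ : NormalForm τ) = affinePoly τ k := by
        change lorentzPoly τ = _
        rw [lorentzPoly_eq ⟨k, by omega⟩]
        congr 1
        omega
      rw [this]
      exact back A hA
  · obtain ⟨a, b, c, habc, A, hA⟩ := exists_subst_flatPoly hgφ h1 hφ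
    have ha : a ≠ 0 := by
      rintro rfl
      refine hhyp A hA 0 ?_
      simp [flatPoly, pderiv_X]
    have hb : b ≠ 0 := by
      rintro rfl
      refine hhyp A hA 1 ?_
      simp [flatPoly, pderiv_X]
    have hc : c ≠ 0 := by
      rintro rfl
      refine hhyp A hA 2 ?_
      simp [flatPoly, pderiv_X]
    obtain ⟨f, T, hT⟩ := exists_flat_sorted habc (by omega) (by omega) (by omega)
    refine ⟨f, back (T * A) ?_⟩
    rw [Units.val_mul, ← subst_subst, hT, hA]

theorem classification (τ : ℕ) (h : Poly) (H : Set V) (hH : IsSpecialHomogeneousSurface τ h H) :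
    ∃ f : NormalForm τ,
      (∃ A : GL3, (∀ v, eval (act A v) f.poly = eval v h) ∧ act A '' H ⊆ hyp₁ f.poly) ∧
      ∀ f' : NormalForm τ, (∃ A : GL3, act A '' H ⊆ {v | eval v f'.poly = 1}) → f' = f := by
  obtain ⟨f, A, hA⟩ := exists_normalForm_subst hH
  have hev : ∀ v, eval (act A v) f.poly = eval v h := fun v => by
    rw [← hA, eval_subst]; rfl
  refine ⟨f, ⟨A, hev, ?_⟩, ?_⟩
  · rintro _ ⟨p, hp, rfl⟩
    obtain ⟨U, -, hU⟩ := hH.1.relOpen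
    rw [hU] at hp
    refine ⟨(hev p).trans hp.2.1, ?_⟩
    have := hp.2.2
    rw [← hA, mem_hyp_subst_iff (det_ne_zero A)] at this
    exact this
  · rintro f' ⟨B, hB⟩
    -- Rigidity again: it suffices that the surface lands in a level set of `f'`, with no relation
    -- between the polynomials assumed.
    have hBh : subst B.val f'.poly = h :=
      eq_of_eq_one_on_surface hH.1 (isHomogeneous_subst f'.isHomogeneous _) fun v hv => by
        rw [eval_subst]
        exact hB ⟨v, hv, rfl⟩
    refine NormalForm.eq_of_subst hH.1.three_le (det_ne_zero (B * A⁻¹)) ?_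
    rw [Units.val_mul, ← subst_subst, hBh, ← hA, subst_subst, ← Units.val_mul, mul_inv_cancel,
      Units.val_one, subst_one]

/-! ### Hyperbolic points of the normal forms -/

/-- The gradient of `h` at `v` is `h(v) L`, and its Hessian is `h(v) (L Lᵀ + M)`. -/
structure HasLogJet (h : Poly) (v L : V) (M : M3) : Prop where
  grad : ∀ i, eval v (pderiv i h) = eval v h * L i
  hess : ∀ i j, eval v (pderiv i (pderiv j h)) = eval v h * (L i * L j + M i j)

theorem HasLogJet.one (v : V) : HasLogJet 1 v 0 0 := ⟨fun i => by simp, fun i j => by simp⟩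

/-- Where the polynomials do not vanish, `L` and `M` are the gradient and the Hessian of the
logarithm of the absolute value, which is additive under products. -/
theorem HasLogJet.mul {h₁ h₂ : Poly} {v L₁ L₂ : V} {M₁ M₂ : M3} (H₁ : HasLogJet h₁ v L₁ M₁)
    (H₂ : HasLogJet h₂ v L₂ M₂) : HasLogJet (h₁ * h₂) v (L₁ + L₂) (M₁ + M₂) := by
  refine ⟨fun i => ?_, fun i j => ?_⟩
  · simp only [pderiv_mul, map_add, map_mul, H₁.grad, H₂.grad, Pi.add_apply]
    ring
  · simp only [pderiv_mul, map_add, map_mul, H₁.grad, H₂.grad, H₁.hess, H₂.hess, Pi.add_apply,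
      Matrix.add_apply]
    ring

theorem HasLogJet.pow {h : Poly} {v L : V} {M : M3} (H : HasLogJet h v L M) (n : ℕ) :
    HasLogJet (h ^ n) v ((n : ℝ) • L) ((n : ℝ) • M) := by
  induction n with
  | zero => simpa using HasLogJet.one v
  | succ n ih =>
    rw [pow_succ]
    have := ih.mul H
    rwa [show ((n + 1 : ℕ) : ℝ) • L = (n : ℝ) • L + L by push_cast; rw [add_smul, one_smul],
      show ((n + 1 : ℕ) : ℝ) • M = (n : ℝ) • M + M by push_cast; rw [add_smul, one_smul]]

theorem HasLogJet.of_ne_zero {f : Poly} {v : V} (hf : eval v f ≠ 0) :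
    HasLogJet f v (fun i => eval v (pderiv i f) / eval v f)
      (Matrix.of fun i j => eval v (pderiv i (pderiv j f)) / eval v f -
        eval v (pderiv i f) * eval v (pderiv j f) / eval v f ^ 2) := by
  refine ⟨fun i => by field_simp, fun i j => ?_⟩
  simp only [Matrix.of_apply]
  field_simp
  ring

theorem HasLogJet.hessian_eq {h : Poly} {v L : V} {M : M3} (H : HasLogJet h v L M) :
    hessian h v = eval v h • (Matrix.vecMulVec L L + M) := by
  ext i j
  simp [hessian, H.hess, Matrix.vecMulVec_apply]

theorem HasLogJet.dotProduct_neg_hessian {h : Poly} {v L : V} {M : M3} (H : HasLogJet h v L M)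
    {w : V} (hw : L ⬝ᵥ w = 0) :
    w ⬝ᵥ ((-hessian h v) *ᵥ w) = -(eval v h * (w ⬝ᵥ (M *ᵥ w))) := by
  rw [H.hessian_eq, Matrix.neg_mulVec, Matrix.smul_mulVec, Matrix.add_mulVec,
    Matrix.vecMulVec_mulVec, hw]
  simp

theorem HasLogJet.det_neg_hessian {h : Poly} {v L : V} {M : M3} (H : HasLogJet h v L M) :
    (-hessian h v).det = -(eval v h ^ 3 * (Matrix.vecMulVec L L + M).det) := by
  rw [H.hessian_eq, Matrix.det_neg, Matrix.det_smul]
  simp [Odd.neg_one_pow (n := 3) (by decide)]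

theorem hasLogJet_flatPoly (a b c : ℕ) {v : V} (hv : ∀ i, v i ≠ 0) :
    HasLogJet (flatPoly a b c) v (fun i => (![a, b, c] : Fin 3 → ℝ) i / v i)
      (Matrix.diagonal fun i => -((![a, b, c] : Fin 3 → ℝ) i / v i ^ 2)) := by
  have hX : ∀ i : Fin 3, eval v (X i : Poly) ≠ 0 := fun i => by simpa using hv i
  have := (((HasLogJet.of_ne_zero (hX 0)).pow a).mul ((HasLogJet.of_ne_zero (hX 1)).pow b)).mul
    ((HasLogJet.of_ne_zero (hX 2)).pow c)
  convert this using 1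
  · rfl
  · funext i
    fin_cases i <;> simp [div_eq_mul_inv]
  · ext i j
    fin_cases i <;> fin_cases j <;> simp [div_eq_mul_inv]

/-- The determinant of the negative Hessian is a negative multiple of `h ^ 3`, with the factor `a b
c (a + b + c - 1)`, so beyond `h > 0` only a vector of positive square is needed. -/
theorem mem_hyp_flatPoly {a b c : ℕ} (ha : 1 ≤ a) (hb : 1 ≤ b) (hc : 1 ≤ c) {v : V} :
    v ∈ hyp (flatPoly a b c) ↔ 0 < eval v (flatPoly a b c) := by
  refine ⟨fun h => h.1, fun h => ?_⟩
  have hv : ∀ i, v i ≠ 0 := by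
    intro i h0
    rw [eval_flatPoly, Finset.prod_eq_zero (Finset.mem_univ i)] at h
    · exact lt_irrefl _ h
    · rw [h0]; fin_cases i <;> simp <;> omega
  have ha' : (1 : ℝ) ≤ a := by exact_mod_cast ha
  have hb' : (1 : ℝ) ≤ b := by exact_mod_cast hb
  have hc' : (1 : ℝ) ≤ c := by exact_mod_cast hc
  have H := hasLogJet_flatPoly a b c hv
  have h0 := hv 0; have h1 := hv 1; have h2 := hv 2
  -- The vector is tangent to the level set, where the rank-one part of the Hessian drops out.
  refine mem_hyp_iff.2 ⟨h, ?_, ![v 0 * b, -(v 1 * a), 0], ?_⟩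
  · rw [H.det_neg_hessian]
    have e : (Matrix.vecMulVec (fun i => (![a, b, c] : Fin 3 → ℝ) i / v i)
        (fun i => (![a, b, c] : Fin 3 → ℝ) i / v i) +
        Matrix.diagonal fun i => -((![a, b, c] : Fin 3 → ℝ) i / v i ^ 2)).det =
        a * b * c * (a + b + c - 1) / (v 0 * v 1 * v 2) ^ 2 := by
      rw [Matrix.det_fin_three]
      simp [Matrix.vecMulVec_apply]
      field_simp
      ring
    rw [e, neg_lt_zero]
    have : 0 < (a : ℝ) + b + c - 1 := by linarith
    positivity
  · rw [H.dotProduct_neg_hessian]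
    · simp [dotProduct, Matrix.mulVec_diagonal, Fin.sum_univ_three]
      have : -(v 1 * a * (b / v 1 ^ 2 * (v 1 * a))) + -(v 0 * b * (a / v 0 ^ 2 * (v 0 * b))) =
          -((a : ℝ) * b * (a + b)) := by
        field_simp; ring
      rw [this]
      exact mul_neg_of_pos_of_neg h (neg_lt_zero.2 (by positivity))
    · simp [dotProduct, Fin.sum_univ_three]
      field_simp; ring

theorem nullForm_ne_zero_of_quadForm_pos {v : V} (hq : 0 < quadForm v) : nullForm v ≠ 0 := by
  intro h
  have h1 : v 2 = -v 0 := by rw [nullForm] at h; linarith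
  rw [quadForm, h1] at hq
  nlinarith [sq_nonneg (v 1)]

theorem hasLogJet_affinePoly (τ k : ℕ) {v : V} (hu : τ - 2 * k = 0 ∨ nullForm v ≠ 0)
    (hq : quadForm v ≠ 0) : HasLogJet (affinePoly τ k) v
      (((τ - 2 * k : ℕ) / nullForm v) • ![1, 0, 1] +
        (k / quadForm v) • ![2 * v 0, -2 * v 1, -2 * v 2])
      (-((τ - 2 * k : ℕ) / nullForm v ^ 2) • Matrix.vecMulVec ![1, 0, 1] ![1, 0, 1] +
        ((k / quadForm v) • Matrix.diagonal ![2, -2, -2] - (k / quadForm v ^ 2) •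
          Matrix.vecMulVec ![2 * v 0, -2 * v 1, -2 * v 2] ![2 * v 0, -2 * v 1, -2 * v 2])) := by
  have h1 : HasLogJet (nullPoly ^ (τ - 2 * k)) v (((τ - 2 * k : ℕ) / nullForm v) • ![1, 0, 1])
      (-((τ - 2 * k : ℕ) / nullForm v ^ 2) • Matrix.vecMulVec ![1, 0, 1] ![1, 0, 1]) := by
    rcases hu with h0 | h0
    · rw [h0]
      simpa using HasLogJet.one v
    · have := (HasLogJet.of_ne_zero (f := nullPoly) (v := v) (by simpa using h0)).pow (τ - 2 * k)
      convert this using 1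
      · funext i
        fin_cases i <;> simp [nullPoly, pderiv_X, div_eq_mul_inv, nullForm]
      · ext i j
        fin_cases i <;> fin_cases j <;>
          simp [nullPoly, pderiv_X, div_eq_mul_inv, nullForm]
  have h2 : HasLogJet (quad ^ k) v ((k / quadForm v) • ![2 * v 0, -2 * v 1, -2 * v 2])
      ((k / quadForm v) • Matrix.diagonal ![2, -2, -2] - (k / quadForm v ^ 2) •
          Matrix.vecMulVec ![2 * v 0, -2 * v 1, -2 * v 2] ![2 * v 0, -2 * v 1, -2 * v 2]) := by
    have := (HasLogJet.of_ne_zero (f := quad) (v := v) (by simpa using hq)).pow k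
    have hp : ∀ i : Fin 3, eval v (pderiv i quad) = (![2 * v 0, -2 * v 1, -2 * v 2] : V) i := by
      intro i
      fin_cases i <;> simp [quad, pderiv_X]
    have hpp : ∀ i j : Fin 3, eval v (pderiv i (pderiv j quad)) =
        (Matrix.diagonal ![2, -2, -2] : M3) i j := by
      intro i j
      have h2 : pderiv i (2 : Poly) = 0 := by
        rw [show (2 : Poly) = C 2 from (map_ofNat C 2).symm, pderiv_C]
      fin_cases i <;> fin_cases j <;> simp_all [quad, pderiv_X]
    convert this using 1
    · funext i
      simp [hp, div_eq_mul_inv]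
      ring
    · ext i j
      simp only [hp, hpp, Matrix.smul_apply, Matrix.sub_apply, Matrix.vecMulVec_apply,
        Matrix.of_apply, smul_eq_mul, eval_quad]
      ring
  exact h1.mul h2

theorem det_logJet_affine {n k x y z : ℝ} (hu : n = 0 ∨ x + z ≠ 0)
    (hq : x ^ 2 - y ^ 2 - z ^ 2 ≠ 0) :
    (Matrix.vecMulVec ((n / (x + z)) • ![1, 0, 1] +
        (k / (x ^ 2 - y ^ 2 - z ^ 2)) • ![2 * x, -2 * y, -2 * z])
        ((n / (x + z)) • ![1, 0, 1] +
        (k / (x ^ 2 - y ^ 2 - z ^ 2)) • ![2 * x, -2 * y, -2 * z]) +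
      (-(n / (x + z) ^ 2) • Matrix.vecMulVec ![1, 0, 1] ![1, 0, 1] +
        ((k / (x ^ 2 - y ^ 2 - z ^ 2)) • Matrix.diagonal ![2, -2, -2] -
        (k / (x ^ 2 - y ^ 2 - z ^ 2) ^ 2) •
          Matrix.vecMulVec ![2 * x, -2 * y, -2 * z] ![2 * x, -2 * y, -2 * z])) : M3).det =
      8 * k ^ 2 * (n + k) * (n + 2 * k - 1) / (x ^ 2 - y ^ 2 - z ^ 2) ^ 3 := by
  rw [Matrix.det_fin_three]
  simp
  rcases hu with rfl | hu
  · simp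
    field_simp
    ring
  · obtain ⟨q, hqd⟩ : ∃ q, q = x ^ 2 - y ^ 2 - z ^ 2 := ⟨_, rfl⟩
    obtain ⟨u, hud⟩ : ∃ u, u = x + z := ⟨_, rfl⟩
    rw [← hqd] at hq ⊢
    rw [← hud] at hu ⊢
    -- In terms of `u = x + z`, `y` and `q`, where `x - z = (q + y ^ 2) / u`, the claim is an
    -- identity of rational functions in independent variables.
    have hx : x = (u + (q + y ^ 2) / u) / 2 := by
      field_simp; rw [hqd, hud]; ring
    have hz : z = (u - (q + y ^ 2) / u) / 2 := by
      field_simp; rw [hqd, hud]; ring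
    rw [hx, hz]
    field_simp
    ring

/-- The determinant of the negative Hessian is a negative constant times the cube of `h` divided by
the quadratic form. For `h > 0` its sign therefore forces the quadratic form to be positive. -/
theorem mem_hyp_affinePoly {τ k : ℕ} (hk : 1 ≤ k) {v : V} :
    v ∈ hyp (affinePoly τ k) ↔ 0 < quadForm v ∧ 0 < nullForm v ^ (τ - 2 * k) := by
  have hk' : (1 : ℝ) ≤ k := by exact_mod_cast hk
  have hn : (0 : ℝ) ≤ ((τ - 2 * k : ℕ) : ℝ) := Nat.cast_nonneg _
  have hdet : (τ - 2 * k = 0 ∨ nullForm v ≠ 0) → quadForm v ≠ 0 →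
      (-hessian (affinePoly τ k) v).det = -(eval v (affinePoly τ k) ^ 3 * (8 * k ^ 2 *
        ((τ - 2 * k : ℕ) + k) * ((τ - 2 * k : ℕ) + 2 * k - 1) / quadForm v ^ 3)) := by
    intro hu hq
    rw [(hasLogJet_affinePoly τ k hu hq).det_neg_hessian]
    congr 2
    exact det_logJet_affine (by
      rcases hu with h | h
      · left; rw [h]; simp
      · right; exact h) hq
  have hpos : 0 < 8 * (k : ℝ) ^ 2 * ((τ - 2 * k : ℕ) + k) * ((τ - 2 * k : ℕ) + 2 * k - 1) := by
    have : 0 < ((τ - 2 * k : ℕ) : ℝ) + 2 * k - 1 := by linarith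
    positivity
  constructor
  · intro h
    obtain ⟨h1, h2, -⟩ := mem_hyp_iff.1 h
    have hev := eval_affinePoly τ k v
    have hq : quadForm v ≠ 0 := by
      intro h0
      rw [hev, h0, zero_pow (by omega), mul_zero] at h1
      exact lt_irrefl _ h1
    have hu : τ - 2 * k = 0 ∨ nullForm v ≠ 0 := by
      by_contra hcon
      push Not at hcon
      rw [hev, hcon.2, zero_pow hcon.1, zero_mul] at h1
      exact lt_irrefl _ h1
    rw [hdet hu hq, neg_lt_zero] at h2
    have h3 := (pos_iff_pos_of_mul_pos h2).1 (pow_pos h1 3)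
    have hq3 : 0 < quadForm v ^ 3 := by
      by_contra hcon
      push Not at hcon
      exact absurd h3 (not_lt.2 (div_nonpos_of_nonneg_of_nonpos hpos.le hcon))
    have hqp : 0 < quadForm v := (Odd.pow_pos_iff (by decide)).1 hq3
    refine ⟨hqp, ?_⟩
    rw [hev] at h1
    exact (pos_iff_pos_of_mul_pos h1).2 (pow_pos hqp k)
  · rintro ⟨hq, hu⟩
    have hu0 := nullForm_ne_zero_of_quadForm_pos hq
    have h1 : 0 < eval v (affinePoly τ k) := by rw [eval_affinePoly]; positivity
    -- The vector is tangent to the level sets of both factors, so only the constant Hessian of the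
    -- quadratic form contributes.
    refine mem_hyp_iff.2 ⟨h1, ?_, ![v 1, nullForm v, -v 1], ?_⟩
    · rw [hdet (Or.inr hu0) hq.ne', neg_lt_zero]
      positivity
    · rw [(hasLogJet_affinePoly τ k (Or.inr hu0) hq.ne').dotProduct_neg_hessian]
      · have e : (![v 1, nullForm v, -v 1] : V) ⬝ᵥ ((-((τ - 2 * k : ℕ) / nullForm v ^ 2) •
          Matrix.vecMulVec ![1, 0, 1] ![1, 0, 1] +
          ((k / quadForm v) • Matrix.diagonal ![2, -2, -2] - (k / quadForm v ^ 2) •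
          Matrix.vecMulVec ![2 * v 0, -2 * v 1, -2 * v 2] ![2 * v 0, -2 * v 1, -2 * v 2]) : M3) *ᵥ
            ![v 1, nullForm v, -v 1]) = -(2 * k * nullForm v ^ 2 / quadForm v) := by
          simp [Matrix.mulVec, dotProduct, Fin.sum_univ_three]
          rw [show v 0 = nullForm v - v 2 by rw [nullForm]; ring]
          field_simp
          ring
        rw [e, mul_neg, neg_neg]
        positivity
      · simp [dotProduct, Fin.sum_univ_three]
        rw [show v 0 = nullForm v - v 2 by rw [nullForm]; ring]
        ring

/-! ### Connected components of hyperbolic level sets -/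

theorem hyp₁_eq_radial {n : ℕ} {h : Poly} {p : V} (hp : p ∈ hyp₁ h) : radial n h p = p :=
  radial_eq_self hp.1

theorem isPreconnected_radial_image {n : ℕ} {h : Poly} {K : Set V} (hK : IsPreconnected K)
    (hKh : K ⊆ hyp h) : IsPreconnected (radial n h '' K) :=
  hK.image _ fun _ hv => (continuousAt_radial (hKh hv).1).continuousWithinAt

/-- Radial projection retracts the open cone `hyp h` continuously onto `hyp₁ h`, so it carries a
component of the cone into one component of the level set. -/
theorem connectedComponentIn_hyp₁_eq_inter {n : ℕ} (hn : n ≠ 0) {h : Poly}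
    (hh : h.IsHomogeneous n) {p : V} (hp : p ∈ hyp₁ h) :
    connectedComponentIn (hyp₁ h) p = connectedComponentIn (hyp h) p ∩ hyp₁ h := by
  refine Set.Subset.antisymm (Set.subset_inter
    (connectedComponentIn_mono _ (hyp₁_subset_hyp h)) (connectedComponentIn_subset _ _)) ?_
  rintro q ⟨hq, hq1⟩
  have hsub := connectedComponentIn_subset (hyp h) p
  refine (isPreconnected_radial_image (n := n) isPreconnected_connectedComponentIn
    hsub).subset_connectedComponentIn (x := p)
    ⟨p, mem_connectedComponentIn (hyp₁_subset_hyp h hp), hyp₁_eq_radial hp⟩ ?_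
    ⟨q, hq, hyp₁_eq_radial hq1⟩
  rintro _ ⟨v, hv, rfl⟩
  exact radial_mem_hyp₁ hn hh (hsub hv)

theorem exists_isOpen_connectedComponentIn_eq {n : ℕ} (hn : n ≠ 0) {h : Poly}
    (hh : h.IsHomogeneous n) {p : V} (hp : p ∈ hyp₁ h) :
    ∃ U : Set V, IsOpen U ∧ connectedComponentIn (hyp₁ h) p = U ∩ hyp₁ h :=
  ⟨_, (isOpen_hyp h).connectedComponentIn, connectedComponentIn_hyp₁_eq_inter hn hh hp⟩

theorem exists_isClosed_connectedComponentIn_eq {S : Set V} {p : V} (hp : p ∈ S) :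
    ∃ F : Set V, IsClosed F ∧ connectedComponentIn S p = F ∩ S := by
  obtain ⟨F, hF, he⟩ := isClosed_induced_iff.1 (isClosed_connectedComponent (x := (⟨p, hp⟩ : S)))
  refine ⟨F, hF, ?_⟩
  rw [connectedComponentIn_eq_image hp, ← he, Subtype.image_preimage_coe, Set.inter_comm]

theorem connectedComponentIn_hyp₁_eq {ι : Type*} {n : ℕ} (hn : n ≠ 0) {h : Poly}
    (hh : h.IsHomogeneous n) {K : ι → Set V} (hKo : ∀ i, IsOpen (K i))
    (hKc : ∀ i, IsPreconnected (K i)) (hKd : Pairwise (Function.onFun Disjoint K))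
    (hKu : hyp h = ⋃ i, K i) {p : V} {i : ι} (hp : p ∈ hyp₁ h) (hpi : p ∈ K i) :
    connectedComponentIn (hyp₁ h) p = K i ∩ hyp₁ h := by
  have hsub : K i ⊆ hyp h := hKu ▸ Set.subset_iUnion K i
  rw [connectedComponentIn_hyp₁_eq_inter hn hh hp]
  congr 1
  refine Set.Subset.antisymm ?_ ((hKc i).subset_connectedComponentIn hpi hsub)
  refine IsPreconnected.subset_left_of_subset_union (hKo i)
    (isOpen_iUnion fun j : {j // j ≠ i} => hKo j) ?_ ?_
    ⟨p, mem_connectedComponentIn (hyp₁_subset_hyp h hp), hpi⟩ isPreconnected_connectedComponentIn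
  · exact Set.disjoint_iUnion_right.2 fun j => hKd j.2.symm
  · intro q hq
    have := connectedComponentIn_subset _ _ hq
    rw [hKu] at this
    obtain ⟨j, hj⟩ := Set.mem_iUnion.1 this
    by_cases hji : j = i
    · exact Or.inl (hji ▸ hj)
    · exact Or.inr (Set.mem_iUnion.2 ⟨⟨j, hji⟩, hj⟩)

theorem card_connectedComponents_hyp₁ {ι : Type*} {n : ℕ} (hn : n ≠ 0) {h : Poly}
    (hh : h.IsHomogeneous n) {K : ι → Set V} (hKo : ∀ i, IsOpen (K i))
    (hKc : ∀ i, IsConnected (K i)) (hKd : Pairwise (Function.onFun Disjoint K))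
    (hKu : hyp h = ⋃ i, K i) : Nat.card (ConnectedComponents (hyp₁ h)) = Nat.card ι := by
  have hsub : ∀ i, K i ⊆ hyp h := fun i => hKu ▸ Set.subset_iUnion K i
  choose x hx using fun i => (hKc i).nonempty
  let y : ι → hyp₁ h := fun i => ⟨radial n h (x i), radial_mem_hyp₁ hn hh (hsub i (hx i))⟩
  have hcomp : ∀ {p : V} {i : ι} (hp : p ∈ hyp₁ h), p ∈ K i →
      connectedComponentIn (hyp₁ h) p = K i ∩ hyp₁ h := fun hp hpi =>
    connectedComponentIn_hyp₁_eq hn hh hKo (fun i => (hKc i).isPreconnected) hKd hKu hp hpi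
  have hmk : ∀ p q : hyp₁ h, (ConnectedComponents.mk p = ConnectedComponents.mk q) ↔
      (p : V) ∈ connectedComponentIn (hyp₁ h) q := by
    intro p q
    rw [ConnectedComponents.coe_eq_coe', connectedComponentIn_eq_image q.2]
    simp
  -- The segment from `x i` to its radial projection lies in the cone and cannot leave one member of
  -- a disjoint open cover.
  have hyK : ∀ i, (y i : V) ∈ K i := by
    intro i
    have hseg : IsPreconnected (segment ℝ (x i) (y i)) := (convex_segment _ _).isPreconnected
    have hseg' : segment ℝ (x i) (y i : V) ⊆ hyp h := by
      rintro _ ⟨a, b, ha, hb, hab, rfl⟩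
      have hc : 0 < (eval (x i) h) ^ (-(1 / (n : ℝ))) :=
        Real.rpow_pos_of_pos (hsub i (hx i)).1 _
      have : a • x i + b • (y i : V) = (a + b * (eval (x i) h) ^ (-(1 / (n : ℝ)))) • x i := by
        simp only [y, radial, add_smul, mul_smul]
      rw [this]
      refine smul_mem_hyp hh ?_ (hsub i (hx i))
      rcases ha.eq_or_lt with rfl | ha
      · have : b = 1 := by linarith
        rw [this]; linarith
      · positivity
    refine IsPreconnected.subset_left_of_subset_union (hKo i)
      (isOpen_iUnion fun j : {j // j ≠ i} => hKo j)
      (Set.disjoint_iUnion_right.2 fun j => hKd j.2.symm) ?_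
      ⟨x i, left_mem_segment _ _ _, hx i⟩ hseg (right_mem_segment _ _ _)
    intro q hq
    have := hseg' hq
    rw [hKu] at this
    obtain ⟨j, hj⟩ := Set.mem_iUnion.1 this
    by_cases hji : j = i
    · exact Or.inl (hji ▸ hj)
    · exact Or.inr (Set.mem_iUnion.2 ⟨⟨j, hji⟩, hj⟩)
  refine (Nat.card_eq_of_bijective (fun i => ConnectedComponents.mk (y i)) ⟨?_, ?_⟩).symm
  · intro i j hij
    rw [hmk, hcomp (y j).2 (hyK j)] at hij
    by_contra hne
    exact Set.disjoint_left.1 (hKd hne) (hyK i) hij.1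
  · intro c
    obtain ⟨p, rfl⟩ := ConnectedComponents.surjective_coe c
    have hp := hyp₁_subset_hyp h p.2
    rw [hKu] at hp
    obtain ⟨j, hj⟩ := Set.mem_iUnion.1 hp
    refine ⟨j, ?_⟩
    rw [hmk, hcomp p.2 hj]
    exact ⟨hyK j, (y j).2⟩

/-! ### Homogeneity of the components -/

theorem continuous_act (A : GL3) : Continuous (act A) :=
  continuous_const.matrix_mulVec continuous_id

theorem continuous_act_left (p : V) : Continuous fun A : GL3 => act A p :=
  Units.continuous_val.matrix_mulVec continuous_const

theorem isClosed_autGroup (h : Poly) : IsClosed (autGroup h : Set GL3) := by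
  have : (autGroup h : Set GL3) = ⋂ v : V, {A | eval (act A v) h = eval v h} := by
    ext A; simp [autGroup]
  rw [this]
  exact isClosed_iInter fun v =>
    isClosed_eq ((continuous_eval h).comp (continuous_act_left v)) continuous_const

theorem act_inv_act (A : GL3) (v : V) : act A⁻¹ (act A v) = v := by
  rw [← act_mul, inv_mul_cancel, act_one]

theorem act_mem_connectedComponentIn {h : Poly} {A : GL3} (hA : A ∈ autGroup h) {p q : V}
    (hp : p ∈ hyp₁ h) (hq : q ∈ connectedComponentIn (hyp₁ h) p) :
    act A q ∈ connectedComponentIn (hyp₁ h) (act A p) := by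
  refine (isPreconnected_connectedComponentIn.image _
    (continuous_act A).continuousOn).subset_connectedComponentIn
    ⟨p, mem_connectedComponentIn hp, rfl⟩ ?_ ⟨q, hq, rfl⟩
  rintro _ ⟨v, hv, rfl⟩
  exact (act_mem_hyp₁ hA).2 (connectedComponentIn_subset _ _ hv)

/-- The automorphisms of `h` that preserve the set `C`. -/
def setStab (h : Poly) (C : Set V) : Subgroup GL3 where
  carrier := {A | A ∈ autGroup h ∧ ∀ v, act A v ∈ C ↔ v ∈ C}
  one_mem' := ⟨one_mem _, fun v => by rw [act_one]⟩
  mul_mem' := fun {A B} hA hB => ⟨mul_mem hA.1 hB.1, fun v => by rw [act_mul, hA.2, hB.2]⟩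
  inv_mem' := fun {A} hA => ⟨inv_mem hA.1, fun v => by rw [← hA.2, act_act_inv]⟩

/-- As `C` is clopen in the level set, which automorphisms preserve, stability of `C` is a closed
condition: points of `C` stay in `F` and the other points of the level set stay outside `U`. -/
theorem isClosed_setStab {h : Poly} {C U F : Set V} (hU : IsOpen U) (hCU : C = U ∩ hyp₁ h)
    (hF : IsClosed F) (hCF : C = F ∩ hyp₁ h) : IsClosed (setStab h C : Set GL3) := by
  have : (setStab h C : Set GL3) = (autGroup h : Set GL3) ∩
      ((⋂ v ∈ C, {A | act A v ∈ F}) ∩ ⋂ v ∈ hyp₁ h \ C, {A | act A v ∈ Uᶜ}) := by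
    ext A
    simp only [setStab, Subgroup.coe_set_mk, Submonoid.coe_set_mk, Subsemigroup.coe_set_mk,
      Set.mem_ofPred_eq, Set.mem_inter_iff, Set.mem_iInter, SetLike.mem_coe]
    refine and_congr_right fun hA => ⟨fun h => ⟨fun v hv => ?_, fun v hv hvU => ?_⟩, fun h v => ?_⟩
    · have := (h v).2 hv
      rw [hCF] at this
      exact this.1
    · refine hv.2 ((h v).1 ?_)
      rw [hCU]
      exact ⟨hvU, (act_mem_hyp₁ hA).2 hv.1⟩
    · constructor
      · intro hv
        by_contra hvC
        have h1 : act A v ∈ U ∩ hyp₁ _ := hCU ▸ hv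
        exact h.2 v ⟨(act_mem_hyp₁ hA).1 h1.2, hvC⟩ h1.1
      · intro hv
        have h1 : v ∈ F ∩ hyp₁ _ := hCF ▸ hv
        rw [hCF]
        exact ⟨h.1 v hv, (act_mem_hyp₁ hA).2 h1.2⟩
  rw [this]
  exact (isClosed_autGroup h).inter (IsClosed.inter
    (isClosed_biInter fun v _ => hF.preimage (continuous_act_left v))
    (isClosed_biInter fun v _ => hU.isClosed_compl.preimage (continuous_act_left v)))

theorem metric_act (τ : ℕ) {h : Poly} {A : GL3} (hA : A ∈ autGroup h) (p v w : V) :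
    metric τ h (act A p) (act A v) (act A w) = metric τ h p v w := by
  have e : hessian h p = A.valᵀ * hessian h (act A p) * A.val := by
    conv_lhs => rw [← mem_autGroup_iff.1 hA]
    rw [hessian_subst]; rfl
  rw [metric, metric, e, ← Matrix.mulVec_mulVec, ← Matrix.mulVec_mulVec,
    Matrix.dotProduct_mulVec v, Matrix.vecMul_transpose]
  rfl

theorem hasFDerivAt_act (A : GL3) (p : V) :
    HasFDerivAt (act A) (LinearMap.toContinuousLinearMap (Matrix.mulVecLin A.val)) p :=
  (LinearMap.toContinuousLinearMap (Matrix.mulVecLin A.val)).hasFDerivAt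

theorem contDiff_act (A : GL3) : ContDiff ℝ ∞ (act A) :=
  (LinearMap.toContinuousLinearMap (Matrix.mulVecLin A.val)).contDiff

theorem areIsometric_of_mem_autGroup (τ : ℕ) {h : Poly} {A : GL3} (hA : A ∈ autGroup h) {p : V}
    (hp : p ∈ hyp₁ h) : AreIsometric τ h (connectedComponentIn (hyp₁ h) p)
      (connectedComponentIn (hyp₁ h) (act A p)) := by
  refine ⟨act A, act A⁻¹, Set.univ, Set.univ, isOpen_univ, isOpen_univ, Set.subset_univ _,
    Set.subset_univ _, (contDiff_act A).contDiffOn, (contDiff_act _).contDiffOn,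
    fun q hq => act_mem_connectedComponentIn hA hp hq, fun q hq => ?_,
    fun q _ => act_inv_act A q, fun q _ => act_act_inv A q, fun q _ v w _ _ => ?_⟩
  · have := act_mem_connectedComponentIn (inv_mem hA) ((act_mem_hyp₁ hA).2 hp) hq
    rwa [act_inv_act] at this
  · rw [(hasFDerivAt_act A q).fderiv]
    exact metric_act τ hA q v w

/-- Automorphisms permute the components isometrically, and one that joins two points of a component
preserves it. Transitivity on the whole level set thus gives homogeneity and isometry of the
components at once. -/
theorem homogeneous_of_transitive {τ : ℕ} (hτ : 3 ≤ τ) {h : Poly} (hh : h.IsHomogeneous τ)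
    (hne : (hyp h).Nonempty)
    (htr : ∀ p ∈ hyp₁ h, ∀ q ∈ hyp₁ h, ∃ A ∈ autGroup h, act A p = q) :
    IsHyperbolic τ h ∧
      (∀ p ∈ hyp₁ h, IsGPSRSurface τ h (connectedComponentIn (hyp₁ h) p) ∧
        ∃ G : Subgroup GL3, IsClosed (G : Set GL3) ∧
          ActsTransitivelyOn G (connectedComponentIn (hyp₁ h) p)) ∧
      ∀ p ∈ hyp₁ h, ∀ q ∈ hyp₁ h, AreIsometric τ h (connectedComponentIn (hyp₁ h) p)
        (connectedComponentIn (hyp₁ h) q) := by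
  have hτ0 : τ ≠ 0 := by omega
  refine ⟨⟨hh, hne⟩, fun p hp => ?_, fun p hp q hq => ?_⟩
  · obtain ⟨U, hU, hCU⟩ := exists_isOpen_connectedComponentIn_eq hτ0 hh hp
    obtain ⟨F, hF, hCF⟩ := exists_isClosed_connectedComponentIn_eq hp
    refine ⟨⟨hτ, ⟨hh, hne⟩, ⟨p, mem_connectedComponentIn hp⟩, U, hU, hCU⟩,
      setStab h (connectedComponentIn (hyp₁ h) p), isClosed_setStab hU hCU hF hCF,
      fun A hA v hv => (hA.2 v).2 hv, fun q hq r hr => ?_⟩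
    have hq1 := connectedComponentIn_subset _ _ hq
    have hr1 := connectedComponentIn_subset _ _ hr
    obtain ⟨A, hA, rfl⟩ := htr q hq1 r hr1
    have e1 := connectedComponentIn_eq hq
    have e2 := connectedComponentIn_eq hr
    refine ⟨A, ⟨hA, fun v => ⟨fun hv => ?_, fun hv => ?_⟩⟩, rfl⟩
    · rw [e2] at hv
      have := act_mem_connectedComponentIn (inv_mem hA) hr1 hv
      rwa [act_inv_act, act_inv_act, ← e1] at this
    · rw [e1] at hv
      have := act_mem_connectedComponentIn hA hq1 hv
      rwa [← e2] at this
  · obtain ⟨A, hA, rfl⟩ := htr p hp q hq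
    exact areIsometric_of_mem_autGroup τ hA hp

/-! ### Linear maps preserving the null form and the quadratic form up to scale -/

/-- The matrix that multiplies `x + z` by `α` and `x² - y² - z²` by `s²`, and maps `y` to
`s y + γ (x + z)`. -/
def affMat (α s γ : ℝ) : M3 :=
  !![(α + (s ^ 2 + γ ^ 2) / α) / 2, s * γ / α, (α + (γ ^ 2 - s ^ 2) / α) / 2;
    γ, s, γ;
    (α - (s ^ 2 + γ ^ 2) / α) / 2, -(s * γ / α), (α - (γ ^ 2 - s ^ 2) / α) / 2]

theorem nullForm_affMat (α s γ : ℝ) (v : V) :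
    nullForm (affMat α s γ *ᵥ v) = α * nullForm v := by
  simp [nullForm, affMat, Matrix.mulVec, dotProduct, Fin.sum_univ_three]
  ring

theorem affMat_mulVec_one (α s γ : ℝ) (v : V) :
    (affMat α s γ *ᵥ v) 1 = s * v 1 + γ * nullForm v := by
  simp [nullForm, affMat, Matrix.mulVec, dotProduct, Fin.sum_univ_three]
  ring

theorem quadForm_affMat {α : ℝ} (hα : α ≠ 0) (s γ : ℝ) (v : V) :
    quadForm (affMat α s γ *ᵥ v) = s ^ 2 * quadForm v := by
  simp [quadForm, affMat, Matrix.mulVec, dotProduct, Fin.sum_univ_three]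
  field_simp
  ring

theorem det_affMat {α : ℝ} (hα : α ≠ 0) (s γ : ℝ) : (affMat α s γ).det = s ^ 3 := by
  simp [affMat, Matrix.det_fin_three]
  field_simp
  ring

theorem affMat_mul {α α' : ℝ} (hα : α ≠ 0) (hα' : α' ≠ 0) (s γ s' γ' : ℝ) :
    affMat α s γ * affMat α' s' γ' = affMat (α * α') (s * s') (s * γ' + γ * α') := by
  ext i j
  fin_cases i <;> fin_cases j <;>
    simp [affMat, Matrix.mul_apply, Fin.sum_univ_three] <;> field_simp <;> ring


theorem affMat_injective {α s γ α' s' γ' : ℝ} (h : affMat α s γ = affMat α' s' γ') :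
    α = α' ∧ s = s' ∧ γ = γ' := by
  have h1 := congrFun (congrFun h 1) 0
  have h2 := congrFun (congrFun h 1) 1
  have h3 := congrFun (congrFun h 0) 0
  have h4 := congrFun (congrFun h 2) 0
  simp [affMat] at h1 h2 h3 h4
  exact ⟨by linarith, h2, h1⟩

/-- A point is determined by the values of `x + z ≠ 0`, `y` and `x² - y² - z²`. -/
theorem eq_of_nullForm_quadForm {v w : V} (hv : nullForm v ≠ 0) (h0 : nullForm w = nullForm v)
    (h1 : w 1 = v 1) (h2 : quadForm w = quadForm v) : w = v := by
  have h3 : w 0 - w 2 = v 0 - v 2 := by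
    refine mul_left_cancel₀ hv ?_
    conv_lhs => rw [← h0]
    simp only [nullForm, quadForm] at *
    rw [h1] at h2
    linear_combination h2
  simp only [nullForm] at h0
  funext i
  fin_cases i
  · exact (by linarith : w 0 = v 0)
  · exact h1
  · exact (by linarith : w 2 = v 2)

/-- The condition on `x + z` eliminates the third row; the quadratic form on basis vectors and their
sums then determines all entries from `α`, `A 1 0` and `A 1 1`. -/
theorem eq_affMat {A : M3} {α β : ℝ} (hα : α ≠ 0) (hu : ∀ v, nullForm (A *ᵥ v) = α * nullForm v)
    (hq : ∀ v, quadForm (A *ᵥ v) = β * quadForm v) :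
    A = affMat α (A 1 1) (A 1 0) ∧ A 1 1 ^ 2 = β := by
  have u0 := hu ![1, 0, 0]
  have u1 := hu ![0, 1, 0]
  have u2 := hu ![0, 0, 1]
  have q0 := hq ![1, 0, 0]
  have q1 := hq ![0, 1, 0]
  have q2 := hq ![0, 0, 1]
  have q01 := hq ![1, 1, 0]
  have q02 := hq ![1, 0, 1]
  have q12 := hq ![0, 1, 1]
  simp [nullForm, quadForm, Matrix.mulVec, dotProduct, Fin.sum_univ_three] at *
  have e20 : A 2 0 = α - A 0 0 := by linarith
  have e21 : A 2 1 = - A 0 1 := by linarith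
  have e22 : A 2 2 = α - A 0 2 := by linarith
  rw [e20] at q0
  rw [e21] at q1
  rw [e22] at q2
  rw [e20, e21] at q01
  rw [e20, e22] at q02
  rw [e21, e22] at q12
  have hs : A 1 1 ^ 2 = β := by linarith
  have h4 : A 1 2 = A 1 0 := by
    have h6 : (A 1 2 - A 1 0) ^ 2 = 0 := by linarith
    have := pow_eq_zero_iff (two_ne_zero) |>.1 h6
    linarith
  have a01 : A 0 1 = A 1 1 * A 1 0 / α := by
    field_simp; linarith
  have a00 : A 0 0 = (α + (A 1 1 ^ 2 + A 1 0 ^ 2) / α) / 2 := by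
    field_simp; linarith
  have a02 : A 0 2 = (α + (A 1 0 ^ 2 - A 1 1 ^ 2) / α) / 2 := by
    rw [h4] at q2
    field_simp; linarith
  refine ⟨?_, hs⟩
  ext i j
  fin_cases i <;> fin_cases j <;> simp [affMat]
  · exact a00
  · exact a01
  · exact a02
  · exact h4
  · rw [e20, a00]; ring
  · rw [e21, a01]
  · rw [e22, a02]; ring

/-- `affMat` as an element of `GL(3, ℝ)`. -/
def affGL (α s γ : ℝ) (hα : α ≠ 0) (hs : s ≠ 0) : GL3 :=
  Matrix.GeneralLinearGroup.mkOfDetNeZero (affMat α s γ)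
    (by rw [det_affMat hα]; exact pow_ne_zero _ hs)

@[simp] theorem coe_affGL (α s γ : ℝ) (hα : α ≠ 0) (hs : s ≠ 0) :
    (affGL α s γ hα hs).val = affMat α s γ := rfl

theorem affGL_mem_autGroup {τ k : ℕ} {α s γ : ℝ} (hα : α ≠ 0) (hs : s ≠ 0)
    (h : α ^ (τ - 2 * k) * (s ^ 2) ^ k = 1) : affGL α s γ hα hs ∈ autGroup (affinePoly τ k) := by
  intro v
  rw [eval_affinePoly, eval_affinePoly, act, coe_affGL, nullForm_affMat, quadForm_affMat hα,
    mul_pow, mul_pow]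
  linear_combination (nullForm v ^ (τ - 2 * k) * quadForm v ^ k) * h

/-- A hyperbolic point is determined by `x + z`, `y` and the quadratic form, and some `affMat`
matches these three values. That both points lie on the level set is what makes it an automorphism.
-/
theorem transitive_affinePoly {τ k : ℕ} (hk : 1 ≤ k) : ∀ p ∈ hyp₁ (affinePoly τ k),
    ∀ q ∈ hyp₁ (affinePoly τ k), ∃ A ∈ autGroup (affinePoly τ k), act A p = q := by
  intro p hp q hq
  have hp1 : eval p (affinePoly τ k) = 1 := hp.1
  have hq1 : eval q (affinePoly τ k) = 1 := hq.1
  have hpq := ((mem_hyp_affinePoly hk).1 hp.2).1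
  have hqq := ((mem_hyp_affinePoly hk).1 hq.2).1
  have hpu := nullForm_ne_zero_of_quadForm_pos hpq
  have hqu := nullForm_ne_zero_of_quadForm_pos hqq
  rw [eval_affinePoly] at hp1 hq1
  have hr : 0 < quadForm q / quadForm p := div_pos hqq hpq
  have hs2 : √(quadForm q / quadForm p) ^ 2 = quadForm q / quadForm p := Real.sq_sqrt hr.le
  have hα : nullForm q / nullForm p ≠ 0 := div_ne_zero hqu hpu
  have hs : √(quadForm q / quadForm p) ≠ 0 := (Real.sqrt_pos.2 hr).ne'
  refine ⟨affGL (nullForm q / nullForm p) √(quadForm q / quadForm p)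
    ((q 1 - √(quadForm q / quadForm p) * p 1) / nullForm p) hα hs,
    affGL_mem_autGroup hα hs ?_, eq_of_nullForm_quadForm hqu ?_ ?_ ?_⟩
  · rw [hs2, div_pow, div_pow, div_mul_div_comm, hp1, hq1, div_one]
  · rw [act, coe_affGL, nullForm_affMat]; field_simp
  · rw [act, coe_affGL, affMat_mulVec_one]; field_simp; ring
  · rw [act, coe_affGL, quadForm_affMat hα, hs2]; field_simp

theorem quadForm_e₀ : quadForm e₀ = 1 := by simp [quadForm, e₀]

theorem nullForm_e₀ : nullForm e₀ = 1 := by simp [nullForm, e₀]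

theorem e₀_mem_hyp_affinePoly {τ k : ℕ} (hk : 1 ≤ k) : e₀ ∈ hyp (affinePoly τ k) := by
  rw [mem_hyp_affinePoly hk, quadForm_e₀, nullForm_e₀]
  simp

/-! ### The components of the hyperbolic level sets -/

/-- The two time cones of the quadratic form. -/
def timeCone (ε : ℤˣ) : Set V := {v | 0 < quadForm v ∧ 0 < (ε : ℝ) * v 0}

theorem continuous_quadForm : Continuous quadForm := by
  unfold quadForm; fun_prop

theorem isOpen_timeCone (ε : ℤˣ) : IsOpen (timeCone ε) :=
  (isOpen_lt continuous_const continuous_quadForm).inter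
    (isOpen_lt continuous_const (continuous_const.mul (continuous_apply 0)))

theorem units_cast_sq (ε : ℤˣ) : (ε : ℝ) ^ 2 = 1 := by
  rcases Int.units_eq_one_or ε with rfl | rfl <;> simp

/-- The reversed Cauchy–Schwarz inequality: the mixed term of two vectors in the same time cone is
nonnegative. -/
theorem convex_timeCone (ε : ℤˣ) : Convex ℝ (timeCone ε) := by
  rintro v ⟨hv, hv0⟩ w ⟨hw, hw0⟩ a b ha hb hab
  have key : ∀ a b : ℝ, 0 ≤ a → 0 ≤ b → a + b = 1 →
      0 < a ^ 2 * quadForm v + b ^ 2 * quadForm w := by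
    intro a b ha hb hab
    rcases ha.eq_or_lt with rfl | ha
    · have : b = 1 := by linarith
      subst this; linarith
    · have := mul_pos (pow_pos ha 2) hv
      have := mul_nonneg (sq_nonneg b) hw.le
      linarith
  have hmix : 0 ≤ v 0 * w 0 - v 1 * w 1 - v 2 * w 2 := by
    have h1 : 0 < v 0 * w 0 := by
      have := mul_pos hv0 hw0
      nlinarith [units_cast_sq ε]
    have h2 : (v 1 * w 1 + v 2 * w 2) ^ 2 ≤ (v 0 * w 0) ^ 2 := by
      simp only [quadForm] at hv hw
      have h3 : (v 1 ^ 2 + v 2 ^ 2) * (w 1 ^ 2 + w 2 ^ 2) ≤ v 0 ^ 2 * w 0 ^ 2 :=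
        mul_le_mul (by linarith) (by linarith) (by positivity) (by positivity)
      nlinarith [sq_nonneg (v 1 * w 2 - v 2 * w 1)]
    have := abs_le_of_sq_le_sq' h2 h1.le
    linarith [this.2]
  constructor
  · have h1 := key a b ha hb hab
    have h2 := mul_nonneg (mul_nonneg ha hb) hmix
    simp only [quadForm, Pi.add_apply, Pi.smul_apply, smul_eq_mul] at *
    nlinarith
  · simp only [Pi.add_apply, Pi.smul_apply, smul_eq_mul]
    rcases ha.eq_or_lt with rfl | ha
    · have : b = 1 := by linarith
      subst this; linarith
    · have := mul_pos ha hv0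
      have := mul_nonneg hb hw0.le
      linarith

theorem isConnected_timeCone (ε : ℤˣ) : IsConnected (timeCone ε) :=
  ⟨⟨(ε : ℝ) • e₀, by simp [quadForm, e₀, units_cast_sq],
    by simp [e₀, ← sq, units_cast_sq]⟩, (convex_timeCone ε).isPreconnected⟩

theorem disjoint_timeCone : Pairwise (Function.onFun Disjoint timeCone) := by
  intro ε δ hne
  refine Set.disjoint_left.2 fun v hv hw => ?_
  have h1 := hv.2
  have h2 := hw.2
  rcases Int.units_eq_one_or ε with rfl | rfl <;> rcases Int.units_eq_one_or δ with rfl | rfl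
  · exact hne rfl
  · simp at h1 h2; linarith
  · simp at h1 h2; linarith
  · exact hne rfl

/-- Inside the cone `(x + z) (x - z)` is positive, so both factors have the sign of their sum `2 x`.
-/
theorem nullForm_pos_iff {v : V} (hv : 0 < quadForm v) : 0 < nullForm v ↔ 0 < v 0 := by
  have h1 : 0 < nullForm v * (v 0 - v 2) := by
    simp only [quadForm, nullForm] at *
    nlinarith [sq_nonneg (v 1)]
  constructor
  · intro h
    have := (pos_iff_pos_of_mul_pos h1).1 h
    simp only [nullForm] at h
    linarith
  · intro h
    by_contra hcon
    have hn : v 0 - v 2 ≤ 0 := by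
      by_contra h3
      exact hcon ((pos_iff_pos_of_mul_pos h1).2 (not_le.1 h3))
    simp only [nullForm] at hcon
    linarith

theorem hyp_affinePoly_even {τ k : ℕ} (hk : 1 ≤ k) (hτ : Even τ) :
    hyp (affinePoly τ k) = ⋃ ε, timeCone ε := by
  have he : Even (τ - 2 * k) := hτ.tsub (even_two_mul k)
  ext v
  rw [mem_hyp_affinePoly hk, Set.mem_iUnion]
  constructor
  · rintro ⟨hq, -⟩
    have h0 : v 0 ≠ 0 := by
      intro h0
      rw [quadForm, h0] at hq
      nlinarith [sq_nonneg (v 1), sq_nonneg (v 2)]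
    rcases lt_or_gt_of_ne h0 with h | h
    · exact ⟨-1, hq, by simpa using h⟩
    · exact ⟨1, hq, by simpa using h⟩
  · rintro ⟨ε, hq, -⟩
    exact ⟨hq, he.pow_pos (nullForm_ne_zero_of_quadForm_pos hq)⟩

theorem hyp_affinePoly_odd {τ k : ℕ} (hk : 1 ≤ k) (hkτ : 2 * k ≤ τ) (hτ : Odd τ) :
    hyp (affinePoly τ k) = timeCone 1 := by
  have he : Odd (τ - 2 * k) := Nat.Odd.sub_even hkτ hτ (even_two_mul k)
  ext v
  rw [mem_hyp_affinePoly hk, he.pow_pos_iff]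
  constructor
  · rintro ⟨hq, hu⟩
    exact ⟨hq, by simpa using (nullForm_pos_iff hq).1 hu⟩
  · rintro ⟨hq, h0⟩
    exact ⟨hq, (nullForm_pos_iff hq).2 (by simpa using h0)⟩

theorem card_connectedComponents_affinePoly {τ k : ℕ} (hk : 1 ≤ k) (hkτ : 2 * k ≤ τ) :
    Nat.card (ConnectedComponents (hyp₁ (affinePoly τ k))) = if Odd τ then 1 else 2 := by
  have hh := isHomogeneous_affinePoly hkτ
  split_ifs with hodd
  · rw [card_connectedComponents_hyp₁ (K := fun _ : Unit => timeCone 1) (by omega) hh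
      (fun _ => isOpen_timeCone 1) (fun _ => isConnected_timeCone 1)
      (fun i j hij => absurd rfl hij) (by rw [hyp_affinePoly_odd hk hkτ hodd, Set.iUnion_const])]
    simp
  · rw [card_connectedComponents_hyp₁ (K := timeCone) (by omega) hh isOpen_timeCone
      isConnected_timeCone disjoint_timeCone (hyp_affinePoly_even hk (Nat.not_odd_iff_even.1 hodd))]
    simp

-- Octants as components of the hyperbolic sets of monomials.

/-- The octant with sign vector `ε`. -/
def octant (ε : Fin 3 → ℤˣ) : Set V := {v | ∀ i, 0 < (ε i : ℝ) * v i}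

theorem isOpen_octant (ε : Fin 3 → ℤˣ) : IsOpen (octant ε) := by
  have : octant ε = ⋂ i, {v | 0 < (ε i : ℝ) * v i} := by ext; simp [octant]
  rw [this]
  exact isOpen_iInter_of_finite fun i => isOpen_lt continuous_const (by fun_prop)

theorem isConnected_octant (ε : Fin 3 → ℤˣ) : IsConnected (octant ε) := by
  refine ⟨⟨fun i => (ε i : ℝ), fun i => by rw [← sq, units_cast_sq]; exact one_pos⟩,
    Convex.isPreconnected ?_⟩
  rintro v hv w hw a b ha hb hab i
  simp only [Pi.add_apply, Pi.smul_apply, smul_eq_mul]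
  have h1 := hv i
  have h2 := hw i
  rcases ha.eq_or_lt with rfl | ha
  · have : b = 1 := by linarith
    subst this; linarith
  · have := mul_pos ha h1
    have := mul_nonneg hb h2.le
    linarith

theorem exists_unit_mul_pos {x : ℝ} (hx : x ≠ 0) : ∃ ε : ℤˣ, 0 < (ε : ℝ) * x := by
  rcases lt_or_gt_of_ne hx with h | h
  · exact ⟨-1, by simpa using h⟩
  · exact ⟨1, by simpa using h⟩

theorem unit_eq_of_mul_pos {x : ℝ} {ε δ : ℤˣ} (h1 : 0 < (ε : ℝ) * x) (h2 : 0 < (δ : ℝ) * x) :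
    ε = δ := by
  rcases Int.units_eq_one_or ε with rfl | rfl <;> rcases Int.units_eq_one_or δ with rfl | rfl
  · rfl
  · simp at h1 h2; linarith
  · simp at h1 h2; linarith
  · rfl

/-- The sign vectors `ε` with `∏ εᵢ ^ mᵢ = 1`. -/
def signGroup (m : Fin 3 → ℕ) : Subgroup (Fin 3 → ℤˣ) where
  carrier := {ε | ∏ i, ε i ^ m i = 1}
  one_mem' := by simp
  mul_mem' := fun {a b} ha hb => by
    simp only [Set.mem_ofPred_eq, Pi.mul_apply, mul_pow, Finset.prod_mul_distrib] at *
    rw [ha, hb, one_mul]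
  inv_mem' := fun {a} ha => by
    simp only [Set.mem_ofPred_eq, Pi.inv_apply, inv_pow, Finset.prod_inv_distrib] at *
    rw [ha, inv_one]

theorem mem_signGroup {m : Fin 3 → ℕ} {ε : Fin 3 → ℤˣ} :
    ε ∈ signGroup m ↔ ∏ i, ε i ^ m i = 1 := Iff.rfl

theorem prod_pow_pos_iff {m : Fin 3 → ℕ} {ε : Fin 3 → ℤˣ} {v : V} (hv : v ∈ octant ε) :
    0 < ∏ i, v i ^ m i ↔ ε ∈ signGroup m := by
  have h1 : 0 < ∏ i, ((ε i : ℝ) * v i) ^ m i := Finset.prod_pos fun i _ => pow_pos (hv i) _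
  simp only [mul_pow, Finset.prod_mul_distrib] at h1
  have h2 : ∏ i, (ε i : ℝ) ^ m i = ((∏ i, ε i ^ m i : ℤˣ) : ℝ) := by
    push_cast; rfl
  rw [h2] at h1
  rw [mem_signGroup]
  generalize ∏ i, ε i ^ m i = δ at *
  rcases Int.units_eq_one_or δ with rfl | rfl
  · simpa using h1
  · have : ((-1 : ℤˣ) : ℝ) = -1 := by simp
    rw [this] at h1
    refine ⟨fun h => ?_, fun h => by simp at h⟩
    linarith

theorem hyp_flatPoly {a b c : ℕ} (ha : 1 ≤ a) (hb : 1 ≤ b) (hc : 1 ≤ c) :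
    hyp (flatPoly a b c) = ⋃ ε : signGroup ![a, b, c], octant ε := by
  ext v
  rw [mem_hyp_flatPoly ha hb hc, Set.mem_iUnion, eval_flatPoly]
  constructor
  · intro h
    have hv : ∀ i, v i ≠ 0 := by
      intro i h0
      rw [Finset.prod_eq_zero (Finset.mem_univ i)] at h
      · exact lt_irrefl _ h
      · rw [h0]; fin_cases i <;> simp <;> omega
    choose ε hε using fun i => exists_unit_mul_pos (hv i)
    exact ⟨⟨ε, (prod_pow_pos_iff hε).1 h⟩, hε⟩
  · rintro ⟨ε, hε⟩
    exact (prod_pow_pos_iff hε).2 ε.2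

theorem card_connectedComponents_flatPoly {a b c : ℕ} (ha : 1 ≤ a) (hb : 1 ≤ b) (hc : 1 ≤ c) :
    Nat.card (ConnectedComponents (hyp₁ (flatPoly a b c))) = Nat.card (signGroup ![a, b, c]) := by
  refine card_connectedComponents_hyp₁ (K := fun ε : signGroup ![a, b, c] => octant ε)
    (by omega) (isHomogeneous_flatPoly a b c) (fun _ => isOpen_octant _)
    (fun _ => isConnected_octant _) (fun ε δ hne => ?_) (hyp_flatPoly ha hb hc)
  refine Set.disjoint_left.2 fun v hv hw => hne (Subtype.ext (funext fun i => ?_))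
  exact unit_eq_of_mul_pos (hv i) (hw i)

theorem transitive_flatPoly {a b c : ℕ} (ha : 1 ≤ a) (hb : 1 ≤ b) (hc : 1 ≤ c) :
    ∀ p ∈ hyp₁ (flatPoly a b c), ∀ q ∈ hyp₁ (flatPoly a b c),
      ∃ A ∈ autGroup (flatPoly a b c), act A p = q := by
  intro p hp q hq
  have hne : ∀ {v : V}, v ∈ hyp₁ (flatPoly a b c) → ∀ i, v i ≠ 0 := by
    intro v hv i h0
    have h := hv.1
    rw [Set.mem_ofPred_eq, eval_flatPoly, Finset.prod_eq_zero (Finset.mem_univ i)] at h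
    · exact zero_ne_one h
    · rw [h0]; fin_cases i <;> simp <;> omega
  have hp1 : eval p (flatPoly a b c) = 1 := hp.1
  have hq1 : eval q (flatPoly a b c) = 1 := hq.1
  rw [eval_flatPoly] at hp1 hq1
  have hdet : (Matrix.diagonal fun i => q i / p i).det ≠ 0 := by
    rw [Matrix.det_diagonal]
    exact Finset.prod_ne_zero_iff.2 fun i _ => div_ne_zero (hne hq i) (hne hp i)
  refine ⟨Matrix.GeneralLinearGroup.mkOfDetNeZero (Matrix.diagonal fun i => q i / p i) hdet,
    fun v => ?_, ?_⟩
  · rw [eval_flatPoly, eval_flatPoly]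
    have : ∀ i, act (Matrix.GeneralLinearGroup.mkOfDetNeZero
        (Matrix.diagonal fun i => q i / p i) hdet) v i = q i / p i * v i := fun i =>
      Matrix.mulVec_diagonal _ _ _
    simp only [this, mul_pow, div_pow, Finset.prod_mul_distrib, Finset.prod_div_distrib, hp1, hq1]
    simp
  · funext i
    refine (Matrix.mulVec_diagonal _ _ _).trans ?_
    exact div_mul_cancel₀ _ (hne hp i)

theorem NormalForm.homogeneous {τ : ℕ} (hτ : 3 ≤ τ) (f : NormalForm τ) :
    IsHyperbolic τ f.poly ∧
      (∀ p ∈ hyp₁ f.poly, IsGPSRSurface τ f.poly (connectedComponentIn (hyp₁ f.poly) p) ∧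
        ∃ G : Subgroup GL3, IsClosed (G : Set GL3) ∧
          ActsTransitivelyOn G (connectedComponentIn (hyp₁ f.poly) p)) ∧
      ∀ p ∈ hyp₁ f.poly, ∀ q ∈ hyp₁ f.poly, AreIsometric τ f.poly
        (connectedComponentIn (hyp₁ f.poly) p) (connectedComponentIn (hyp₁ f.poly) q) := by
  refine homogeneous_of_transitive hτ f.isHomogeneous ?_ ?_
  · match f with
    | .lorentz h =>
      change (hyp (lorentzPoly τ)).Nonempty
      rw [lorentzPoly_eq h]
      exact ⟨e₀, e₀_mem_hyp_affinePoly (by omega)⟩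
    | .affine k hk _ => exact ⟨e₀, e₀_mem_hyp_affinePoly hk⟩
    | .flat a b c ha hab hbc _ _ =>
      refine ⟨fun _ => 1, (mem_hyp_flatPoly ha (by omega) (by omega)).2 ?_⟩
      rw [eval_flatPoly]
      simp
  · match f with
    | .lorentz h =>
      change ∀ p ∈ hyp₁ (lorentzPoly τ), ∀ q ∈ hyp₁ (lorentzPoly τ),
        ∃ A ∈ autGroup (lorentzPoly τ), act A p = q
      rw [lorentzPoly_eq h]
      exact transitive_affinePoly (by omega)
    | .affine k hk _ => exact transitive_affinePoly hk
    | .flat a b c ha hab hbc _ _ => exact transitive_flatPoly ha (by omega) (by omega)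

/-! ### The Lorentz group -/

theorem minkForm_self (v : V) : minkForm v v = -quadForm v := by
  simp only [minkForm, quadForm]; ring

theorem mem_O21_iff {A : GL3} : A ∈ O21 ↔ ∀ v, quadForm (act A v) = quadForm v := by
  constructor
  · intro h v
    have := h v v
    rw [minkForm_self, minkForm_self] at this
    linarith
  · intro h v w
    have hpol : ∀ v w : V, minkForm v w = (quadForm v + quadForm w - quadForm (v + w)) / 2 := by
      intro v w
      simp only [minkForm, quadForm, Pi.add_apply]; ring
    have hadd : act A v + act A w = act A (v + w) := (Matrix.mulVec_add _ _ _).symm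
    rw [hpol, hpol, hadd, h, h, h]

theorem eval_lorentzPoly (τ : ℕ) (v : V) : eval v (lorentzPoly τ) = quadForm v ^ (τ / 2) := by
  simp [lorentzPoly]

theorem autGroup_lorentzPoly {τ : ℕ} (hτ : 2 ≤ τ) : autGroup (lorentzPoly τ) = O21 := by
  have hk : τ / 2 ≠ 0 := by omega
  ext A
  rw [mem_O21_iff]
  constructor
  · intro hA
    have h : ∀ v, quadForm (act A v) ^ (τ / 2) = quadForm v ^ (τ / 2) := by
      intro v
      have := hA v
      rwa [eval_lorentzPoly, eval_lorentzPoly] at this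
    obtain ⟨h1, h2⟩ := exists_quadForm_smul (det_ne_zero A) hk (c := 1) fun v => by
      rw [one_mul]; exact h v
    have h3 : quadForm (A.val *ᵥ e₀) = 1 := by
      refine (pow_eq_one_iff_of_nonneg h1.le hk).1 ?_
      have := h e₀
      rwa [quadForm_e₀, one_pow] at this
    intro v
    have := h2 v
    rwa [h3, one_mul] at this
  · intro h v
    rw [eval_lorentzPoly, eval_lorentzPoly, h]

theorem hyp_lorentzPoly {τ : ℕ} (hτ : 2 ≤ τ) (he : Even τ) :
    hyp (lorentzPoly τ) = ⋃ ε, timeCone ε := by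
  rw [lorentzPoly_eq he, hyp_affinePoly_even (by omega) he]

theorem isHomogeneous_lorentzPoly {τ : ℕ} (he : Even τ) : (lorentzPoly τ).IsHomogeneous τ := by
  rw [lorentzPoly_eq he]
  exact isHomogeneous_affinePoly (by omega)

theorem mem_hyp₁_lorentzPoly {τ : ℕ} (hτ : 2 ≤ τ) (he : Even τ) {v : V} :
    v ∈ hyp₁ (lorentzPoly τ) ↔ quadForm v = 1 := by
  have hk : τ / 2 ≠ 0 := by omega
  have hh : v ∈ hyp (lorentzPoly τ) ↔ 0 < quadForm v := by
    rw [lorentzPoly_eq he, mem_hyp_affinePoly (by omega),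
      show τ - 2 * (τ / 2) = 0 by have := Nat.even_iff.1 he; omega]
    simp
  rw [hyp₁, Set.mem_inter_iff, hh, Set.mem_ofPred_eq, eval_lorentzPoly]
  constructor
  · rintro ⟨h1, h2⟩
    exact (pow_eq_one_iff_of_nonneg h2.le hk).1 h1
  · intro h
    rw [h]; simp

/-! ### Stabilisers -/

theorem mem_so21_iff {X : M3} : X ∈ so21 ↔
    X = !![0, X 1 0, X 2 0; X 1 0, 0, -X 2 1; X 2 0, X 2 1, 0] := by
  constructor
  · intro h
    have h00 := h ![1, 0, 0] ![1, 0, 0]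
    have h11 := h ![0, 1, 0] ![0, 1, 0]
    have h22 := h ![0, 0, 1] ![0, 0, 1]
    have h01 := h ![1, 0, 0] ![0, 1, 0]
    have h02 := h ![1, 0, 0] ![0, 0, 1]
    have h12 := h ![0, 1, 0] ![0, 0, 1]
    simp [minkForm, Matrix.mulVec, dotProduct, Fin.sum_univ_three] at h00 h11 h22 h01 h02 h12
    ext i j
    fin_cases i <;> fin_cases j <;> simp <;> linarith
  · intro h v w
    rw [h]
    simp [minkForm, Matrix.mulVec, dotProduct, Fin.sum_univ_three]
    ring

section
open scoped Matrix.Norms.Operator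

theorem hasDerivAt_exp_mulVec (X : M3) (v : V) (i : Fin 3) (t : ℝ) :
    HasDerivAt (fun t : ℝ => (NormedSpace.exp (t • X) *ᵥ v) i)
      ((X *ᵥ (NormedSpace.exp (t • X) *ᵥ v)) i) t := by
  have h := hasDerivAt_exp_smul_const' (𝕂 := ℝ) X t
  let L : M3 →ₗ[ℝ] ℝ :=
    { toFun := fun M => (M *ᵥ v) i
      map_add' := fun M N => by rw [Matrix.add_mulVec]; rfl
      map_smul' := fun c M => by rw [Matrix.smul_mulVec]; rfl }
  have h2 := (LinearMap.toContinuousLinearMap L).hasFDerivAt.comp_hasDerivAt t h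
  rw [Matrix.mulVec_mulVec]
  exact h2

end

theorem hasDerivAt_minkForm_exp (X : M3) (v w : V) (t : ℝ) :
    HasDerivAt (fun t : ℝ => minkForm (NormedSpace.exp (t • X) *ᵥ v) (NormedSpace.exp (t • X) *ᵥ w))
      (minkForm (X *ᵥ (NormedSpace.exp (t • X) *ᵥ v)) (NormedSpace.exp (t • X) *ᵥ w) +
        minkForm (NormedSpace.exp (t • X) *ᵥ v) (X *ᵥ (NormedSpace.exp (t • X) *ᵥ w))) t := by
  have hv := fun i => hasDerivAt_exp_mulVec X v i t
  have hw := fun i => hasDerivAt_exp_mulVec X w i t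
  have := (((hv 0).mul (hw 0)).neg.add ((hv 1).mul (hw 1))).add ((hv 2).mul (hw 2))
  refine this.congr_deriv ?_
  simp only [minkForm]
  ring

theorem eq_of_hasDerivAt_zero {f : ℝ → ℝ} (hf : ∀ t, HasDerivAt f 0 t) (t : ℝ) : f t = f 0 :=
  is_const_of_deriv_eq_zero (fun t => (hf t).differentiableAt) (fun t => (hf t).deriv) t 0

theorem exp_mem_stab_iff {X : M3} {p : V} {S : Subgroup GL3}
    (hS : ∀ A, A ∈ S ↔ A ∈ O21 ∧ act A p = p) :
    (∀ t : ℝ, ∃ A ∈ S, (A : M3) = NormedSpace.exp (t • X)) ↔ X ∈ so21 ∧ X *ᵥ p = 0 := by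
  constructor
  · intro h
    have hO : ∀ (t : ℝ) (v w : V), minkForm (NormedSpace.exp (t • X) *ᵥ v) (NormedSpace.exp (t • X) *ᵥ w) =
        minkForm v w := by
      intro t v w
      obtain ⟨A, hA, hAe⟩ := h t
      rw [← hAe]
      exact ((hS A).1 hA).1 v w
    have hp : ∀ t : ℝ, NormedSpace.exp (t • X) *ᵥ p = p := by
      intro t
      obtain ⟨A, hA, hAe⟩ := h t
      rw [← hAe]
      exact ((hS A).1 hA).2
    refine ⟨fun v w => ?_, ?_⟩
    · have h1 := hasDerivAt_minkForm_exp X v w 0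
      simp only [hO] at h1
      have := h1.unique (hasDerivAt_const 0 (minkForm v w))
      simpa [NormedSpace.exp_zero] using this
    · funext i
      have h1 := hasDerivAt_exp_mulVec X p i 0
      simp only [hp] at h1
      exact h1.unique (hasDerivAt_const 0 (p i))
  · rintro ⟨hX, hXp⟩ t
    refine ⟨(Matrix.isUnit_exp (t • X)).unit, (hS _).2 ⟨fun v w => ?_, ?_⟩, rfl⟩
    · have := eq_of_hasDerivAt_zero (fun t => (hasDerivAt_minkForm_exp X v w t).congr_deriv
        (hX _ _)) t
      simp only [zero_smul, NormedSpace.exp_zero, Matrix.one_mulVec] at this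
      exact this
    · have hcomm : ∀ t : ℝ, X *ᵥ (NormedSpace.exp (t • X) *ᵥ p) = 0 := by
        intro t
        have : Commute X (NormedSpace.exp (t • X)) :=
          ((Commute.refl X).smul_right t).exp_right
        rw [Matrix.mulVec_mulVec, this.eq, ← Matrix.mulVec_mulVec, hXp, Matrix.mulVec_zero]
      funext i
      have := eq_of_hasDerivAt_zero (fun t => (hasDerivAt_exp_mulVec X p i t).congr_deriv
        (congrFun (hcomm t) i)) t
      simp only [zero_smul, NormedSpace.exp_zero, Matrix.one_mulVec] at this
      exact this

theorem ne_zero_of_quadForm_pos {v : V} (hq : 0 < quadForm v) : v 0 ≠ 0 := by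
  intro h0
  rw [quadForm, h0] at hq
  nlinarith [sq_nonneg (v 1), sq_nonneg (v 2)]

theorem lieDim_stab_lorentzPoly {τ : ℕ} (hτ : 2 ≤ τ) (he : Even τ) {p : V}
    (hp : p ∈ hyp (lorentzPoly τ)) : lieDim (stab (lorentzPoly τ) p) = 1 := by
  have hq : 0 < quadForm p := by
    rw [hyp_lorentzPoly hτ he] at hp
    obtain ⟨ε, hε⟩ := Set.mem_iUnion.1 hp
    exact hε.1
  have hp0 := ne_zero_of_quadForm_pos hq
  -- The infinitesimal Lorentz rotation about `p`, up to scale the only element of `so21` that kills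
  -- `p`.
  set J : M3 := !![0, p 2, -p 1; p 2, 0, -p 0; -p 1, p 0, 0] with hJ
  have hS : ∀ A, A ∈ stab (lorentzPoly τ) p ↔ A ∈ O21 ∧ act A p = p := by
    intro A
    rw [← autGroup_lorentzPoly hτ]; rfl
  have hset : {X : M3 | ∀ t : ℝ, ∃ A ∈ stab (lorentzPoly τ) p,
      (A : M3) = NormedSpace.exp (t • X)} = (Submodule.span ℝ {J} : Set M3) := by
    ext X
    rw [Set.mem_ofPred_eq, exp_mem_stab_iff hS, SetLike.mem_coe, Submodule.mem_span_singleton]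
    constructor
    · rintro ⟨hX, hXp⟩
      rw [mem_so21_iff] at hX
      have h1 := congrFun hXp 1
      have h2 := congrFun hXp 2
      rw [hX] at h1 h2
      simp [Matrix.mulVec, dotProduct, Fin.sum_univ_three] at h1 h2
      have e1 : X 1 0 = X 2 1 / p 0 * p 2 := by field_simp; linarith
      have e2 : X 2 0 = -(X 2 1 / p 0 * p 1) := by field_simp; linarith
      refine ⟨X 2 1 / p 0, ?_⟩
      rw [hX, hJ]
      ext i j
      fin_cases i <;> fin_cases j <;> simp [e1, e2, hp0]
    · rintro ⟨c, rfl⟩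
      constructor
      · rw [mem_so21_iff]
        ext i j
        fin_cases i <;> fin_cases j <;> simp [hJ]
      · funext i
        fin_cases i <;> simp [hJ, Matrix.mulVec, dotProduct, Fin.sum_univ_three] <;> ring
  rw [lieDim, hset, Submodule.span_eq, finrank_span_singleton]
  intro h0
  have := congrFun (congrFun h0 2) 1
  simp [hJ] at this
  exact hp0 this

/-! ### The symmetric space -/

/-- The topology of a unit group also demands continuity of the inverse, which Cramer's rule
supplies. -/
theorem continuous_GL_of_val {X : Type*} [TopologicalSpace X] {n : Type*} [Fintype n]
    [DecidableEq n] {f : X → GL n ℝ} (h : Continuous fun x => (f x).val) : Continuous f := by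
  refine Units.continuous_iff.2 ⟨h, ?_⟩
  have : (fun x => ((f x)⁻¹).val) = fun x => ((f x).val.det)⁻¹ • (f x).val.adjugate := by
    funext x
    rw [Matrix.coe_units_inv, Matrix.inv_def, Ring.inverse_eq_inv']
  rw [this]
  refine (h.matrix_det.inv₀ fun x => ?_).smul h.matrix_adjugate
  exact ((Matrix.isUnit_iff_isUnit_det _).1 (f x).isUnit).ne_zero

theorem neg_minkForm_pos_iff {v w : V} (hv : 0 < quadForm v) (hw : 0 < quadForm w) (hw0 : 0 < w 0) :
    0 < -minkForm v w ↔ 0 < v 0 := by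
  have h2 : (v 1 * w 1 + v 2 * w 2) ^ 2 < (v 0 * w 0) ^ 2 := by
    simp only [quadForm] at hv hw
    have h3 : (v 1 ^ 2 + v 2 ^ 2) * (w 1 ^ 2 + w 2 ^ 2) < v 0 ^ 2 * w 0 ^ 2 :=
      mul_lt_mul'' (by linarith) (by linarith) (by positivity) (by positivity)
    nlinarith [sq_nonneg (v 1 * w 2 - v 2 * w 1)]
  have h3 := sq_lt_sq.1 h2
  have h4 := abs_lt.1 h3
  rw [minkForm]
  constructor
  · intro h
    by_contra hcon
    have : v 0 * w 0 ≤ 0 := mul_nonpos_of_nonpos_of_nonneg (not_lt.1 hcon) hw0.le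
    rw [abs_of_nonpos this] at h4
    linarith
  · intro h
    rw [abs_of_pos (mul_pos h hw0)] at h4
    linarith

/-- Time orientation can be tested on the base point: by the reversed Cauchy–Schwarz inequality,
pairing with its image detects the sign of the first coordinate of every timelike vector. -/
theorem mem_SO21p_iff {A : GL3} : A ∈ SO21p ↔ A ∈ O21 ∧ A.val.det = 1 ∧ 0 < A.val 0 0 := by
  have h0 : act A e₀ 0 = A.val 0 0 := mulVec_e₀ A.val 0
  refine and_congr_right fun hO => and_congr_right fun _ => ⟨fun h => ?_, fun h v hv => ?_⟩
  · rw [← h0, h e₀ (by rw [minkForm_self, quadForm_e₀]; norm_num)]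
    simp [e₀]
  · rw [minkForm_self, neg_lt_zero] at hv
    rw [← neg_minkForm_pos_iff (w := act A e₀) (by rw [mem_O21_iff.1 hO]; exact hv)
      (by rw [mem_O21_iff.1 hO, quadForm_e₀]; exact one_pos) (by rw [h0]; exact h), hO]
    simp [minkForm, e₀]

/-- The boost that maps the base point to `p`. -/
def boostMat (p : V) : M3 :=
  !![p 0, p 1, p 2;
    p 1, 1 + p 1 * p 1 / (1 + p 0), p 1 * p 2 / (1 + p 0);
    p 2, p 1 * p 2 / (1 + p 0), 1 + p 2 * p 2 / (1 + p 0)]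

theorem det_boostMat {p : V} (hp : quadForm p = 1) (hp0 : 0 < p 0) : (boostMat p).det = 1 := by
  have h1 : 1 + p 0 ≠ 0 := by linarith
  simp only [quadForm] at hp
  simp [boostMat, Matrix.det_fin_three]
  field_simp
  grind

theorem quadForm_boostMat {p : V} (hp : quadForm p = 1) (hp0 : 0 < p 0) (v : V) :
    quadForm (boostMat p *ᵥ v) = quadForm v := by
  have h1 : 1 + p 0 ≠ 0 := by linarith
  simp only [quadForm] at hp
  simp [boostMat, quadForm, Matrix.mulVec, dotProduct, Fin.sum_univ_three]
  field_simp
  grind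

/-- The boost that maps the base point to `p`, as an element of `SO(2,1)⁺`. -/
def boost (p : V) (hp : quadForm p = 1) (hp0 : 0 < p 0) : SO21p :=
  ⟨Matrix.GeneralLinearGroup.mkOfDetNeZero (boostMat p)
      (by rw [det_boostMat hp hp0]; exact one_ne_zero),
    mem_SO21p_iff.2 ⟨mem_O21_iff.2 (quadForm_boostMat hp hp0), det_boostMat hp hp0, hp0⟩⟩

theorem act_boost {p : V} (hp : quadForm p = 1) (hp0 : 0 < p 0) : act (boost p hp hp0) e₀ = p := by
  funext i
  refine (mulVec_e₀ (boostMat p) i).trans ?_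
  fin_cases i <;> rfl

theorem exists_cos_sin {a b : ℝ} (h : a ^ 2 + b ^ 2 = 1) :
    ∃ θ : ℝ, Real.cos θ = a ∧ Real.sin θ = b := by
  have h1 : ‖(⟨a, b⟩ : ℂ)‖ = 1 := by
    rw [← sq_eq_sq₀ (norm_nonneg _) zero_le_one, ← Complex.normSq_eq_norm_sq, Complex.normSq_mk]
    linarith
  obtain ⟨θ, hθ⟩ := (Complex.norm_eq_one_iff _).1 h1
  refine ⟨θ, ?_, ?_⟩
  · rw [← Complex.exp_ofReal_mul_I_re, hθ]
  · rw [← Complex.exp_ofReal_mul_I_im, hθ]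

theorem mem_SO2_iff {g : SO21p} : g ∈ SO2 ↔ act g e₀ = e₀ := by
  constructor
  · rintro ⟨θ, hθ⟩
    funext i
    refine (mulVec_e₀ g.1.val i).trans ?_
    rw [hθ]
    fin_cases i <;> rfl
  · intro h
    obtain ⟨hO, hdet, -⟩ := mem_SO21p_iff.1 g.2
    have hc : ∀ i, g.1.val i 0 = e₀ i := fun i => by
      rw [← mulVec_e₀ g.1.val i]; exact congrFun h i
    have h0 := hc 0
    have h1 := hc 1
    have h2 := hc 2
    have h01 := hO ![1, 0, 0] ![0, 1, 0]
    have h02 := hO ![1, 0, 0] ![0, 0, 1]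
    have h11 := hO ![0, 1, 0] ![0, 1, 0]
    have h22 := hO ![0, 0, 1] ![0, 0, 1]
    have h12 := hO ![0, 1, 0] ![0, 0, 1]
    generalize hA : g.1.val = A at *
    simp [e₀] at h0 h1 h2
    simp [act, hA, minkForm, Matrix.mulVec, dotProduct, Fin.sum_univ_three, h0, h1, h2] at h01 h02
    simp [act, hA, minkForm, Matrix.mulVec, dotProduct, Fin.sum_univ_three, h01, h02]
      at h11 h22 h12
    rw [Matrix.det_fin_three] at hdet
    simp [h0, h1, h2] at hdet
    obtain ⟨θ, hcos, hsin⟩ := exists_cos_sin (a := A 1 1) (b := A 2 1) (by linarith)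
    refine ⟨θ, ?_⟩
    rw [hA, hcos, hsin]
    have e1 : A 2 2 = A 1 1 := by
      linear_combination (-A 2 2) * h11 + A 1 1 * hdet + A 2 1 * h12
    have e2 : A 1 2 = -A 2 1 := by
      linear_combination (-A 1 2) * h11 - A 2 1 * hdet + A 1 1 * h12
    ext i j
    fin_cases i <;> fin_cases j <;> simp [h0, h1, h2, h01, h02, e1, e2]

theorem quadForm_unit_smul (ε : ℤˣ) (v : V) : quadForm ((ε : ℝ) • v) = quadForm v := by
  simp only [quadForm, Pi.smul_apply, smul_eq_mul, mul_pow, units_cast_sq, one_mul]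

theorem act_boost_inv {p : V} (hp : quadForm p = 1) (hp0 : 0 < p 0) :
    act ((boost p hp hp0)⁻¹ : SO21p) p = e₀ := by
  rw [Subgroup.coe_inv]
  calc _ = act (boost p hp hp0 : GL3)⁻¹ (act (boost p hp hp0) e₀) := by rw [act_boost]
    _ = e₀ := act_inv_act _ _

/-- The orbit map `g SO(2) ↦ ε g e₀` onto a sheet of the hyperboloid. -/
def orbitHomeo (ε : ℤˣ) :
    (SO21p ⧸ SO2) ≃ₜ {q : V | quadForm q = 1 ∧ 0 < (ε : ℝ) * q 0} where
  toFun := Quotient.lift (s := QuotientGroup.leftRel SO2)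
    (fun g => ⟨(ε : ℝ) • act g e₀, by
      obtain ⟨hO, -, h0⟩ := mem_SO21p_iff.1 g.2
      have h1 := mem_O21_iff.1 hO e₀
      rw [quadForm_e₀] at h1
      constructor
      · rw [quadForm_unit_smul, h1]
      · rw [Pi.smul_apply, smul_eq_mul, ← mul_assoc, ← sq, units_cast_sq, one_mul, act, mulVec_e₀]
        exact h0⟩)
    (fun g g' h => by
      rw [← Quotient.eq_iff_equiv, Quotient.eq, QuotientGroup.leftRel_apply, mem_SO2_iff,
        Subgroup.coe_mul, act_mul] at h
      have : act g' e₀ = act g e₀ := by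
        conv_rhs => rw [← h]
        rw [Subgroup.coe_inv, act_act_inv]
      simp only [this])
  -- Boosts are a continuous section of the orbit map, so the inverse is explicit and no open
  -- mapping argument is needed.
  invFun := fun q => QuotientGroup.mk (boost ((ε : ℝ) • q.1)
    ((quadForm_unit_smul ε q).trans q.2.1) q.2.2)
  left_inv := by
    intro x
    induction x using QuotientGroup.induction_on with
    | H g =>
      rw [QuotientGroup.eq, mem_SO2_iff, Subgroup.coe_mul, act_mul]
      have : ∀ p hp hp0, p = act g e₀ → act ((boost p hp hp0)⁻¹ : SO21p) (act g e₀) = e₀ := by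
        rintro p hp hp0 h
        rw [← h, act_boost_inv]
      refine this _ _ _ ?_
      change (ε : ℝ) • (ε : ℝ) • act g e₀ = _
      rw [smul_smul, ← sq, units_cast_sq, one_smul]
  right_inv := by
    intro q
    refine Subtype.ext ?_
    change (ε : ℝ) • act (boost _ _ _) e₀ = q.1
    rw [act_boost, smul_smul, ← sq, units_cast_sq, one_smul]
  continuous_toFun := by
    refine Continuous.quotient_lift (Continuous.subtype_mk ?_ _) _
    exact ((continuous_act_left e₀).comp continuous_subtype_val).const_smul (ε : ℝ)
  continuous_invFun := by
    refine QuotientGroup.continuous_mk.comp (Continuous.subtype_mk (continuous_GL_of_val ?_) _)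
    change Continuous fun q : {q : V | quadForm q = 1 ∧ 0 < (ε : ℝ) * q 0} =>
      boostMat ((ε : ℝ) • q.1)
    have hc : ∀ i, Continuous fun q : {q : V | quadForm q = 1 ∧ 0 < (ε : ℝ) * q 0} =>
        ((ε : ℝ) • q.1) i := fun i =>
      (continuous_apply i).comp (continuous_subtype_val.const_smul (ε : ℝ))
    have hd : ∀ i j, Continuous fun q : {q : V | quadForm q = 1 ∧ 0 < (ε : ℝ) * q 0} =>
        ((ε : ℝ) • q.1) i * ((ε : ℝ) • q.1) j / (1 + ((ε : ℝ) • q.1) 0) := fun i j =>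
      ((hc i).mul (hc j)).div (continuous_const.add (hc 0)) fun q => by
        have : 0 < ((ε : ℝ) • q.1) 0 := q.2.2
        linarith
    refine continuous_matrix fun i j => ?_
    fin_cases i <;> fin_cases j
    · exact hc 0
    · exact hc 1
    · exact hc 2
    · exact hc 1
    · exact (continuous_const (y := (1 : ℝ))).add (hd 1 1)
    · exact hd 1 2
    · exact hc 2
    · exact hd 1 2
    · exact (continuous_const (y := (1 : ℝ))).add (hd 2 2)

theorem orbitHomeo_mk (ε : ℤˣ) (g : SO21p) :
    (orbitHomeo ε (g : SO21p ⧸ SO2) : V) = (ε : ℝ) • act g e₀ := rfl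

theorem metric_lorentzPoly {τ : ℕ} (hτ : 2 ≤ τ) (he : Even τ) (ε : ℤˣ) {v w : V} (hv : v 0 = 0)
    (hw : w 0 = 0) : metric τ (lorentzPoly τ) ((ε : ℝ) • e₀) v w = v 1 * w 1 + v 2 * w 2 := by
  have hk : τ - 2 * (τ / 2) = 0 := by have := Nat.even_iff.1 he; omega
  have hτk : (τ : ℝ) = 2 * (τ / 2 : ℕ) := by
    exact_mod_cast (Nat.two_mul_div_two_of_even he).symm
  have hτ0 : (τ : ℝ) ≠ 0 := by positivity
  have hq : quadForm ((ε : ℝ) • e₀) = 1 := by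
    rw [quadForm_unit_smul, quadForm_e₀]
  have hj := hasLogJet_affinePoly τ (τ / 2) (v := (ε : ℝ) • e₀) (Or.inl hk) (by rw [hq]; simp)
  rw [metric, lorentzPoly_eq he, hj.hessian_eq, eval_affinePoly, hq, hk]
  simp [Matrix.mulVec, dotProduct, Fin.sum_univ_three, hv, hw, e₀]
  rw [hτk] at hτ0 ⊢
  have hk0 : ((τ / 2 : ℕ) : ℝ) ≠ 0 := fun h => hτ0 (by rw [h, mul_zero])
  field_simp
  ring

theorem conj_mem_so21 {g : GL3} (hg : g ∈ O21) {X : M3} (hX : X ∈ so21) :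
    g⁻¹.val * X * g.val ∈ so21 := by
  intro v w
  have h1 : ∀ v : V, (g⁻¹.val * X * g.val) *ᵥ v = act g⁻¹ (X *ᵥ act g v) := fun v => by
    simp [act, Matrix.mulVec_mulVec, mul_assoc]
  rw [h1, h1, ← hg, ← hg v, act_act_inv, act_act_inv]
  exact hX _ _

theorem half_trace_symPart {X Y : M3} (hX : X ∈ so21) (hY : Y ∈ so21) :
    (1 / 2 : ℝ) * Matrix.trace (symPart X * symPart Y) = X 1 0 * Y 1 0 + X 2 0 * Y 2 0 := by
  rw [mem_so21_iff] at hX hY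
  rw [hX, hY]
  simp [symPart, Matrix.trace, Fin.sum_univ_three, Matrix.mul_apply]
  ring

/-- By invariance the metrics need only be compared at the base point. There both are the Euclidean
product of the velocities `X e₀` and `Y e₀`, so the homothety factor is one. -/
theorem isHomothetic_lorentzPoly {τ : ℕ} (hτ : 2 ≤ τ) (he : Even τ) {p : V}
    (hp : p ∈ hyp₁ (lorentzPoly τ)) : IsHomotheticToSO21ModSO2 τ (lorentzPoly τ)
      (connectedComponentIn (hyp₁ (lorentzPoly τ)) p) := by
  have hu := hyp_lorentzPoly hτ he
  have hph := hyp₁_subset_hyp _ hp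
  rw [hu] at hph
  obtain ⟨ε, hε⟩ := Set.mem_iUnion.1 hph
  have hC : connectedComponentIn (hyp₁ (lorentzPoly τ)) p =
      {q : V | quadForm q = 1 ∧ 0 < (ε : ℝ) * q 0} := by
    rw [connectedComponentIn_hyp₁_eq (by omega) (isHomogeneous_lorentzPoly he) isOpen_timeCone
      (fun ε => (isConnected_timeCone ε).isPreconnected) disjoint_timeCone hu hp hε]
    ext q
    rw [Set.mem_inter_iff, mem_hyp₁_lorentzPoly hτ he]
    constructor
    · rintro ⟨h1, h2⟩
      exact ⟨h2, h1.2⟩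
    · rintro ⟨h1, h2⟩
      exact ⟨⟨by rw [h1]; exact one_pos, h2⟩, h1⟩
  rw [hC]
  refine ⟨1, orbitHomeo ε, one_pos, fun g x => ?_, fun g X hX Y hY => ?_⟩
  · induction x using QuotientGroup.induction_on with
    | H g' =>
      change (ε : ℝ) • act (g * g' : SO21p) e₀ = act g ((ε : ℝ) • act g' e₀)
      rw [Subgroup.coe_mul, act_mul]
      exact (Matrix.mulVec_smul _ _ _).symm
  · have hgO := (mem_SO21p_iff.1 g.2).1
    have hgA : (g : GL3) ∈ autGroup (lorentzPoly τ) := by rwa [autGroup_lorentzPoly hτ]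
    have hX' := conj_mem_so21 hgO hX
    have hY' := conj_mem_so21 hgO hY
    have e1 : ∀ Z : M3, Z *ᵥ ((ε : ℝ) • act g e₀) =
        act g ((ε : ℝ) • (((g : GL3)⁻¹.val * Z * g.1.val) *ᵥ e₀)) := by
      intro Z
      have : Z * g.1.val = g.1.val * ((g : GL3)⁻¹.val * Z * g.1.val) := by
        rw [← mul_assoc, ← mul_assoc, ← Units.val_mul, mul_inv_cancel, Units.val_one, one_mul]
      rw [act, act, Matrix.mulVec_smul, Matrix.mulVec_smul, Matrix.mulVec_mulVec,
        Matrix.mulVec_mulVec, this]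
    have e2 : (ε : ℝ) • act g e₀ = act g ((ε : ℝ) • e₀) := (Matrix.mulVec_smul _ _ _).symm
    have h0 : ∀ {Z : M3}, Z ∈ so21 → ((ε : ℝ) • (Z *ᵥ e₀)) 0 = 0 := by
      intro Z hZ
      rw [mem_so21_iff] at hZ
      rw [Pi.smul_apply, mulVec_e₀, hZ]
      simp
    rw [orbitHomeo_mk, e1 X, e1 Y, e2, metric_act τ hgA,
      metric_lorentzPoly hτ he ε (h0 hX') (h0 hY'), one_mul, symmetricMetric, Subgroup.coe_inv,
      half_trace_symPart hX' hY']
    simp only [Pi.smul_apply, mulVec_e₀, smul_eq_mul]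
    linear_combination (((g : GL3)⁻¹.val * X * g.1.val) 1 0 * ((g : GL3)⁻¹.val * Y * g.1.val) 1 0 +
      ((g : GL3)⁻¹.val * X * g.1.val) 2 0 * ((g : GL3)⁻¹.val * Y * g.1.val) 2 0) * units_cast_sq ε

theorem lorentz_case {τ : ℕ} (hτ : 3 ≤ τ) (he : Even τ) :
    Nat.card (ConnectedComponents (hyp₁ (lorentzPoly τ))) = 2 ∧
      (∀ p ∈ hyp₁ (lorentzPoly τ), IsHomotheticToSO21ModSO2 τ (lorentzPoly τ)
        (connectedComponentIn (hyp₁ (lorentzPoly τ)) p)) ∧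
      (∀ p ∈ hyp (lorentzPoly τ), lieDim (stab (lorentzPoly τ) p) = 1) ∧
      autGroup (lorentzPoly τ) = O21 := by
  refine ⟨?_, fun p hp => isHomothetic_lorentzPoly (by omega) he hp,
    fun p hp => lieDim_stab_lorentzPoly (by omega) he hp, autGroup_lorentzPoly (by omega)⟩
  rw [lorentzPoly_eq he, card_connectedComponents_affinePoly (by omega) (by omega),
    if_neg (Nat.not_odd_iff_even.2 he)]

/-! ### Signs and semidirect products -/

/-- The sign of a non-zero real number. -/
def signUnit (x : ℝ) : ℤˣ := if 0 < x then 1 else -1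

theorem signUnit_mul_self (x : ℝ) : (signUnit x : ℝ) * x = |x| := by
  unfold signUnit
  split_ifs with h
  · simp [abs_of_pos h]
  · simp [abs_of_nonpos (not_lt.1 h)]

theorem signUnit_eq_iff {x : ℝ} (hx : x ≠ 0) {ε : ℤˣ} : signUnit x = ε ↔ 0 < (ε : ℝ) * x := by
  have h : 0 < (signUnit x : ℝ) * x := by rw [signUnit_mul_self]; exact abs_pos.2 hx
  exact ⟨fun e => e ▸ h, fun h' => unit_eq_of_mul_pos h h'⟩

theorem signUnit_eq_one_iff {x : ℝ} (hx : x ≠ 0) : signUnit x = 1 ↔ 0 < x := by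
  rw [signUnit_eq_iff hx]; simp

theorem signUnit_mul {x y : ℝ} (hx : x ≠ 0) (hy : y ≠ 0) :
    signUnit (x * y) = signUnit x * signUnit y := by
  rw [signUnit_eq_iff (mul_ne_zero hx hy)]
  push_cast
  have := mul_pos ((signUnit_eq_iff hx).1 rfl) ((signUnit_eq_iff hy).1 rfl)
  linarith

theorem unit_cast_ne_zero (ε : ℤˣ) : (ε : ℝ) ≠ 0 := by
  intro h
  have := units_cast_sq ε
  rw [h] at this
  norm_num at this

theorem signUnit_unit_mul (ε : ℤˣ) {x : ℝ} (hx : 0 < x) : signUnit ((ε : ℝ) * x) = ε := by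
  rw [signUnit_eq_iff (mul_ne_zero (unit_cast_ne_zero ε) hx.ne'), ← mul_assoc, ← sq, units_cast_sq,
    one_mul]
  exact hx

theorem signUnit_unit (ε : ℤˣ) : signUnit (ε : ℝ) = ε := by
  simpa using signUnit_unit_mul ε one_pos

theorem signUnit_one : signUnit 1 = 1 := by simp [signUnit]

theorem continuous_signUnit {X : Type*} [TopologicalSpace X] {f : X → ℝ} (hf : Continuous f)
    (h0 : ∀ x, f x ≠ 0) : Continuous fun x => signUnit (f x) := by
  refine continuous_discrete_rng.2 fun ε => ?_
  have : (fun x => signUnit (f x)) ⁻¹' {ε} = {x | 0 < (ε : ℝ) * f x} := by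
    ext x
    exact signUnit_eq_iff (h0 x)
  rw [this]
  exact isOpen_lt continuous_const (hf.const_mul _)

theorem isSemidirect_of_section {G Q : Type} [Group G] [Group Q] {χ : G →* Q} {κ : Q →* G}
    (h : ∀ q, χ (κ q) = q)
    (hf : ∀ q, (∀ n ∈ χ.ker, κ q * n = n * κ q) → q = 1) : IsSemidirect χ.ker κ.range := by
  refine ⟨inferInstance, Subgroup.isComplement'_of_disjoint_and_mul_eq_univ ?_ ?_, ?_⟩
  · rw [Subgroup.disjoint_def]
    rintro _ hx ⟨q, rfl⟩
    rw [MonoidHom.mem_ker, h] at hx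
    rw [hx, map_one]
  · refine Set.eq_univ_of_forall fun x => Set.mem_mul.2
      ⟨x * (κ (χ x))⁻¹, ?_, κ (χ x), ⟨χ x, rfl⟩, by group⟩
    rw [SetLike.mem_coe, MonoidHom.mem_ker, map_mul, map_inv, h, mul_inv_cancel]
  · rintro _ ⟨q, rfl⟩ hq
    rw [hf q hq, map_one]

theorem nonempty_range_mulEquiv {G Q : Type} [Group G] [Group Q] {χ : G →* Q} {κ : Q →* G}
    (h : ∀ q, χ (κ q) = q) : Nonempty (κ.range ≃* Q) :=
  ⟨(MonoidHom.ofInjective (Function.LeftInverse.injective h)).symm⟩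

/-! ### Automorphisms of `(x + z)^(τ - 2k) (x² - y² - z²)^k` -/

section AffineAut

variable {τ k : ℕ}

/-- The factor by which an automorphism multiplies `x + z`. -/
def nullCoeff (A : autGroup (affinePoly τ k)) : ℝ := A.1.val 0 0 + A.1.val 2 0

/-- The coefficient of `y` in the second coordinate of an automorphism. -/
def midCoeff (A : autGroup (affinePoly τ k)) : ℝ := A.1.val 1 1

/-- The coefficient of `x + z` in the second coordinate of an automorphism. -/
def shearCoeff (A : autGroup (affinePoly τ k)) : ℝ := A.1.val 1 0

/-- The linear factor is preserved up to scale and cancels from the invariance identity; what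
remains preserves the quadratic form up to scale, and `eq_affMat` applies. -/
theorem autGroup_affinePoly_spec (hk : 1 ≤ k) (hkτ : 2 * k < τ) (A : autGroup (affinePoly τ k)) :
    nullCoeff A ≠ 0 ∧ midCoeff A ≠ 0 ∧
      nullCoeff A ^ (τ - 2 * k) * (midCoeff A ^ 2) ^ k = 1 ∧
      A.1.val = affMat (nullCoeff A) (midCoeff A) (shearCoeff A) := by
  have hA := det_ne_zero A.1
  have h : ∀ v, nullForm (A.1.val *ᵥ v) ^ (τ - 2 * k) * quadForm (A.1.val *ᵥ v) ^ k =
      nullForm v ^ (τ - 2 * k) * quadForm v ^ k := by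
    intro v
    have := A.2 v
    rwa [eval_affinePoly, eval_affinePoly] at this
  have hu := exists_nullForm_smul hA (by omega) h
  have hα : nullForm (A.1.val *ᵥ e₀) = nullCoeff A := by
    rw [nullForm, mulVec_e₀, mulVec_e₀]; rfl
  rw [hα] at hu
  have h1 := h e₀
  rw [hα, nullForm_e₀, quadForm_e₀, one_pow, one_pow, one_mul] at h1
  have hα0 : nullCoeff A ≠ 0 := by
    intro h0
    rw [h0, zero_pow (by omega), zero_mul] at h1
    exact zero_ne_one h1
  have hp : nullPoly ^ (τ - 2 * k) * (C (nullCoeff A ^ (τ - 2 * k)) * subst A.1.val quad ^ k) =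
      nullPoly ^ (τ - 2 * k) * quad ^ k := MvPolynomial.funext fun v => by
    have := h v
    rw [hu, mul_pow] at this
    simp only [map_mul, map_pow, eval_C, eval_nullPoly, eval_subst, eval_quad]
    linarith
  have hp' := mul_left_cancel₀ (pow_ne_zero _ nullPoly_ne_zero) hp
  obtain ⟨-, hq⟩ := exists_quadForm_smul hA (k := k) (by omega)
    (c := nullCoeff A ^ (τ - 2 * k)) fun v => by
      have := congrArg (eval v) hp'
      simpa only [map_mul, map_pow, eval_C, eval_subst, eval_quad] using this
  obtain ⟨e1, e2⟩ := eq_affMat hα0 hu hq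
  rw [← e2] at h1
  refine ⟨hα0, fun h0 => ?_, h1, e1⟩
  rw [show A.1.val 1 1 = 0 from h0, zero_pow two_ne_zero, zero_pow (by omega), mul_zero] at h1
  exact zero_ne_one h1

/-- The automorphism with given coefficients. -/
def affAut (α s γ : ℝ) (hα : α ≠ 0) (hs : s ≠ 0) (h : α ^ (τ - 2 * k) * (s ^ 2) ^ k = 1) :
    autGroup (affinePoly τ k) :=
  ⟨affGL α s γ hα hs, affGL_mem_autGroup hα hs h⟩

@[simp] theorem nullCoeff_affAut {α s γ : ℝ} (hα : α ≠ 0) (hs : s ≠ 0)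
    (h : α ^ (τ - 2 * k) * (s ^ 2) ^ k = 1) : nullCoeff (affAut α s γ hα hs h) = α := by
  simp [nullCoeff, affAut, affMat]; ring

@[simp] theorem midCoeff_affAut {α s γ : ℝ} (hα : α ≠ 0) (hs : s ≠ 0)
    (h : α ^ (τ - 2 * k) * (s ^ 2) ^ k = 1) : midCoeff (affAut α s γ hα hs h) = s := rfl

@[simp] theorem shearCoeff_affAut {α s γ : ℝ} (hα : α ≠ 0) (hs : s ≠ 0)
    (h : α ^ (τ - 2 * k) * (s ^ 2) ^ k = 1) : shearCoeff (affAut α s γ hα hs h) = γ := rfl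


theorem nullCoeff_ne_zero (hk : 1 ≤ k) (hkτ : 2 * k < τ) (A : autGroup (affinePoly τ k)) :
    nullCoeff A ≠ 0 := (autGroup_affinePoly_spec hk hkτ A).1

theorem midCoeff_ne_zero (hk : 1 ≤ k) (hkτ : 2 * k < τ) (A : autGroup (affinePoly τ k)) :
    midCoeff A ≠ 0 := (autGroup_affinePoly_spec hk hkτ A).2.1

theorem affine_ext (hk : 1 ≤ k) (hkτ : 2 * k < τ) {A B : autGroup (affinePoly τ k)}
    (h1 : nullCoeff A = nullCoeff B) (h2 : midCoeff A = midCoeff B)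
    (h3 : shearCoeff A = shearCoeff B) : A = B := by
  refine Subtype.ext (Units.ext ?_)
  rw [(autGroup_affinePoly_spec hk hkτ A).2.2.2, (autGroup_affinePoly_spec hk hkτ B).2.2.2, h1, h2,
    h3]

theorem affine_coeff_mul (hk : 1 ≤ k) (hkτ : 2 * k < τ) (A B : autGroup (affinePoly τ k)) :
    nullCoeff (A * B) = nullCoeff A * nullCoeff B ∧ midCoeff (A * B) = midCoeff A * midCoeff B ∧
      shearCoeff (A * B) = midCoeff A * shearCoeff B + shearCoeff A * nullCoeff B := by
  refine affMat_injective ?_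
  rw [← (autGroup_affinePoly_spec hk hkτ (A * B)).2.2.2,
    ← affMat_mul (nullCoeff_ne_zero hk hkτ A) (nullCoeff_ne_zero hk hkτ B),
    ← (autGroup_affinePoly_spec hk hkτ A).2.2.2, ← (autGroup_affinePoly_spec hk hkτ B).2.2.2]
  rfl

theorem affine_coeff_one :
    nullCoeff (1 : autGroup (affinePoly τ k)) = 1 ∧ midCoeff (1 : autGroup (affinePoly τ k)) = 1 ∧
      shearCoeff (1 : autGroup (affinePoly τ k)) = 0 := by
  simp [nullCoeff, midCoeff, shearCoeff]

theorem continuous_entry {S : Subgroup GL3} (i j : Fin 3) :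
    Continuous fun A : S => A.1.val i j :=
  (Units.continuous_val.comp continuous_subtype_val).matrix_elem i j

theorem continuous_nullCoeff : Continuous (nullCoeff (τ := τ) (k := k)) :=
  (continuous_entry 0 0).add (continuous_entry 2 0)

theorem continuous_midCoeff : Continuous (midCoeff (τ := τ) (k := k)) := continuous_entry 1 1

theorem continuous_shearCoeff : Continuous (shearCoeff (τ := τ) (k := k)) := continuous_entry 1 0

/-- The sign of `nullCoeff`. -/
def nullSign (hk : 1 ≤ k) (hkτ : 2 * k < τ) : autGroup (affinePoly τ k) →* ℤˣ where
  toFun A := signUnit (nullCoeff A)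
  map_one' := by rw [affine_coeff_one.1]; simp [signUnit]
  map_mul' A B := by
    rw [(affine_coeff_mul hk hkτ A B).1,
      signUnit_mul (nullCoeff_ne_zero hk hkτ A) (nullCoeff_ne_zero hk hkτ B)]

/-- The sign of `midCoeff`. -/
def midSign (hk : 1 ≤ k) (hkτ : 2 * k < τ) : autGroup (affinePoly τ k) →* ℤˣ where
  toFun A := signUnit (midCoeff A)
  map_one' := by rw [affine_coeff_one.2.1]; simp [signUnit]
  map_mul' A B := by
    rw [(affine_coeff_mul hk hkτ A B).2.1,
      signUnit_mul (midCoeff_ne_zero hk hkτ A) (midCoeff_ne_zero hk hkτ B)]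

theorem nullSign_apply (hk : 1 ≤ k) (hkτ : 2 * k < τ) (A : autGroup (affinePoly τ k)) :
    nullSign hk hkτ A = signUnit (nullCoeff A) := rfl

theorem midSign_apply (hk : 1 ≤ k) (hkτ : 2 * k < τ) (A : autGroup (affinePoly τ k)) :
    midSign hk hkτ A = signUnit (midCoeff A) := rfl

-- The identity component and the affine group.

theorem mem_ker_signs (hk : 1 ≤ k) (hkτ : 2 * k < τ) {A : autGroup (affinePoly τ k)} :
    A ∈ (nullSign hk hkτ).ker ⊓ (midSign hk hkτ).ker ↔ 0 < nullCoeff A ∧ 0 < midCoeff A := by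
  rw [Subgroup.mem_inf, MonoidHom.mem_ker, MonoidHom.mem_ker,
    ← signUnit_eq_one_iff (nullCoeff_ne_zero hk hkτ A),
    ← signUnit_eq_one_iff (midCoeff_ne_zero hk hkτ A)]
  rfl

/-- Here `t` is the logarithm of the ratio of `midCoeff` to `nullCoeff`; the relation between these
two then forces the logarithm of `nullCoeff` to be `-(2 * k / τ * t)`. -/
theorem exp_rel (hkτ : 2 * k < τ) (t : ℝ) :
    Real.exp (-(2 * k / τ * t)) ^ (τ - 2 * k) *
      ((Real.exp t * Real.exp (-(2 * k / τ * t))) ^ 2) ^ k = 1 := by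
  have hτ : (τ : ℝ) ≠ 0 := by
    have : τ ≠ 0 := by omega
    exact_mod_cast this
  have hc : ((τ - 2 * k : ℕ) : ℝ) = τ - 2 * k := by
    rw [Nat.cast_sub hkτ.le]; push_cast; rfl
  rw [← Real.exp_add, ← pow_mul, ← Real.exp_nat_mul, ← Real.exp_nat_mul, ← Real.exp_add,
    Real.exp_eq_one_iff, hc]
  push_cast
  field_simp
  ring

/-- A parametrisation of the identity component of the automorphism group. -/
def affParam (hkτ : 2 * k < τ) (x : ℝ × ℝ) : autGroup (affinePoly τ k) :=
  affAut (Real.exp (-(2 * k / τ * x.1))) (Real.exp x.1 * Real.exp (-(2 * k / τ * x.1)))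
    (x.2 * Real.exp (-(2 * k / τ * x.1))) (Real.exp_pos _).ne'
    (mul_pos (Real.exp_pos _) (Real.exp_pos _)).ne' (exp_rel hkτ x.1)

theorem continuous_affMat {X : Type*} [TopologicalSpace X] {f g h : X → ℝ} (hf : Continuous f)
    (hg : Continuous g) (hh : Continuous h) (h0 : ∀ x, f x ≠ 0) :
    Continuous fun x => affMat (f x) (g x) (h x) := by
  have h1 : Continuous fun x => (g x ^ 2 + h x ^ 2) / f x :=
    ((hg.pow 2).add (hh.pow 2)).div hf h0
  have h2 : Continuous fun x => (h x ^ 2 - g x ^ 2) / f x :=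
    ((hh.pow 2).sub (hg.pow 2)).div hf h0
  have h3 : Continuous fun x => g x * h x / f x := (hg.mul hh).div hf h0
  refine continuous_matrix fun i j => ?_
  fin_cases i <;> fin_cases j
  · exact (hf.add h1).div_const 2
  · exact h3
  · exact (hf.add h2).div_const 2
  · exact hh
  · exact hg
  · exact hh
  · exact (hf.sub h1).div_const 2
  · exact h3.neg
  · exact (hf.sub h2).div_const 2

theorem continuous_affParam (hkτ : 2 * k < τ) : Continuous (affParam (k := k) hkτ) := by
  refine Continuous.subtype_mk (continuous_GL_of_val ?_) _
  exact continuous_affMat (by fun_prop) (by fun_prop) (by fun_prop) fun x => (Real.exp_pos _).ne'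

theorem affParam_log (hk : 1 ≤ k) (hkτ : 2 * k < τ) {A : autGroup (affinePoly τ k)}
    (h1 : 0 < nullCoeff A) (h2 : 0 < midCoeff A) :
    affParam hkτ (Real.log (midCoeff A / nullCoeff A), shearCoeff A / nullCoeff A) = A := by
  have hτ : τ ≠ 0 := by omega
  have hτ' : (τ : ℝ) ≠ 0 := by exact_mod_cast hτ
  have hrel := (autGroup_affinePoly_spec hk hkτ A).2.2.1
  have hc : ((τ - 2 * k : ℕ) : ℝ) = τ - 2 * k := by
    rw [Nat.cast_sub hkτ.le]; push_cast; rfl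
  have hlog : (τ - 2 * k : ℝ) * Real.log (nullCoeff A) + 2 * k * Real.log (midCoeff A) = 0 := by
    have := congrArg Real.log hrel
    rw [← pow_mul, Real.log_mul (pow_ne_zero _ h1.ne') (pow_ne_zero _ h2.ne'), Real.log_pow,
      Real.log_pow, Real.log_one, hc] at this
    push_cast at this
    exact this
  have hα : Real.exp (-(2 * k / τ * Real.log (midCoeff A / nullCoeff A))) = nullCoeff A := by
    rw [← Real.exp_log h1, Real.exp_log h1, Real.log_div h2.ne' h1.ne']
    conv_rhs => rw [← Real.exp_log h1]
    congr 1
    field_simp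
    linear_combination -hlog
  refine affine_ext hk hkτ ?_ ?_ ?_
  · rw [affParam, nullCoeff_affAut, hα]
  · rw [affParam, midCoeff_affAut, hα, Real.exp_log (div_pos h2 h1), div_mul_cancel₀ _ h1.ne']
  · rw [affParam, shearCoeff_affAut, hα, div_mul_cancel₀ _ h1.ne']

/-- The signs of the two scale factors are continuous, so their common kernel is clopen; it is also
the continuous image of `ℝ × ℝ`. -/
theorem connectedComponentOfOne_affinePoly (hk : 1 ≤ k) (hkτ : 2 * k < τ) :
    Subgroup.connectedComponentOfOne (autGroup (affinePoly τ k)) =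
      (nullSign hk hkτ).ker ⊓ (midSign hk hkτ).ker := by
  refine SetLike.coe_injective (Set.Subset.antisymm ?_ ?_)
  · refine IsClopen.connectedComponent_subset ?_ (one_mem _)
    have e : (((nullSign hk hkτ).ker ⊓ (midSign hk hkτ).ker :
        Subgroup (autGroup (affinePoly τ k))) : Set (autGroup (affinePoly τ k))) =
        (fun A => signUnit (nullCoeff A)) ⁻¹' {1} ∩ (fun A => signUnit (midCoeff A)) ⁻¹' {1} := rfl
    rw [e]
    exact ((isClopen_discrete _).preimage (continuous_signUnit continuous_nullCoeff
      (nullCoeff_ne_zero hk hkτ))).inter ((isClopen_discrete _).preimage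
      (continuous_signUnit continuous_midCoeff (midCoeff_ne_zero hk hkτ)))
  · intro A hA
    have hmem := (mem_ker_signs hk hkτ).1 hA
    refine (isPreconnected_range (continuous_affParam (k := k) hkτ)).subset_connectedComponent
      ?_ ⟨_, affParam_log hk hkτ hmem.1 hmem.2⟩
    refine ⟨_, affParam_log hk hkτ (A := 1) ?_ ?_⟩
    · rw [affine_coeff_one.1]; exact one_pos
    · rw [affine_coeff_one.2.1]; exact one_pos

theorem affineMatrix_det_ne_zero {a : ℝ} (ha : 0 < a) (b : ℝ) :
    (!![a, b; 0, 1] : Matrix (Fin 2) (Fin 2) ℝ).det ≠ 0 := by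
  simp [Matrix.det_fin_two, ha.ne']

/-- The element `t ↦ a t + b` of the affine group. -/
def affineElem (a b : ℝ) (ha : 0 < a) : affineGroup :=
  ⟨Matrix.GeneralLinearGroup.mkOfDetNeZero !![a, b; 0, 1] (affineMatrix_det_ne_zero ha b),
    a, b, ha, rfl⟩

theorem affineGroup_spec (M : affineGroup) : 0 < M.1.val 0 0 ∧
    M.1.val = !![M.1.val 0 0, M.1.val 0 1; 0, 1] := by
  obtain ⟨a, b, ha, h⟩ := M.2
  rw [h]
  simp [ha]

/-- The identity component of the automorphism group is the affine group. -/
def affineEquiv (hk : 1 ≤ k) (hkτ : 2 * k < τ) :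
    ((nullSign hk hkτ).ker ⊓ (midSign hk hkτ).ker :
      Subgroup (autGroup (affinePoly τ k))) ≃ₜ* affineGroup where
  -- This is the action on the quotient `y / (x + z)`, which automorphisms transform by affine maps.
  toFun A := affineElem (midCoeff A.1 / nullCoeff A.1) (shearCoeff A.1 / nullCoeff A.1)
    (div_pos ((mem_ker_signs hk hkτ).1 A.2).2 ((mem_ker_signs hk hkτ).1 A.2).1)
  invFun M := ⟨affParam hkτ (Real.log (M.1.val 0 0), M.1.val 0 1), (mem_ker_signs hk hkτ).2 (by
    rw [affParam, nullCoeff_affAut, midCoeff_affAut]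
    exact ⟨Real.exp_pos _, mul_pos (Real.exp_pos _) (Real.exp_pos _)⟩)⟩
  left_inv A := by
    have h := (mem_ker_signs hk hkτ).1 A.2
    exact Subtype.ext (affParam_log hk hkτ h.1 h.2)
  right_inv M := by
    obtain ⟨h0, hM⟩ := affineGroup_spec M
    refine Subtype.ext (Units.ext ?_)
    rw [hM]
    change !![midCoeff (affParam hkτ _) / nullCoeff (affParam hkτ _),
      shearCoeff (affParam hkτ _) / nullCoeff (affParam hkτ _); 0, 1] = _
    simp only [affParam, nullCoeff_affAut, midCoeff_affAut, shearCoeff_affAut]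
    rw [mul_div_cancel_right₀ _ (Real.exp_pos _).ne', mul_div_cancel_right₀ _ (Real.exp_pos _).ne',
      Real.exp_log h0]
  map_mul' A B := by
    have hA := ((mem_ker_signs hk hkτ).1 A.2).1.ne'
    have hB := ((mem_ker_signs hk hkτ).1 B.2).1.ne'
    obtain ⟨h1, h2, h3⟩ := affine_coeff_mul hk hkτ A.1 B.1
    refine Subtype.ext (Units.ext ?_)
    change !![midCoeff (A.1 * B.1) / nullCoeff (A.1 * B.1),
      shearCoeff (A.1 * B.1) / nullCoeff (A.1 * B.1); 0, 1] =
      !![midCoeff A.1 / nullCoeff A.1, shearCoeff A.1 / nullCoeff A.1; 0, 1] *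
      !![midCoeff B.1 / nullCoeff B.1, shearCoeff B.1 / nullCoeff B.1; 0, 1]
    rw [h1, h2, h3]
    ext i j
    fin_cases i <;> fin_cases j <;> simp <;> field_simp
  continuous_toFun := by
    refine Continuous.subtype_mk (continuous_GL_of_val ?_) _
    have h0 : ∀ A : ((nullSign hk hkτ).ker ⊓ (midSign hk hkτ).ker :
        Subgroup (autGroup (affinePoly τ k))), nullCoeff A.1 ≠ 0 :=
      fun A => nullCoeff_ne_zero hk hkτ A.1
    have hn := continuous_nullCoeff.comp (continuous_subtype_val
      (p := (· ∈ (nullSign hk hkτ).ker ⊓ (midSign hk hkτ).ker)))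
    refine continuous_matrix fun i j => ?_
    fin_cases i <;> fin_cases j
    · exact (continuous_midCoeff.comp continuous_subtype_val).div hn h0
    · exact (continuous_shearCoeff.comp continuous_subtype_val).div hn h0
    · exact continuous_const
    · exact continuous_const
  continuous_invFun := by
    have hc : ∀ i j, Continuous fun M : affineGroup => M.1.val i j := fun i j =>
      (Units.continuous_val.comp continuous_subtype_val).matrix_elem i j
    exact Continuous.subtype_mk ((continuous_affParam hkτ).comp
      (((hc 0 0).log fun M => (affineGroup_spec M).1.ne').prodMk (hc 0 1))) _

-- Reflections, scalars and the remaining components.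

/-- The reflections `y ↦ ±y`. -/
def reflectionHom (hk : 1 ≤ k) (hkτ : 2 * k < τ) : ℤˣ →* autGroup (affinePoly τ k) where
  toFun ε := affAut 1 ε 0 one_ne_zero (unit_cast_ne_zero ε) (by rw [units_cast_sq]; simp)
  map_one' := affine_ext hk hkτ (by simp [affine_coeff_one]) (by simp [affine_coeff_one])
    (by simp [affine_coeff_one])
  map_mul' ε δ := by
    refine affine_ext hk hkτ ?_ ?_ ?_
    · rw [(affine_coeff_mul hk hkτ _ _).1]; simp
    · rw [(affine_coeff_mul hk hkτ _ _).2.1]; simp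
    · rw [(affine_coeff_mul hk hkτ _ _).2.2]; simp

/-- The reflections are a section of the product of the two signs. The action is faithful because
the nontrivial reflection does not commute with a shear. -/
theorem isSemidirect_ker_signs (hk : 1 ≤ k) (hkτ : 2 * k < τ) :
    IsSemidirect (nullSign hk hkτ * midSign hk hkτ).ker (reflectionHom hk hkτ).range ∧
      Nonempty ((reflectionHom hk hkτ).range ≃* ℤˣ) := by
  have h : ∀ ε, (nullSign hk hkτ * midSign hk hkτ) (reflectionHom hk hkτ ε) = ε := by
    intro ε
    rw [MonoidHom.mul_apply, nullSign_apply, midSign_apply, reflectionHom, MonoidHom.coe_mk,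
      OneHom.coe_mk, nullCoeff_affAut, midCoeff_affAut, signUnit_unit, signUnit_one, one_mul]
  refine ⟨isSemidirect_of_section h fun ε hε => ?_, nonempty_range_mulEquiv h⟩
  have h1 := hε (affAut 1 1 1 one_ne_zero one_ne_zero (by simp)) (by
    rw [MonoidHom.mem_ker, MonoidHom.mul_apply, nullSign_apply, midSign_apply, nullCoeff_affAut,
      midCoeff_affAut, signUnit_one, one_mul])
  have h2 := congrArg shearCoeff h1
  rw [(affine_coeff_mul hk hkτ _ _).2.2, (affine_coeff_mul hk hkτ _ _).2.2] at h2
  simp [reflectionHom] at h2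
  exact Units.ext (by exact_mod_cast h2)

/-- The scalars `±1`, which are automorphisms in even degree. -/
def scalarHom (hk : 1 ≤ k) (hkτ : 2 * k < τ) (he : Even τ) :
    ℤˣ →* autGroup (affinePoly τ k) where
  toFun ε := affAut ε ε 0 (unit_cast_ne_zero ε) (unit_cast_ne_zero ε) (by
    obtain ⟨m, hm⟩ := he.tsub (even_two_mul k)
    rw [units_cast_sq, one_pow, mul_one, hm, ← two_mul, pow_mul, units_cast_sq, one_pow])
  map_one' := affine_ext hk hkτ (by simp [affine_coeff_one]) (by simp [affine_coeff_one])
    (by simp [affine_coeff_one])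
  map_mul' ε δ := by
    refine affine_ext hk hkτ ?_ ?_ ?_
    · rw [(affine_coeff_mul hk hkτ _ _).1]; simp
    · rw [(affine_coeff_mul hk hkτ _ _).2.1]; simp
    · rw [(affine_coeff_mul hk hkτ _ _).2.2]; simp

theorem nullSign_scalarHom (hk : 1 ≤ k) (hkτ : 2 * k < τ) (he : Even τ) (ε : ℤˣ) :
    nullSign hk hkτ (scalarHom hk hkτ he ε) = ε := by
  rw [nullSign_apply, scalarHom, MonoidHom.coe_mk, OneHom.coe_mk, nullCoeff_affAut, signUnit_unit]

theorem midSign_scalarHom (hk : 1 ≤ k) (hkτ : 2 * k < τ) (he : Even τ) (ε : ℤˣ) :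
    midSign hk hkτ (scalarHom hk hkτ he ε) = ε := by
  rw [midSign_apply, scalarHom, MonoidHom.coe_mk, OneHom.coe_mk, midCoeff_affAut, signUnit_unit]

theorem scalarHom_comm (hk : 1 ≤ k) (hkτ : 2 * k < τ) (he : Even τ) (ε : ℤˣ)
    (A : autGroup (affinePoly τ k)) : scalarHom hk hkτ he ε * A = A * scalarHom hk hkτ he ε := by
  have e1 : nullCoeff (scalarHom hk hkτ he ε) = ε := by
    rw [scalarHom, MonoidHom.coe_mk, OneHom.coe_mk, nullCoeff_affAut]
  have e2 : midCoeff (scalarHom hk hkτ he ε) = ε := rfl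
  have e3 : shearCoeff (scalarHom hk hkτ he ε) = 0 := rfl
  refine affine_ext hk hkτ ?_ ?_ ?_
  · rw [(affine_coeff_mul hk hkτ _ _).1, (affine_coeff_mul hk hkτ _ _).1, mul_comm]
  · rw [(affine_coeff_mul hk hkτ _ _).2.1, (affine_coeff_mul hk hkτ _ _).2.1, mul_comm]
  · rw [(affine_coeff_mul hk hkτ _ _).2.2, (affine_coeff_mul hk hkτ _ _).2.2, e1, e2, e3]
    ring

theorem mul_scalarHom_mem_inf (hk : 1 ≤ k) (hkτ : 2 * k < τ) (he : Even τ)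
    {A : autGroup (affinePoly τ k)} (hA : A ∈ (nullSign hk hkτ * midSign hk hkτ).ker) :
    A * scalarHom hk hkτ he (nullSign hk hkτ A) ∈
      (nullSign hk hkτ).ker ⊓ (midSign hk hkτ).ker := by
  rw [MonoidHom.mem_ker, MonoidHom.mul_apply] at hA
  rw [Subgroup.mem_inf, MonoidHom.mem_ker, MonoidHom.mem_ker, map_mul, map_mul,
    nullSign_scalarHom, midSign_scalarHom, Int.units_mul_self, mul_comm]
  exact ⟨rfl, hA⟩

theorem mul_scalarHom_mem_ker (hk : 1 ≤ k) (hkτ : 2 * k < τ) (he : Even τ)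
    {B : autGroup (affinePoly τ k)} (hB : B ∈ (nullSign hk hkτ).ker ⊓ (midSign hk hkτ).ker)
    (ε : ℤˣ) : B * scalarHom hk hkτ he ε ∈ (nullSign hk hkτ * midSign hk hkτ).ker := by
  obtain ⟨h1, h2⟩ := Subgroup.mem_inf.1 hB
  rw [MonoidHom.mem_ker] at h1 h2
  rw [MonoidHom.mem_ker, MonoidHom.mul_apply, map_mul, map_mul, h1, h2, nullSign_scalarHom,
    midSign_scalarHom, one_mul, Int.units_mul_self]

/-- In even degree, the automorphisms preserving the sign of `nullCoeff * midCoeff` are the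
product of the identity component and the scalars `±1`. -/
def evenEquiv (hk : 1 ≤ k) (hkτ : 2 * k < τ) (he : Even τ) :
    (nullSign hk hkτ * midSign hk hkτ).ker ≃ₜ*
      ((nullSign hk hkτ).ker ⊓ (midSign hk hkτ).ker :
        Subgroup (autGroup (affinePoly τ k))) × ℤˣ where
  toFun A := (⟨A.1 * scalarHom hk hkτ he (nullSign hk hkτ A.1),
    mul_scalarHom_mem_inf hk hkτ he A.2⟩, nullSign hk hkτ A.1)
  invFun B := ⟨B.1.1 * scalarHom hk hkτ he B.2, mul_scalarHom_mem_ker hk hkτ he B.1.2 B.2⟩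
  left_inv A := Subtype.ext (by
    change A.1 * scalarHom hk hkτ he _ * scalarHom hk hkτ he _ = A.1
    rw [mul_assoc, ← map_mul, Int.units_mul_self, map_one, mul_one])
  right_inv B := by
    obtain ⟨h1, h2⟩ := Subgroup.mem_inf.1 B.1.2
    rw [MonoidHom.mem_ker] at h1 h2
    have h : nullSign hk hkτ (B.1.1 * scalarHom hk hkτ he B.2) = B.2 := by
      rw [map_mul, h1, nullSign_scalarHom, one_mul]
    refine Prod.ext (Subtype.ext ?_) h
    change B.1.1 * scalarHom hk hkτ he B.2 * scalarHom hk hkτ he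
      (nullSign hk hkτ (B.1.1 * scalarHom hk hkτ he B.2)) = B.1.1
    rw [h, mul_assoc, ← map_mul, Int.units_mul_self, map_one, mul_one]
  map_mul' A B := by
    refine Prod.ext (Subtype.ext ?_) (map_mul (nullSign hk hkτ) A.1 B.1)
    change A.1 * B.1 * scalarHom hk hkτ he (nullSign hk hkτ (A.1 * B.1)) =
      A.1 * scalarHom hk hkτ he (nullSign hk hkτ A.1) *
        (B.1 * scalarHom hk hkτ he (nullSign hk hkτ B.1))
    rw [map_mul, map_mul, mul_assoc A.1 (scalarHom hk hkτ he _), ← mul_assoc _ B.1,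
      scalarHom_comm hk hkτ he (nullSign hk hkτ A.1) B.1, mul_assoc B.1, ← mul_assoc A.1]
  continuous_toFun := by
    have h1 : Continuous fun A : (nullSign hk hkτ * midSign hk hkτ).ker => nullSign hk hkτ A.1 :=
      continuous_signUnit (continuous_nullCoeff.comp continuous_subtype_val)
        fun A => nullCoeff_ne_zero hk hkτ A.1
    exact (Continuous.subtype_mk (continuous_subtype_val.mul
      ((continuous_of_discreteTopology (f := scalarHom hk hkτ he)).comp h1)) _).prodMk h1
  continuous_invFun := Continuous.subtype_mk ((continuous_subtype_val.comp continuous_fst).mul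
    ((continuous_of_discreteTopology (f := scalarHom hk hkτ he)).comp continuous_snd)) _

/-- In odd degree the exponent of `x + z` is odd, so the relation between the scale factors forces
`nullCoeff` to be positive. -/
theorem ker_signs_odd (hk : 1 ≤ k) (hkτ : 2 * k < τ) (ho : Odd τ) :
    (nullSign hk hkτ * midSign hk hkτ).ker = (nullSign hk hkτ).ker ⊓ (midSign hk hkτ).ker := by
  have hn : Odd (τ - 2 * k) := Nat.Odd.sub_even hkτ.le ho (even_two_mul k)
  ext A
  have h1 : nullSign hk hkτ A = 1 := by
    rw [nullSign_apply, signUnit_eq_one_iff (nullCoeff_ne_zero hk hkτ A), ← hn.pow_pos_iff]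
    obtain ⟨-, h2, h3, -⟩ := autGroup_affinePoly_spec hk hkτ A
    have h4 : 0 < (midCoeff A ^ 2) ^ k := by positivity
    exact (pos_iff_pos_of_mul_pos (by rw [h3]; exact one_pos)).2 h4
  rw [Subgroup.mem_inf, MonoidHom.mem_ker, MonoidHom.mem_ker, MonoidHom.mem_ker,
    MonoidHom.mul_apply, h1, one_mul]
  simp

/-- The stabiliser of a hyperbolic point consists of the identity and a reflection. -/
def stabHom (hk : 1 ≤ k) (hkτ : 2 * k < τ) {p : V} (hu : nullForm p ≠ 0) :
    ℤˣ →* stab (affinePoly τ k) p where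
  -- The shear compensates the change of sign in the second coordinate of `p`.
  toFun ε := ⟨(affAut 1 ε ((1 - ε) * p 1 / nullForm p) one_ne_zero (unit_cast_ne_zero ε)
      (by rw [units_cast_sq]; simp) : autGroup (affinePoly τ k)).1, Subtype.prop _, by
    refine eq_of_nullForm_quadForm hu ?_ ?_ ?_
    · exact (nullForm_affMat _ _ _ _).trans (one_mul _)
    · refine (affMat_mulVec_one _ _ _ _).trans ?_
      field_simp; ring
    · refine (quadForm_affMat one_ne_zero _ _ _).trans ?_
      rw [units_cast_sq, one_mul]⟩
  map_one' := Subtype.ext (congrArg Subtype.val (a₂ := (1 : autGroup (affinePoly τ k)))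
    (affine_ext hk hkτ (by simp [affine_coeff_one]) (by simp [affine_coeff_one])
    (by simp [affine_coeff_one])))
  map_mul' ε δ := by
    refine Subtype.ext (congrArg Subtype.val (a₂ := (affAut 1 (ε : ℝ) ((1 - ε) * p 1 / nullForm p)
      one_ne_zero (unit_cast_ne_zero ε) (by rw [units_cast_sq]; simp) *
      affAut 1 (δ : ℝ) ((1 - δ) * p 1 / nullForm p)
      one_ne_zero (unit_cast_ne_zero δ) (by rw [units_cast_sq]; simp) :
        autGroup (affinePoly τ k))) (affine_ext hk hkτ ?_ ?_ ?_))
    · rw [(affine_coeff_mul hk hkτ _ _).1]; simp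
    · rw [(affine_coeff_mul hk hkτ _ _).2.1]; simp
    · rw [(affine_coeff_mul hk hkτ _ _).2.2]; simp; field_simp; ring

theorem bijective_stabHom (hk : 1 ≤ k) (hkτ : 2 * k < τ) {p : V} (hu : nullForm p ≠ 0)
    (hq : quadForm p ≠ 0) : Function.Bijective (stabHom hk hkτ hu) := by
  constructor
  · intro ε δ h
    have h1 : (ε : ℝ) = δ := congrFun (congrFun (congrArg (fun A => A.1.val) h) 1) 1
    exact Units.ext (by exact_mod_cast h1)
  · intro A
    obtain ⟨hα, hs, -, hA⟩ := autGroup_affinePoly_spec hk hkτ ⟨A.1, A.2.1⟩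
    set B : autGroup (affinePoly τ k) := ⟨A.1, A.2.1⟩ with hB
    have hp : affMat (nullCoeff B) (midCoeff B) (shearCoeff B) *ᵥ p = p := by
      rw [← hA]; exact A.2.2
    have h1 : nullCoeff B = 1 := by
      have := nullForm_affMat (nullCoeff B) (midCoeff B) (shearCoeff B) p
      rw [hp] at this
      exact mul_right_cancel₀ hu (by linarith)
    have h2 : midCoeff B ^ 2 = 1 := by
      have := quadForm_affMat hα (midCoeff B) (shearCoeff B) p
      rw [hp] at this
      exact mul_right_cancel₀ hq (by linarith)
    obtain ⟨ε, hε⟩ : ∃ ε : ℤˣ, midCoeff B = ε := by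
      rcases sq_eq_one_iff.1 h2 with h | h
      · exact ⟨1, by simp [h]⟩
      · exact ⟨-1, by simp [h]⟩
    have h3 : shearCoeff B = (1 - ε) * p 1 / nullForm p := by
      have := affMat_mulVec_one (nullCoeff B) (midCoeff B) (shearCoeff B) p
      rw [hp, hε] at this
      field_simp
      linarith
    refine ⟨ε, Subtype.ext (congrArg Subtype.val (a₂ := B) (affine_ext hk hkτ ?_ ?_ ?_))⟩
    · rw [nullCoeff_affAut, h1]
    · rw [midCoeff_affAut, hε]
    · rw [shearCoeff_affAut, h3]

end AffineAut

theorem affine_case {τ k : ℕ} (hk : 1 ≤ k) (hkτ : 2 * k < τ) :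
    Nat.card (ConnectedComponents (hyp₁ (affinePoly τ k))) = (if Odd τ then 1 else 2) ∧
      Nonempty (Subgroup.connectedComponentOfOne (autGroup (affinePoly τ k)) ≃ₜ* affineGroup) ∧
      (Odd τ → ∃ K : Subgroup (autGroup (affinePoly τ k)), Nonempty (K ≃* Z₂) ∧
        IsSemidirect (Subgroup.connectedComponentOfOne (autGroup (affinePoly τ k))) K) ∧
      (Even τ → ∃ N K : Subgroup (autGroup (affinePoly τ k)),
        Nonempty (N ≃ₜ* Subgroup.connectedComponentOfOne (autGroup (affinePoly τ k)) × Z₂) ∧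
        Nonempty (K ≃* Z₂) ∧ IsSemidirect N K) ∧
      ∀ p ∈ hyp (affinePoly τ k), Nonempty (stab (affinePoly τ k) p ≃* Z₂) := by
  rw [connectedComponentOfOne_affinePoly hk hkτ]
  obtain ⟨h1, h2⟩ := isSemidirect_ker_signs hk hkτ
  refine ⟨card_connectedComponents_affinePoly hk hkτ.le, ⟨affineEquiv hk hkτ⟩,
    fun ho => ⟨_, h2, ker_signs_odd hk hkτ ho ▸ h1⟩,
    fun he => ⟨_, _, ⟨evenEquiv hk hkτ he⟩, h2, h1⟩, fun p hp => ?_⟩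
  have hq := ((mem_hyp_affinePoly hk).1 hp).1
  exact ⟨(MulEquiv.ofBijective _ (bijective_stabHom hk hkτ
    (nullForm_ne_zero_of_quadForm_pos hq) hq.ne')).symm⟩

/-! ### Monomial matrices -/

/-- The monomial matrix that maps the `j`-th basis vector to `d j` times the `σ j`-th one. -/
def monoMat (σ : Equiv.Perm (Fin 3)) (d : V) : M3 := Matrix.of fun i j => if i = σ j then d j else 0

theorem monoMat_mulVec (σ : Equiv.Perm (Fin 3)) (d v : V) (j : Fin 3) :
    (monoMat σ d *ᵥ v) (σ j) = d j * v j := by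
  simp [monoMat, Matrix.mulVec, dotProduct]

theorem monoMat_mul (σ ρ : Equiv.Perm (Fin 3)) (d e : V) :
    monoMat σ d * monoMat ρ e = monoMat (σ * ρ) fun j => d (ρ j) * e j := by
  ext i j
  simp only [monoMat, Matrix.mul_apply, Matrix.of_apply, Equiv.Perm.mul_apply]
  rw [Finset.sum_eq_single (ρ j)]
  · by_cases h : i = σ (ρ j) <;> simp [h]
  · intro l _ hl
    rw [if_neg hl, mul_zero]
  · simp

theorem monoMat_one : monoMat 1 1 = 1 := by
  ext i j
  by_cases h : i = j <;> simp [monoMat, Matrix.one_apply, h]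

theorem monoMat_diag (σ : Equiv.Perm (Fin 3)) (d : V) (j : Fin 3) : monoMat σ d (σ j) j = d j := by
  simp [monoMat]

theorem perm_eq_of_monoMat_eq {σ ρ : Equiv.Perm (Fin 3)} {d e : V} (hd : ∀ j, d j ≠ 0)
    (h : monoMat σ d = monoMat ρ e) : σ = ρ := by
  refine Equiv.ext fun j => ?_
  by_contra hne
  have h1 := monoMat_diag σ d j
  rw [h, monoMat, Matrix.of_apply, if_neg hne] at h1
  exact hd j h1.symm

/-- A monomial matrix as an element of `GL(3, ℝ)`. -/
def monoGL (σ : Equiv.Perm (Fin 3)) (d : V) (hd : ∀ j, d j ≠ 0) : GL3 where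
  val := monoMat σ d
  inv := monoMat σ⁻¹ fun j => (d (σ⁻¹ j))⁻¹
  val_inv := by
    rw [monoMat_mul, mul_inv_cancel, ← monoMat_one]
    congr 1
    funext j
    exact mul_inv_cancel₀ (hd _)
  inv_val := by
    rw [monoMat_mul, inv_mul_cancel, ← monoMat_one]
    congr 1
    funext j
    rw [show σ⁻¹ (σ j) = j from σ.symm_apply_apply j]
    exact inv_mul_cancel₀ (hd _)

/-- The permutations that preserve the exponents `m`. -/
def stabPerm (m : Fin 3 → ℕ) : Subgroup (Equiv.Perm (Fin 3)) where
  carrier := {σ | ∀ j, m (σ j) = m j}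
  one_mem' := fun j => rfl
  mul_mem' := fun {σ ρ} hσ hρ j => (hσ (ρ j)).trans (hρ j)
  inv_mem' := fun {σ} hσ j => by
    have h := hσ (σ⁻¹ j)
    rw [show σ (σ⁻¹ j) = j from σ.apply_symm_apply j] at h
    exact h.symm

theorem mem_stabPerm {m : Fin 3 → ℕ} {σ : Equiv.Perm (Fin 3)} :
    σ ∈ stabPerm m ↔ ∀ j, m (σ j) = m j := Iff.rfl

section FlatAut

variable {a b c : ℕ}

theorem monoGL_mem_autGroup {σ : Equiv.Perm (Fin 3)} (hσ : σ ∈ stabPerm ![a, b, c]) {d : V}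
    (hd : ∀ j, d j ≠ 0) (h1 : ∏ j, d j ^ (![a, b, c] : Fin 3 → ℕ) j = 1) :
    monoGL σ d hd ∈ autGroup (flatPoly a b c) := by
  intro v
  rw [eval_flatPoly, eval_flatPoly, ← Equiv.prod_comp σ]
  have : ∀ j, act (monoGL σ d hd) v (σ j) = d j * v j := fun j => monoMat_mulVec σ d v j
  simp only [this, mem_stabPerm.1 hσ, mul_pow, Finset.prod_mul_distrib, h1, one_mul]

theorem autGroup_flatPoly_spec (hm : ∀ i : Fin 3, (![a, b, c] : Fin 3 → ℕ) i ≠ 0)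
    (A : autGroup (flatPoly a b c)) : ∃ (σ : Equiv.Perm (Fin 3)) (d : V),
      σ ∈ stabPerm ![a, b, c] ∧ (∀ j, d j ≠ 0) ∧ A.1.val = monoMat σ d ∧
      ∏ j, d j ^ (![a, b, c] : Fin 3 → ℕ) j = 1 := by
  obtain ⟨σ, d, h1, h2, h3⟩ := exists_perm_of_flat (det_ne_zero A.1) hm fun v => by
    rw [← eval_flatPoly, ← eval_flatPoly]
    exact A.2 v
  refine ⟨σ, d, h2, fun j h0 => ?_, by ext i j; exact h1 i j, h3⟩
  rw [Finset.prod_eq_zero (Finset.mem_univ j) (by rw [h0]; exact zero_pow (hm j))] at h3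
  exact zero_ne_one h3

theorem third_ne_zero (hm : ∀ i : Fin 3, (![a, b, c] : Fin 3 → ℕ) i ≠ 0) : c ≠ 0 := hm 2

/-- The permutation of the coordinate axes induced by an automorphism. -/
def flatPerm (hm : ∀ i : Fin 3, (![a, b, c] : Fin 3 → ℕ) i ≠ 0) :
    autGroup (flatPoly a b c) →* stabPerm ![a, b, c] where
  -- The positions of the nonzero entries determine the permutation, so the choice is unique and
  -- hence multiplicative.
  toFun A := ⟨(autGroup_flatPoly_spec hm A).choose,
    (autGroup_flatPoly_spec hm A).choose_spec.choose_spec.1⟩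
  map_one' := by
    obtain ⟨-, h1, h2, -⟩ := (autGroup_flatPoly_spec hm 1).choose_spec.choose_spec
    refine Subtype.ext (perm_eq_of_monoMat_eq h1 (h2.symm.trans monoMat_one.symm))
  map_mul' A B := by
    obtain ⟨-, h1, h2, -⟩ := (autGroup_flatPoly_spec hm (A * B)).choose_spec.choose_spec
    obtain ⟨-, -, h3, -⟩ := (autGroup_flatPoly_spec hm A).choose_spec.choose_spec
    obtain ⟨-, -, h4, -⟩ := (autGroup_flatPoly_spec hm B).choose_spec.choose_spec
    have h5 := (congrArg₂ (· * ·) h3 h4).trans (monoMat_mul _ _ _ _)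
    exact Subtype.ext (perm_eq_of_monoMat_eq h1 (h2.symm.trans h5))

theorem flatPerm_eq (hm : ∀ i : Fin 3, (![a, b, c] : Fin 3 → ℕ) i ≠ 0) {A : autGroup (flatPoly a b c)}
    {σ : stabPerm ![a, b, c]} {d : V} (h : A.1.val = monoMat σ d) : flatPerm hm A = σ := by
  obtain ⟨-, h1, h2, -⟩ := (autGroup_flatPoly_spec hm A).choose_spec.choose_spec
  exact Subtype.ext (perm_eq_of_monoMat_eq h1 (h2.symm.trans h))

theorem flatPerm_ker_spec (hm : ∀ i : Fin 3, (![a, b, c] : Fin 3 → ℕ) i ≠ 0)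
    (A : (flatPerm hm).ker) : (∀ j, A.1.1.val j j ≠ 0) ∧
      A.1.1.val = monoMat 1 (fun j => A.1.1.val j j) ∧
      ∏ j, A.1.1.val j j ^ (![a, b, c] : Fin 3 → ℕ) j = 1 := by
  obtain ⟨σ, d, h0, h1, h2, h3⟩ := autGroup_flatPoly_spec hm A.1
  have hσ : (⟨σ, h0⟩ : stabPerm ![a, b, c]) = 1 := (flatPerm_eq hm h2).symm.trans A.2
  have hσ1 : σ = 1 := congrArg Subtype.val hσ
  subst hσ1
  have hd : ∀ j, A.1.1.val j j = d j := fun j => by rw [h2]; exact monoMat_diag 1 d j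
  simp only [hd]
  exact ⟨h1, h2, h3⟩

/-- The permutation matrices among the automorphisms. -/
def permHom : stabPerm ![a, b, c] →* autGroup (flatPoly a b c) where
  toFun σ := ⟨monoGL σ 1 fun _ => one_ne_zero, monoGL_mem_autGroup σ.2 _ (by simp)⟩
  map_one' := Subtype.ext (Units.ext monoMat_one)
  map_mul' σ ρ := Subtype.ext (Units.ext ((by
    rw [monoMat_mul]
    congr 1
    funext j
    simp : monoMat σ 1 * monoMat ρ 1 = monoMat (σ * ρ) 1)).symm)

theorem flatPerm_permHom (hm : ∀ i : Fin 3, (![a, b, c] : Fin 3 → ℕ) i ≠ 0) (σ : stabPerm ![a, b, c]) :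
    flatPerm hm (permHom σ) = σ := flatPerm_eq (d := 1) hm rfl

-- Diagonal automorphisms of a monomial.

/-- The diagonal automorphism with given non-zero diagonal entries. -/
def diagAut (hm : ∀ i : Fin 3, (![a, b, c] : Fin 3 → ℕ) i ≠ 0) (d : V) (hd : ∀ j, d j ≠ 0)
    (h1 : ∏ j, d j ^ (![a, b, c] : Fin 3 → ℕ) j = 1) : (flatPerm hm).ker :=
  ⟨⟨monoGL 1 d hd, monoGL_mem_autGroup (one_mem _) hd h1⟩,
    flatPerm_eq (σ := 1) (d := d) hm rfl⟩

theorem diagAut_apply (hm : ∀ i : Fin 3, (![a, b, c] : Fin 3 → ℕ) i ≠ 0) {d : V} (hd : ∀ j, d j ≠ 0)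
    (h1 : ∏ j, d j ^ (![a, b, c] : Fin 3 → ℕ) j = 1) (j : Fin 3) :
    (diagAut hm d hd h1).1.1.val j j = d j := monoMat_diag 1 d j

theorem diag_ext (hm : ∀ i : Fin 3, (![a, b, c] : Fin 3 → ℕ) i ≠ 0) {A B : (flatPerm hm).ker}
    (h : ∀ j, A.1.1.val j j = B.1.1.val j j) : A = B := by
  refine Subtype.ext (Subtype.ext (Units.ext ?_))
  rw [(flatPerm_ker_spec hm A).2.1, (flatPerm_ker_spec hm B).2.1]
  congr 1
  exact funext h

theorem diag_mul (hm : ∀ i : Fin 3, (![a, b, c] : Fin 3 → ℕ) i ≠ 0) (A B : (flatPerm hm).ker) (j : Fin 3) :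
    (A * B).1.1.val j j = A.1.1.val j j * B.1.1.val j j := by
  have : (A * B).1.1.val = A.1.1.val * B.1.1.val := rfl
  rw [this, (flatPerm_ker_spec hm A).2.1, (flatPerm_ker_spec hm B).2.1, monoMat_mul]
  simp [monoMat]

/-- The logarithms of the absolute values of the diagonal entries, in terms of the first two. -/
def diagLog (a b c : ℕ) (x : ℝ × ℝ) : V := ![x.1, x.2, -((a * x.1 + b * x.2) / c)]

theorem prod_diag (hc : c ≠ 0) (x : ℝ × ℝ) {ε : Fin 3 → ℤˣ} (hε : ε ∈ signGroup ![a, b, c]) :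
    ∏ j, ((ε j : ℝ) * Real.exp (diagLog a b c x j)) ^ (![a, b, c] : Fin 3 → ℕ) j = 1 := by
  have hc' : (c : ℝ) ≠ 0 := by exact_mod_cast hc
  have h1 : ∏ j, (ε j : ℝ) ^ (![a, b, c] : Fin 3 → ℕ) j = 1 := by
    have := congrArg (fun u : ℤˣ => (u : ℝ)) (mem_signGroup.1 hε)
    push_cast at this
    exact this
  simp only [mul_pow, Finset.prod_mul_distrib, h1, one_mul, ← Real.exp_nat_mul, ← Real.exp_sum]
  rw [Real.exp_eq_one_iff, Fin.sum_univ_three]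
  simp [diagLog]
  field_simp
  ring

theorem diag_entry_ne_zero (x : ℝ × ℝ) (ε : Fin 3 → ℤˣ) (j : Fin 3) :
    (ε j : ℝ) * Real.exp (diagLog a b c x j) ≠ 0 :=
  mul_ne_zero (unit_cast_ne_zero _) (Real.exp_pos _).ne'

theorem signs_mem_signGroup {m : Fin 3 → ℕ} {d : V} (hd : ∀ j, d j ≠ 0)
    (h : ∏ j, d j ^ m j = 1) : (fun j => signUnit (d j)) ∈ signGroup m := by
  rw [← prod_pow_pos_iff (v := d), h]
  · exact one_pos
  · exact fun j => (signUnit_eq_iff (hd j)).1 rfl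

theorem diagLog_log (hc : c ≠ 0) {d : V} (hd : ∀ j, d j ≠ 0)
    (h : ∏ j, d j ^ (![a, b, c] : Fin 3 → ℕ) j = 1) (j : Fin 3) :
    diagLog a b c (Real.log |d 0|, Real.log |d 1|) j = Real.log |d j| := by
  have hc' : (c : ℝ) ≠ 0 := by exact_mod_cast hc
  have h1 := congrArg Real.log h
  rw [Real.log_prod fun i _ => pow_ne_zero _ (hd i), Real.log_one, Fin.sum_univ_three] at h1
  simp only [Real.log_pow] at h1
  simp at h1
  fin_cases j
  · rfl
  · rfl
  · simp [diagLog]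
    field_simp
    linear_combination -h1

theorem signUnit_mul_exp_log {x : ℝ} (hx : x ≠ 0) :
    (signUnit x : ℝ) * Real.exp (Real.log |x|) = x := by
  rw [Real.exp_log (abs_pos.2 hx), ← signUnit_mul_self, ← mul_assoc, ← sq, units_cast_sq, one_mul]

/-- The diagonal automorphisms, through logarithms and signs of the diagonal entries. -/
def diagEquiv (hm : ∀ i : Fin 3, (![a, b, c] : Fin 3 → ℕ) i ≠ 0) :
    (flatPerm hm).ker ≃ₜ* Multiplicative (ℝ × ℝ) × signGroup ![a, b, c] where
  toFun A := (Multiplicative.ofAdd (Real.log |A.1.1.val 0 0|, Real.log |A.1.1.val 1 1|),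
    ⟨fun j => signUnit (A.1.1.val j j), signs_mem_signGroup (flatPerm_ker_spec hm A).1
      (flatPerm_ker_spec hm A).2.2⟩)
  invFun x := diagAut hm (fun j => (x.2.1 j : ℝ) * Real.exp (diagLog a b c x.1.toAdd j))
    (diag_entry_ne_zero _ _) (prod_diag (third_ne_zero hm) _ x.2.2)
  left_inv A := by
    obtain ⟨h1, h2, h3⟩ := flatPerm_ker_spec hm A
    refine diag_ext hm fun j => ?_
    refine (diagAut_apply hm _ _ j).trans ?_
    change (signUnit (A.1.1.val j j) : ℝ) *
      Real.exp (diagLog a b c (Real.log |A.1.1.val 0 0|, Real.log |A.1.1.val 1 1|) j) = _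
    rw [diagLog_log (d := fun j => A.1.1.val j j) (third_ne_zero hm) h1 h3, signUnit_mul_exp_log (h1 j)]
  right_inv x := by
    refine Prod.ext ?_ (Subtype.ext (funext fun j => ?_))
    · simp only [diagAut_apply, abs_mul, Real.abs_exp]
      have : ∀ ε : ℤˣ, |(ε : ℝ)| = 1 := fun ε => by
        rw [← sq_eq_sq₀ (abs_nonneg _) zero_le_one, sq_abs, units_cast_sq, one_pow]
      simp only [this, one_mul, Real.log_exp]
      rfl
    · change signUnit ((diagAut hm _ _ _).1.1.val j j) = _
      rw [diagAut_apply, signUnit_unit_mul _ (Real.exp_pos _)]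
  map_mul' A B := by
    obtain ⟨h1, -, -⟩ := flatPerm_ker_spec hm A
    obtain ⟨h2, -, -⟩ := flatPerm_ker_spec hm B
    refine Prod.ext ?_ (Subtype.ext (funext fun j => ?_))
    · simp only [diag_mul, abs_mul, Real.log_mul (abs_ne_zero.2 (h1 _)) (abs_ne_zero.2 (h2 _))]
      rfl
    · change signUnit ((A * B).1.1.val j j) = signUnit (A.1.1.val j j) * signUnit (B.1.1.val j j)
      rw [diag_mul, signUnit_mul (h1 j) (h2 j)]
  continuous_toFun := by
    have hc : ∀ j, Continuous fun A : (flatPerm hm).ker => A.1.1.val j j := fun j =>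
      (continuous_entry j j).comp continuous_subtype_val
    have hl : ∀ j, Continuous fun A : (flatPerm hm).ker => Real.log |A.1.1.val j j| := fun j =>
      (hc j).abs.log fun A => abs_ne_zero.2 ((flatPerm_ker_spec hm A).1 j)
    exact (continuous_ofAdd.comp ((hl 0).prodMk (hl 1))).prodMk (Continuous.subtype_mk
      (continuous_pi fun j => continuous_signUnit (hc j) fun A => (flatPerm_ker_spec hm A).1 j) _)
  continuous_invFun := by
    refine Continuous.subtype_mk (Continuous.subtype_mk (continuous_GL_of_val ?_) _) _
    have hx : Continuous fun x : Multiplicative (ℝ × ℝ) × signGroup ![a, b, c] => x.1.toAdd :=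
      continuous_toAdd.comp continuous_fst
    have hl : ∀ j, Continuous fun x : Multiplicative (ℝ × ℝ) × signGroup ![a, b, c] =>
        diagLog a b c x.1.toAdd j := by
      intro j
      fin_cases j
      · exact continuous_fst.comp hx
      · exact continuous_snd.comp hx
      · exact (((continuous_fst.comp hx).const_mul _).add
          ((continuous_snd.comp hx).const_mul _)).div_const _ |>.neg
    have hs : ∀ j, Continuous fun x : Multiplicative (ℝ × ℝ) × signGroup ![a, b, c] =>
        ((x.2.1 j : ℤˣ) : ℝ) := fun j =>
      (continuous_of_discreteTopology (f := fun u : ℤˣ => (u : ℝ))).comp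
        ((continuous_apply j).comp (continuous_subtype_val.comp continuous_snd))
    refine continuous_matrix fun i j => ?_
    change Continuous fun x : Multiplicative (ℝ × ℝ) × signGroup ![a, b, c] =>
      if i = j then (x.2.1 j : ℝ) * Real.exp (diagLog a b c x.1.toAdd j) else 0
    split_ifs
    · exact (hs j).mul (Real.continuous_exp.comp (hl j))
    · exact continuous_const

theorem isSemidirect_flat (hm : ∀ i : Fin 3, (![a, b, c] : Fin 3 → ℕ) i ≠ 0) :
    IsSemidirect (flatPerm hm).ker (permHom (a := a) (b := b) (c := c)).range := by
  refine isSemidirect_of_section (flatPerm_permHom hm) fun σ hσ => ?_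
  have hc' : (0 : ℝ) < c := by
    have := hm 2
    exact_mod_cast Nat.pos_of_ne_zero this
  -- The logarithms `1`, `2` and a third that is not positive are distinct, so only the trivial
  -- permutation commutes with this diagonal automorphism.
  set d : V := fun j => (((1 : Fin 3 → ℤˣ) j : ℤˣ) : ℝ) * Real.exp (diagLog a b c (1, 2) j) with hd
  have h := hσ _ (diagAut hm d (diag_entry_ne_zero _ _) (prod_diag (third_ne_zero hm) _ (one_mem _))).2
  have h2 : monoMat σ 1 * monoMat 1 d = monoMat 1 d * monoMat σ 1 :=
    congrArg (fun A : autGroup (flatPoly a b c) => A.1.val) h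
  refine Subtype.ext (Equiv.ext fun j => ?_)
  have h3 := congrFun (congrFun h2 (σ.1 j)) j
  rw [monoMat_mul, monoMat_mul, mul_one, one_mul, monoMat_diag, monoMat_diag] at h3
  simp [hd] at h3
  have hneg : -(((a : ℝ) + b * 2) / c) ≤ 0 := neg_nonpos.2 (by positivity)
  have hinj : Function.Injective (diagLog a b c (1, 2)) := by
    intro i j hij
    fin_cases i <;> fin_cases j <;> simp [diagLog] at hij ⊢ <;> linarith
  exact (hinj h3).symm

end FlatAut

/-! ### The sign group -/

theorem signGroup_eq_top {m : Fin 3 → ℕ} (h : ∀ i, Even (m i)) : signGroup m = ⊤ := by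
  refine eq_top_iff.2 fun ε _ => Finset.prod_eq_one fun i _ => ?_
  obtain ⟨l, hl⟩ := h i
  rw [hl, ← two_mul, pow_mul, Int.units_sq, one_pow]

theorem unit_pow_odd (ε : ℤˣ) {n : ℕ} (hn : Odd n) : ε ^ n = ε := by
  obtain ⟨l, rfl⟩ := hn
  rw [pow_succ, pow_mul, Int.units_sq, one_pow, one_mul]

/-- Forgetting the `i`-th sign. -/
def forgetSign (m : Fin 3 → ℕ) (i : Fin 3) : signGroup m →* (Fin 2 → ℤˣ) where
  toFun ε := fun j => ε.1 (i.succAbove j)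
  map_one' := rfl
  map_mul' _ _ := rfl

/-- An odd exponent allows the relation to be solved for its sign, and the other two are free. -/
theorem bijective_forgetSign {m : Fin 3 → ℕ} {i : Fin 3} (hi : Odd (m i)) :
    Function.Bijective (forgetSign m i) := by
  have hmem : ∀ ε : Fin 3 → ℤˣ, ε ∈ signGroup m ↔
      ε i = ∏ j : Fin 2, ε (i.succAbove j) ^ m (i.succAbove j) := by
    intro ε
    rw [mem_signGroup, Fin.prod_univ_succAbove _ i, unit_pow_odd _ hi, mul_eq_one_iff_eq_inv,
      Int.units_inv_eq_self]
  constructor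
  · intro ε δ h
    have h1 : ∀ j, ε.1 (i.succAbove j) = δ.1 (i.succAbove j) := fun j => congrFun h j
    refine Subtype.ext (funext fun l => ?_)
    induction l using i.succAboveCases with
    | x => rw [(hmem _).1 ε.2, (hmem _).1 δ.2]; simp only [h1]
    | p j => exact h1 j
  · intro δ
    refine ⟨⟨i.insertNth (∏ j, δ j ^ m (i.succAbove j)) δ, (hmem _).2 ?_⟩, ?_⟩
    · simp
    · funext j
      simp [forgetSign]

theorem exists_signGroup_equiv {a b c m : ℕ}
    (hm : m = if Even a ∧ Even b ∧ Even c then 3 else 2) :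
    Nonempty (signGroup ![a, b, c] ≃* (Fin m → ℤˣ)) := by
  split_ifs at hm with h
  · subst hm
    rw [signGroup_eq_top (m := ![a, b, c]) fun i => by
      fin_cases i
      · exact h.1
      · exact h.2.1
      · exact h.2.2]
    exact ⟨Subgroup.topEquiv⟩
  · subst hm
    have : ∃ i, Odd ((![a, b, c] : Fin 3 → ℕ) i) := by
      by_contra hcon
      push Not at hcon
      exact h ⟨Nat.not_odd_iff_even.1 (hcon 0), Nat.not_odd_iff_even.1 (hcon 1),
        Nat.not_odd_iff_even.1 (hcon 2)⟩
    obtain ⟨i, hi⟩ := this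
    exact ⟨MulEquiv.ofBijective _ (bijective_forgetSign hi)⟩

/-! ### The permutation group of the exponents -/

theorem card_fixing (i : Fin 3) : Nat.card {σ : Equiv.Perm (Fin 3) // σ i = i} = 2 := by
  rw [Nat.card_eq_fintype_card]
  revert i
  decide

theorem nonempty_mulEquiv_of_card {P : Type} [Group P] (h : Nat.card P = 2) :
    Nonempty (P ≃* Z₂) := by
  have : Fact (Nat.Prime 2) := ⟨Nat.prime_two⟩
  exact ⟨mulEquivOfPrimeCardEq h (by rw [Nat.card_eq_fintype_card]; rfl)⟩

/-- The exponents take the value `l` exactly away from `i`, so preserving them means fixing `i`. -/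
theorem card_stabPerm {m : Fin 3 → ℕ} {i : Fin 3} {l : ℕ} (h : ∀ j, m j = l ↔ j ≠ i) :
    Nat.card (stabPerm m) = 2 := by
  rw [← card_fixing i]
  refine Nat.card_congr (Equiv.subtypeEquivRight fun σ => ?_)
  rw [mem_stabPerm]
  constructor
  · intro hσ
    by_contra hne
    exact (h i).1 ((hσ i).symm.trans ((h (σ i)).2 hne)) rfl
  · intro hσ j
    by_cases hj : j = i
    · rw [hj, hσ]
    · rw [(h j).2 hj, h]
      intro h2
      exact hj (σ.injective (h2.trans hσ.symm))

theorem stabPerm_eq_bot {a b c : ℕ} (hab : a < b) (hbc : b < c) : stabPerm ![a, b, c] = ⊥ := by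
  refine eq_bot_iff.2 fun σ hσ => Subgroup.mem_bot.2 (Equiv.ext fun j => ?_)
  have hinj : Function.Injective (![a, b, c] : Fin 3 → ℕ) := by
    intro i j hij
    fin_cases i <;> fin_cases j <;> simp at hij ⊢ <;> omega
  exact hinj (hσ j)

theorem stabPerm_eq_top (a : ℕ) : stabPerm ![a, a, a] = ⊤ := by
  refine eq_top_iff.2 fun σ _ j => ?_
  have : ∀ i : Fin 3, (![a, a, a] : Fin 3 → ℕ) i = a := fun i => by fin_cases i <;> rfl
  rw [this, this]

theorem flat_case {a b c m : ℕ} (ha : 1 ≤ a) (hab : a ≤ b) (hbc : b ≤ c)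
    (hmm : m = (if Even a ∧ Even b ∧ Even c then 3 else 2)) :
    Nat.card (ConnectedComponents (hyp₁ (flatPoly a b c))) =
        (if Even a ∧ Even b ∧ Even c then 8 else 4) ∧
      (a < b → b < c → Nonempty (autGroup (flatPoly a b c) ≃ₜ* FlatGroup m)) ∧
      ((a = b ∧ b < c) ∨ (a < b ∧ b = c) →
        ∃ N K : Subgroup (autGroup (flatPoly a b c)),
          Nonempty (N ≃ₜ* FlatGroup m) ∧ Nonempty (K ≃* Z₂) ∧ IsSemidirect N K) ∧
      (a = b → b = c →
        ∃ N K : Subgroup (autGroup (flatPoly a b c)),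
          Nonempty (N ≃ₜ* FlatGroup m) ∧ Nonempty (K ≃* Equiv.Perm (Fin 3)) ∧
            IsSemidirect N K) := by
  have hm : ∀ i : Fin 3, (![a, b, c] : Fin 3 → ℕ) i ≠ 0 := by
    intro i
    fin_cases i <;> simp <;> omega
  obtain ⟨e⟩ := exists_signGroup_equiv hmm
  let E : signGroup ![a, b, c] ≃ₜ* (Fin m → ℤˣ) :=
    { e with
      continuous_toFun := continuous_of_discreteTopology
      continuous_invFun := continuous_of_discreteTopology }
  let F : (flatPerm hm).ker ≃ₜ* FlatGroup m :=
    (diagEquiv hm).trans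
      { MulEquiv.prodCongr (MulEquiv.refl (Multiplicative (ℝ × ℝ))) E.toMulEquiv with
        continuous_toFun := continuous_fst.prodMk (E.continuous_toFun.comp continuous_snd)
        continuous_invFun := continuous_fst.prodMk (E.continuous_invFun.comp continuous_snd) }
  obtain ⟨r⟩ := nonempty_range_mulEquiv (flatPerm_permHom hm)
  refine ⟨?_, fun h1 h2 => ?_, fun h => ?_, fun h1 h2 => ?_⟩
  · rw [card_connectedComponents_flatPoly ha (by omega) (by omega), Nat.card_congr e.toEquiv, hmm]
    split_ifs <;> simp
  · have hker : ∀ A, A ∈ (flatPerm hm).ker := fun A => by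
      have h3 : ∀ σ ∈ stabPerm ![a, b, c], σ = 1 := by
        rw [stabPerm_eq_bot h1 h2]
        exact fun σ => Subgroup.mem_bot.1
      exact Subtype.ext (h3 _ (flatPerm hm A).2)
    let I : autGroup (flatPoly a b c) ≃ₜ* (flatPerm hm).ker :=
      { toFun := fun A => ⟨A, hker A⟩
        invFun := fun A => A.1
        left_inv := fun _ => rfl
        right_inv := fun _ => rfl
        map_mul' := fun _ _ => rfl
        continuous_toFun := continuous_id.subtype_mk _
        continuous_invFun := continuous_subtype_val }
    exact ⟨I.trans F⟩
  · have hcard : Nat.card (stabPerm ![a, b, c]) = 2 := by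
      rcases h with ⟨h1, h2⟩ | ⟨h1, h2⟩
      · refine card_stabPerm (i := 2) (l := a) fun j => ?_
        fin_cases j <;> simp <;> omega
      · refine card_stabPerm (i := 0) (l := b) fun j => ?_
        fin_cases j <;> simp <;> omega
    obtain ⟨z⟩ := nonempty_mulEquiv_of_card hcard
    exact ⟨_, _, ⟨F⟩, ⟨r.trans z⟩, isSemidirect_flat hm⟩
  · subst h1 h2
    refine ⟨_, _, ⟨F⟩, ⟨r.trans ?_⟩, isSemidirect_flat hm⟩
    exact (MulEquiv.subgroupCongr (stabPerm_eq_top a)).trans Subgroup.topEquiv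

end SpecialHom

end

open SpecialHom in
theorem theorem1p1 :
    -- every special homogeneous surface is, up to a linear transformation,
    -- contained in the level set of precisely one of the normal forms of its degree
    (∀ (τ : ℕ) (h : Poly) (H : Set V), IsSpecialHomogeneousSurface τ h H →
      ∃ f : NormalForm τ,
        (∃ A : GL3, (∀ v, MvPolynomial.eval (act A v) f.poly = MvPolynomial.eval v h) ∧
          act A '' H ⊆ hyp₁ f.poly) ∧
        ∀ f' : NormalForm τ,
          (∃ A : GL3, act A '' H ⊆ {v | MvPolynomial.eval v f'.poly = 1}) → f' = f) ∧
    -- the normal forms are hyperbolic, the components of their hyperbolic level sets are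
    -- special homogeneous surfaces, and these components are pairwise isometric
    (∀ τ : ℕ, 3 ≤ τ → ∀ f : NormalForm τ,
      IsHyperbolic τ f.poly ∧
      (∀ p ∈ hyp₁ f.poly,
        IsGPSRSurface τ f.poly (connectedComponentIn (hyp₁ f.poly) p) ∧
        ∃ G : Subgroup GL3, IsClosed (G : Set GL3) ∧
          ActsTransitivelyOn G (connectedComponentIn (hyp₁ f.poly) p)) ∧
      ∀ p ∈ hyp₁ f.poly, ∀ q ∈ hyp₁ f.poly,
        AreIsometric τ f.poly (connectedComponentIn (hyp₁ f.poly) p)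
          (connectedComponentIn (hyp₁ f.poly) q)) ∧
    -- (i)
    (∀ τ : ℕ, 3 ≤ τ → Even τ →
      Nat.card (ConnectedComponents (hyp₁ (lorentzPoly τ))) = 2 ∧
      (∀ p ∈ hyp₁ (lorentzPoly τ), IsHomotheticToSO21ModSO2 τ (lorentzPoly τ)
        (connectedComponentIn (hyp₁ (lorentzPoly τ)) p)) ∧
      (∀ p ∈ hyp (lorentzPoly τ), lieDim (stab (lorentzPoly τ) p) = 1) ∧
      autGroup (lorentzPoly τ) = O21) ∧
    -- (ii)
    (∀ τ k : ℕ, 3 ≤ τ → 1 ≤ k → 2 * k < τ →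
      Nat.card (ConnectedComponents (hyp₁ (affinePoly τ k))) = (if Odd τ then 1 else 2) ∧
      Nonempty (Subgroup.connectedComponentOfOne (autGroup (affinePoly τ k)) ≃ₜ* affineGroup) ∧
      (Odd τ → ∃ K : Subgroup (autGroup (affinePoly τ k)), Nonempty (K ≃* Z₂) ∧
        IsSemidirect (Subgroup.connectedComponentOfOne (autGroup (affinePoly τ k))) K) ∧
      (Even τ → ∃ N K : Subgroup (autGroup (affinePoly τ k)),
        Nonempty (N ≃ₜ* Subgroup.connectedComponentOfOne (autGroup (affinePoly τ k)) × Z₂) ∧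
        Nonempty (K ≃* Z₂) ∧ IsSemidirect N K) ∧
      ∀ p ∈ hyp (affinePoly τ k), Nonempty (stab (affinePoly τ k) p ≃* Z₂)) ∧
    -- (iii)
    (∀ a b c m : ℕ, 1 ≤ a → a ≤ b → b ≤ c →
      m = (if Even a ∧ Even b ∧ Even c then 3 else 2) →
      Nat.card (ConnectedComponents (hyp₁ (flatPoly a b c))) =
        (if Even a ∧ Even b ∧ Even c then 8 else 4) ∧
      (a < b → b < c → Nonempty (autGroup (flatPoly a b c) ≃ₜ* FlatGroup m)) ∧
      ((a = b ∧ b < c) ∨ (a < b ∧ b = c) →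
        ∃ N K : Subgroup (autGroup (flatPoly a b c)),
          Nonempty (N ≃ₜ* FlatGroup m) ∧ Nonempty (K ≃* Z₂) ∧ IsSemidirect N K) ∧
      (a = b → b = c →
        ∃ N K : Subgroup (autGroup (flatPoly a b c)),
          Nonempty (N ≃ₜ* FlatGroup m) ∧ Nonempty (K ≃* Equiv.Perm (Fin 3)) ∧
            IsSemidirect N K)) := by
  exact ⟨classification, fun τ hτ f => f.homogeneous hτ, fun τ hτ he => lorentz_case hτ he,
    fun τ k _ hk hkτ => affine_case hk hkτ, fun a b c m ha hab hbc hm => flat_case ha hab hbc hm⟩
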